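/- Let $m\in\mathbb{R}$ and let $\hat g$ be the spatial Schwarzschild metric of mass $m$, $\hat g=(1-\frac{2m}{R})^{-1}dR^2+R^2(d\Theta^2+\sin^2\Theta\,d\varphi^2)$, i.e. $\hat g_{ij}=\delta_{ij}+\big((1-\frac{2m}{R})^{-1}-1\big)\frac{x^ix^j}{R^2}$ with $R=|x|$ the Euclidean distance in $\mathbb{R}^3$. A smooth 3-manifold $M$ with a Riemannian metric $g$ (of class $C^3$ at least) is called asymptotically Schwarzschild with mass $m$ if there is a compact set $K\subset M$ and a diffeomorphism of $M\setminus K$ onto the exterior $\{|x|>R_0\}$ of a ball in $\mathbb{R}^3$ in whose coordinates $g=\hat g+\tau$ with $$|\tau|+R|\partial\tau|+R^2|\partial\partial\tau|+R^3|\partial\partial\partial\tau|=O(R^{-2})\quad (R\to\infty).$$ For $b\ge 1$ and $a$ large let $\Sigma_a=\{(x^1)^2+(x^2)^2+(x^3)^2/b^2=a^2\}$. The Hayward mass of $\Sigma_a$, as a surface in a time-symmetric slice of a static spacetime with spatial metric $g$, is $$\mathfrak m(\Sigma_a,g)=\frac{1}{8\pi}\sqrt{\frac{|\Sigma_a|}{16\pi}}\int_{\Sigma_a}\Big(R_\sigma-\tfrac12H^2+|\mathring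 A|^2\Big)\,d\sigma ,$$ where $\sigma$ is the induced metric, $|\Sigma_a|$ its area, $R_\sigma$ its scalar curvature, $A$ the second fundamental form with respect to the outward unit normal, $H=\mathrm{tr}_\sigma A$ and $\mathring A=A-\frac H2\sigma$. Then for every $b\ge1$ the limit $\mathfrak m_\infty(b)=\lim_{a\to\infty}\mathfrak m(\Sigma_a,\hat g)$ exists and is finite, and for every asymptotically Schwarzschild $(M,g)$ with mass $m$ $$\lim_{a\to\infty}\mathfrak m(\Sigma_a,g)=\lim_{a\to\infty}\mathfrak m(\Sigma_a,\hat g)=\mathfrak m_\infty(b).$$ Moreover, if $m>0$, there is a constant $C>0$, independent of $b$ and of $(M,g)$, such that $\mathfrak m_\infty(b)\ge C$ for all $b\ge 1$; hence $\lim_{a\to\infty}\mathfrak m(\Sigma_a,g)\ge C>0$. -/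

import Mathlib

open scoped Manifold ContDiff Topology

noncomputable section

namespace HaywardMass

/-! ### Riemannian geometry in coordinates -/

/-- The partial derivative `∂ᵢ f` at `x`. -/
def pd {n : ℕ} (i : Fin n) (f : EuclideanSpace ℝ (Fin n) → ℝ) (x : EuclideanSpace ℝ (Fin n)) : ℝ :=
  fderiv ℝ f x (EuclideanSpace.single i 1)

/-- The coordinate components `gᵢⱼ(x)` of a metric, as a matrix depending on the point. -/
abbrev MetricField (n : ℕ) : Type := EuclideanSpace ℝ (Fin n) → Matrix (Fin n) (Fin n) ℝ

/-- The Christoffel symbol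
`Γᵏᵢⱼ = ½ gᵏˡ (∂ᵢ gⱼₗ + ∂ⱼ gᵢₗ - ∂ₗ gᵢⱼ)` of the Levi-Civita connection. -/
def christoffel {n : ℕ} (G : MetricField n) (k i j : Fin n) (x : EuclideanSpace ℝ (Fin n)) : ℝ :=
  (1 / 2) * ∑ l, (G x)⁻¹ k l *
    (pd i (fun y => G y j l) x + pd j (fun y => G y i l) x - pd l (fun y => G y i j) x)

/-- The Ricci tensor
`Ricᵢⱼ = ∂ₖ Γᵏᵢⱼ - ∂ⱼ Γᵏᵢₖ + Γᵏₖₗ Γˡᵢⱼ - Γᵏⱼₗ Γˡᵢₖ`. -/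
def ricci {n : ℕ} (G : MetricField n) (i j : Fin n) (x : EuclideanSpace ℝ (Fin n)) : ℝ :=
  ∑ k, (pd k (christoffel G k i j) x - pd j (christoffel G k i k) x) +
    ∑ k, ∑ l, (christoffel G k k l x * christoffel G l i j x -
      christoffel G k j l x * christoffel G l i k x)

/-- The scalar curvature `gⁱʲ Ricᵢⱼ`. -/
def scalarCurvature {n : ℕ} (G : MetricField n) (x : EuclideanSpace ℝ (Fin n)) : ℝ :=
  ∑ i, ∑ j, (G x)⁻¹ i j * ricci G i j x

/-! ### The ellipsoids `(x¹)² + (x²)² + (x³)²/b² = a²` -/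

/-- The function `(x¹)² + (x²)² + (x³)²/b²`, whose level set of height `a²` is `Σ_a`. -/
def ellipsoidFun (b : ℝ) (x : EuclideanSpace ℝ (Fin 3)) : ℝ :=
  x 0 ^ 2 + x 1 ^ 2 + x 2 ^ 2 / b ^ 2

/-- The parametrization of `Σ_a` by `u = (θ, φ)`, with `0 < θ < π` and `0 < φ < 2π`
(which covers `Σ_a` up to a null set). -/
def ellipsoidParam (a b : ℝ) (u : EuclideanSpace ℝ (Fin 2)) : EuclideanSpace ℝ (Fin 3) :=
  !₂[a * Real.sin (u 0) * Real.cos (u 1), a * Real.sin (u 0) * Real.sin (u 1),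
    a * b * Real.cos (u 0)]

/-- The component `(∂_α X)ⁱ` of a coordinate tangent vector of the ellipsoid. -/
def tangentVec (a b : ℝ) (α : Fin 2) (i : Fin 3) (u : EuclideanSpace ℝ (Fin 2)) : ℝ :=
  pd α (fun v => ellipsoidParam a b v i) u

/-- The induced metric `σ` on the ellipsoid, in the coordinates `(θ, φ)`. -/
def inducedMetric (G : MetricField 3) (a b : ℝ) : MetricField 2 := fun u =>
  Matrix.of fun α β => ∑ i, ∑ j,
    G (ellipsoidParam a b u) i j * tangentVec a b α i u * tangentVec a b β j u

/-- The component `nᵏ` of the unit vector field `n = ∇f / |∇f|`, `f = ellipsoidFun b`, where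
gradient and length are those of the metric `G`. Along the ellipsoids it is the outward unit
normal `e₁`. -/
def unitNormal (G : MetricField 3) (b : ℝ) (k : Fin 3) (x : EuclideanSpace ℝ (Fin 3)) : ℝ :=
  (∑ l, (G x)⁻¹ k l * pd l (ellipsoidFun b) x) /
    √(∑ i, ∑ j, (G x)⁻¹ i j * pd i (ellipsoidFun b) x * pd j (ellipsoidFun b) x)

/-- The component `(∇ᵢ n)ᵏ = ∂ᵢ nᵏ + Γᵏᵢⱼ nʲ` of the covariant derivative of the unit normal. -/
def covNormal (G : MetricField 3) (b : ℝ) (i k : Fin 3) (x : EuclideanSpace ℝ (Fin 3)) : ℝ :=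
  pd i (unitNormal G b k) x + ∑ j, christoffel G k i j x * unitNormal G b j x

/-- The second fundamental form `A(X, Y) = g(∇_X n, Y)` of the ellipsoid, in the coordinates
`(θ, φ)`. -/
def secondFF (G : MetricField 3) (a b : ℝ) (α β : Fin 2) (u : EuclideanSpace ℝ (Fin 2)) : ℝ :=
  ∑ i, ∑ k, ∑ j, tangentVec a b α i u * covNormal G b i k (ellipsoidParam a b u) *
    G (ellipsoidParam a b u) k j * tangentVec a b β j u

/-- The mean curvature `H = σ^{αβ} A_{αβ}`. -/
def meanCurvature (G : MetricField 3) (a b : ℝ) (u : EuclideanSpace ℝ (Fin 2)) : ℝ :=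
  ∑ α, ∑ β, (inducedMetric G a b u)⁻¹ α β * secondFF G a b α β u

/-- The trace free part `Å = A - (H/2) σ` of the second fundamental form. -/
def traceFreeFF (G : MetricField 3) (a b : ℝ) (α β : Fin 2) (u : EuclideanSpace ℝ (Fin 2)) : ℝ :=
  secondFF G a b α β u - meanCurvature G a b u / 2 * inducedMetric G a b u α β

/-- `|Å|² = σ^{αγ} σ^{βδ} Å_{αβ} Å_{γδ}`. -/
def traceFreeNormSq (G : MetricField 3) (a b : ℝ) (u : EuclideanSpace ℝ (Fin 2)) : ℝ :=
  ∑ α, ∑ β, ∑ γ, ∑ δ, (inducedMetric G a b u)⁻¹ α γ * (inducedMetric G a b u)⁻¹ β δ *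
    traceFreeFF G a b α β u * traceFreeFF G a b γ δ u

/-- The integral `∫_{Σ_a} f dσ` with respect to the area form `√(det σ) dθ dφ`. -/
def surfaceIntegral (G : MetricField 3) (a b : ℝ) (f : EuclideanSpace ℝ (Fin 2) → ℝ) : ℝ :=
  ∫ θ in (0 : ℝ)..Real.pi, ∫ φ in (0 : ℝ)..(2 * Real.pi),
    f !₂[θ, φ] * √(inducedMetric G a b !₂[θ, φ]).det

/-- The area `|Σ_a|`. -/
def area (G : MetricField 3) (a b : ℝ) : ℝ :=
  surfaceIntegral G a b fun _ => 1

/-- The Hayward mass of the ellipsoid `Σ_a` with respect to the metric `G`,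
`(1/8π) √(|Σ|/16π) ∫_Σ (R_σ - H²/2 + |Å|²) dσ`.
In general the integrand is `R_σ + θ₊θ₋ - ½ σ⁺ᵢⱼ σ₋ⁱʲ - 2 ωᵏωₖ`; for a surface in a time-symmetric
slice of a static spacetime `ω = 0`, `θ± = ±H/√2` and the shears are `±√2 Å`. By Gauss-Bonnet the
mass is also `√(|Σ|/16π) (1 - (1/8π) ∫_Σ (H² - |A|²) dσ)`. -/
def haywardMass (G : MetricField 3) (a b : ℝ) : ℝ :=
  1 / (8 * Real.pi) * √(area G a b / (16 * Real.pi)) *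
    surfaceIntegral G a b fun u =>
      scalarCurvature (inducedMetric G a b) u - meanCurvature G a b u ^ 2 / 2 +
        traceFreeNormSq G a b u

/-! ### Asymptotically Schwarzschild manifolds -/

/-- The spatial Schwarzschild metric `(1 - 2m/R)⁻¹ dR² + R² (dΘ² + sin²Θ dφ²)` of mass `m` in the
Cartesian coordinates of the area radius `R = |x|`:
`ĝᵢⱼ = δᵢⱼ + ((1 - 2m/R)⁻¹ - 1) xᵢ xⱼ / R²`. -/
def schwarzschild (m : ℝ) : MetricField 3 := fun x =>
  Matrix.of fun i j =>
    (if i = j then 1 else 0) + ((1 - 2 * m / ‖x‖)⁻¹ - 1) * (x i * x j / ‖x‖ ^ 2)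

/-- The components `gᵢⱼ(x)` of a Riemannian metric on a 3-manifold in the chart `Φ`. -/
def chartMetric {M : Type*} [TopologicalSpace M] [ChartedSpace (EuclideanSpace ℝ (Fin 3)) M]
    [IsManifold (𝓡 3) ∞ M]
    (g : Bundle.ContMDiffRiemannianMetric (𝓡 3) 3 (EuclideanSpace ℝ (Fin 3))
      (fun p : M => TangentSpace (𝓡 3) p))
    (Φ : OpenPartialHomeomorph M (EuclideanSpace ℝ (Fin 3))) : MetricField 3 := fun x =>
  Matrix.of fun i j => g.inner (Φ.symm x)
    (mfderiv (𝓡 3) (𝓡 3) Φ.symm x (EuclideanSpace.single i (1 : ℝ)))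
    (mfderiv (𝓡 3) (𝓡 3) Φ.symm x (EuclideanSpace.single j (1 : ℝ)))

/-- `(M, g)` is asymptotically Schwarzschild with mass `m` in the chart `Φ` at infinity: `Φ` maps
the complement of a compact set diffeomorphically onto the exterior of a ball in `ℝ³`, and there
`g = ĝ + τ` with `|τ| + R|∂τ| + R²|∂∂τ| + R³|∂∂∂τ| = O(R⁻²)`. -/
structure IsAsymptoticallySchwarzschild {M : Type*} [TopologicalSpace M]
    [ChartedSpace (EuclideanSpace ℝ (Fin 3)) M] [IsManifold (𝓡 3) ∞ M] (m : ℝ)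
    (g : Bundle.ContMDiffRiemannianMetric (𝓡 3) 3 (EuclideanSpace ℝ (Fin 3))
      (fun p : M => TangentSpace (𝓡 3) p))
    (Φ : OpenPartialHomeomorph M (EuclideanSpace ℝ (Fin 3))) : Prop where
  mem_maximalAtlas : Φ ∈ IsManifold.maximalAtlas (𝓡 3) ∞ M
  isCompact_compl_source : IsCompact Φ.sourceᶜ
  target_eq : ∃ R₀ : ℝ, Φ.target = {x | R₀ < ‖x‖}
  decay : ∀ i j : Fin 3, ∀ k : ℕ, k ≤ 3 →
    (fun x => ‖x‖ ^ k * ‖iteratedFDeriv ℝ k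
      (fun y => chartMetric g Φ y i j - schwarzschild m y i j) x‖)
      =O[Bornology.cobounded (EuclideanSpace ℝ (Fin 3))] fun x => 1 / ‖x‖ ^ 2

end HaywardMass

end

/-!
In dimension two `H² - |A|² - H²/2 + |Å|² = 0`, so the traced Gauss equation
`R_σ = R - 2 Ric(n, n) + H² - |A|²` turns the integrand of the Hayward mass into the function
`R - 2 Ric(n, n)` of the ambient metric (`scalarCurvature_pullback`, `integrand_eq_massDensity`). No
derivative of the unit normal is left, and only two derivatives of the metric enter.

Rescaling by `a` moves `Σ_a` to the fixed ellipsoid `Σ_1` and replaces `G` by `y ↦ G(a y)`; the area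
contributes a factor `a` to the mass, the integral a factor `a⁻¹` and the function
`a (R - 2 Ric(n, n))` of the rescaled metric (`haywardMass_eq`). If
`G(a y) = δ + h(y) / a + o(1 / a)` with two derivatives, locally uniformly in `y ≠ 0`
(`HasExpansion`), this function converges uniformly on `Σ_1`: the quadratic terms of the curvature
are `O(a⁻²)`, and what is left is the linearization `linMassDensity h`. So the mass has a limit
which depends on `h` and `b` only (`HasExpansion.tendsto_haywardMass`). The Schwarzschild metric has
such an expansion with `h = 2 m yᵢ yⱼ / |y|³`, being a smooth function of `1 / a` and `y`, and a
perturbation `τ` with `|∂ᵏτ| = O(R^{-2-k})` does not change `h` (`hasExpansion_schwarzschild`,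
`hasExpansion_of_decay`). For a Riemannian metric on a manifold, its components in the chart at
infinity are of class `C³` (`contDiffAt_chartMetric`); only `C²` is used.

For the positivity, the linearized Ricci tensor of `h` is `m / |y|³ (δ - 3 y ⊗ y / |y|²)`
(`linRicci_schwarzschildLin`). On `Σ_1`, with `t = cos θ`, `p² = |y|² = 1 + (b² - 1) t²` and
`q² = b² - (b² - 1) t²`, the limit of the integral is
`4 π m ∫_{-1}^{1} (3 b² / (p² q²) - 1) q / p³ dt`. The integrand changes sign when `b` is large, but
it exceeds the derivative of `W(t) = q (t / p³ + t / p) + t³ / 3 - t / (b p)` by a sum of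
nonnegative terms (`le_massProfile`), and `W(1) - W(-1) = 2 (1/3 + 1/b - 1/b² + 1/b³) ≥ 2/3`. Since
the area of `Σ_1` is at least `4 π`, the limit is at least `m / 6`.
-/

noncomputable section

namespace HaywardMass

/-! ### Calculus of partial derivatives -/

/-- The Euclidean space `ℝⁿ` on which metrics in coordinates live. -/
abbrev Euc (n : ℕ) : Type := EuclideanSpace ℝ (Fin n)

section PartialDerivatives

variable {n p : ℕ} {f g : Euc n → ℝ} {x : Euc n}

theorem pd_congr (i : Fin n) (h : f =ᶠ[𝓝 x] g) : pd i f x = pd i g x := by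
  simp only [pd, h.fderiv_eq]

theorem pd_eventuallyEq (i : Fin n) (h : f =ᶠ[𝓝 x] g) : pd i f =ᶠ[𝓝 x] pd i g :=
  h.eventuallyEq_nhds.mono fun _ hy => pd_congr i hy

@[simp] theorem pd_const (i : Fin n) (c : ℝ) : pd i (fun _ : Euc n => c) x = 0 := by
  simp [pd]

theorem pd_add (i : Fin n) (hf : DifferentiableAt ℝ f x) (hg : DifferentiableAt ℝ g x) :
    pd i (fun y => f y + g y) x = pd i f x + pd i g x := by
  simp only [pd, fderiv_fun_add hf hg, add_apply]

theorem pd_sub (i : Fin n) (hf : DifferentiableAt ℝ f x) (hg : DifferentiableAt ℝ g x) :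
    pd i (fun y => f y - g y) x = pd i f x - pd i g x := by
  simp only [pd, fderiv_fun_sub hf hg, sub_apply]

theorem pd_mul (i : Fin n) (hf : DifferentiableAt ℝ f x) (hg : DifferentiableAt ℝ g x) :
    pd i (fun y => f y * g y) x = pd i f x * g x + f x * pd i g x := by
  simp only [pd, fderiv_fun_mul hf hg, add_apply,
    smul_apply, smul_eq_mul]
  ring

theorem pd_const_mul (i : Fin n) (c : ℝ) (f : Euc n → ℝ) (x : Euc n) :
    pd i (fun y => c * f y) x = c * pd i f x := by
  have : (fun y => c * f y) = c • f := rfl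
  simp only [pd, this, fderiv_const_smul_field, Pi.smul_apply, smul_apply,
    smul_eq_mul]

theorem pd_sum {ι : Type*} (s : Finset ι) {F : ι → Euc n → ℝ} (i : Fin n)
    (h : ∀ a ∈ s, DifferentiableAt ℝ (F a) x) :
    pd i (fun y => ∑ a ∈ s, F a y) x = ∑ a ∈ s, pd i (F a) x := by
  simp only [pd, fderiv_fun_sum h, sum_apply]

theorem pd_smul_arg (i : Fin n) (c : ℝ) (f : Euc n → ℝ) (x : Euc n) :
    pd i (fun y => f (c • y)) x = c * pd i f (c • x) := by
  simp only [pd, fderiv_comp_smul, smul_apply, smul_eq_mul]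

theorem _root_.ContDiffAt.pd {k l : WithTop ℕ∞} (hf : ContDiffAt ℝ k f x) (i : Fin n)
    (hkl : l + 1 ≤ k) : ContDiffAt ℝ l (pd i f) x :=
  (hf.fderiv_right hkl).clm_apply contDiffAt_const

theorem pd_pd_eq_fderiv_fderiv (hf : ContDiffAt ℝ 2 f x) (i j : Fin n) :
    pd i (pd j f) x =
      fderiv ℝ (fderiv ℝ f) x (EuclideanSpace.single i 1) (EuclideanSpace.single j 1) := by
  have hd : DifferentiableAt ℝ (fderiv ℝ f) x :=
    (hf.fderiv_right (m := 1) (by norm_num)).differentiableAt (by norm_num)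
  have := fderiv_clm_apply hd (differentiableAt_const (EuclideanSpace.single j (1 : ℝ)))
  change fderiv ℝ (fun y => (fderiv ℝ f y) (EuclideanSpace.single j 1)) x _ = _
  rw [this]
  simp

theorem pd_comm (hf : ContDiffAt ℝ 2 f x) (i j : Fin n) :
    pd i (pd j f) x = pd j (pd i f) x := by
  rw [pd_pd_eq_fderiv_fderiv hf, pd_pd_eq_fderiv_fderiv hf]
  exact (hf.isSymmSndFDerivAt (by simp)) _ _

/-- The chain rule for partial derivatives. -/
theorem pd_comp {X : Euc p → Euc n} {v : Euc p} (α : Fin p) (hf : DifferentiableAt ℝ f (X v))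
    (hX : DifferentiableAt ℝ X v) :
    pd α (fun w => f (X w)) v = ∑ i, pd i f (X v) * pd α (fun w => X w i) v := by
  have h1 : fderiv ℝ (fun w => f (X w)) v = (fderiv ℝ f (X v)).comp (fderiv ℝ X v) :=
    fderiv_comp v hf hX
  have h2 : fderiv ℝ X v (EuclideanSpace.single α 1) =
      ∑ i, pd α (fun w => X w i) v • EuclideanSpace.single i (1 : ℝ) := by
    ext j
    have : pd α (fun w => X w j) v = (fderiv ℝ X v (EuclideanSpace.single α 1)) j := by
      have := ((EuclideanSpace.proj j : Euc n →L[ℝ] ℝ).hasFDerivAt (x := X v)).comp v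
        hX.hasFDerivAt
      have h3 := this.fderiv
      simp only [pd]
      change fderiv ℝ ((EuclideanSpace.proj j : Euc n →L[ℝ] ℝ) ∘ X) v _ = _
      rw [h3]; rfl
    rw [← this]
    simp [Finset.sum_apply, Pi.single_apply]
  simp only [pd, h1, ContinuousLinearMap.comp_apply]
  rw [h2]
  simp [map_sum, pd, mul_comm]

end PartialDerivatives

section MatrixFields

variable {n d : ℕ} {k : WithTop ℕ∞} {G : Euc n → Matrix (Fin d) (Fin d) ℝ} {x : Euc n}

theorem contDiffAt_det (hG : ∀ i j, ContDiffAt ℝ k (fun y => G y i j) x) :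
    ContDiffAt ℝ k (fun y => (G y).det) x := by
  simp only [Matrix.det_apply']
  exact ContDiffAt.sum fun σ _ => contDiffAt_const.mul (contDiffAt_prod fun i _ => hG _ _)

theorem contDiffAt_inv_entry (hG : ∀ i j, ContDiffAt ℝ k (fun y => G y i j) x)
    (hdet : (G x).det ≠ 0) (i j : Fin d) : ContDiffAt ℝ k (fun y => (G y)⁻¹ i j) x := by
  simp only [Matrix.inv_def, Ring.inverse_eq_inv', Matrix.smul_apply, smul_eq_mul,
    Matrix.adjugate_apply]
  refine ((contDiffAt_det hG).inv hdet).mul (contDiffAt_det fun a c => ?_)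
  simp only [Matrix.updateRow_apply]
  split_ifs
  · exact contDiffAt_const
  · exact hG _ _

theorem eventually_det_ne_zero (hG : ∀ i j, ContDiffAt ℝ k (fun y => G y i j) x)
    (hdet : (G x).det ≠ 0) : ∀ᶠ y in 𝓝 x, (G y).det ≠ 0 :=
  (contDiffAt_det hG).continuousAt.eventually_ne hdet

/-- `∂(G⁻¹) = - G⁻¹ (∂G) G⁻¹`. -/
theorem pd_inv_entry (hG : ∀ i j, ContDiffAt ℝ 1 (fun y => G y i j) x)
    (hdet : (G x).det ≠ 0) (m : Fin n) (i j : Fin d) :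
    pd m (fun y => (G y)⁻¹ i j) x =
      -∑ q, ∑ p, (G x)⁻¹ i p * pd m (fun y => G y p q) x * (G x)⁻¹ q j := by
  have hd : ∀ i j, DifferentiableAt ℝ (fun y => G y i j) x :=
    fun i j => (hG i j).differentiableAt (by norm_num)
  have hdi : ∀ i j, DifferentiableAt ℝ (fun y => (G y)⁻¹ i j) x :=
    fun i j => (contDiffAt_inv_entry hG hdet i j).differentiableAt (by norm_num)
  have key : ∀ q, ∑ p, pd m (fun y => (G y)⁻¹ i p) x * G x p q =
      -∑ p, (G x)⁻¹ i p * pd m (fun y => G y p q) x := by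
    intro q
    have h0 : pd m (fun y => ∑ p, (G y)⁻¹ i p * G y p q) x = 0 := by
      rw [pd_congr (g := fun _ => (1 : Matrix (Fin d) (Fin d) ℝ) i q), pd_const]
      filter_upwards [eventually_det_ne_zero hG hdet] with y hy
      rw [← Matrix.mul_apply, Matrix.nonsing_inv_mul _ (isUnit_iff_ne_zero.mpr hy)]
    rw [pd_sum _ _ fun p _ => (hdi i p).fun_mul (hd p q)] at h0
    simp only [pd_mul m (hdi _ _) (hd _ _), Finset.sum_add_distrib] at h0
    linarith
  have h1 : ∀ p, ∑ q, G x p q * (G x)⁻¹ q j = if p = j then 1 else 0 := by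
    intro p
    rw [← Matrix.mul_apply, Matrix.mul_nonsing_inv _ (isUnit_iff_ne_zero.mpr hdet),
      Matrix.one_apply]
  calc pd m (fun y => (G y)⁻¹ i j) x
      = ∑ p, pd m (fun y => (G y)⁻¹ i p) x * ∑ q, G x p q * (G x)⁻¹ q j := by simp [h1]
    _ = ∑ q, (∑ p, pd m (fun y => (G y)⁻¹ i p) x * G x p q) * (G x)⁻¹ q j := by
        simp only [Finset.mul_sum, Finset.sum_mul]
        rw [Finset.sum_comm]
        simp only [mul_assoc]
    _ = _ := by
        simp only [key, Finset.sum_mul, neg_mul, Finset.sum_neg_distrib]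

end MatrixFields

/-! ### The lowered curvature tensor -/

section Curvature

variable {n : ℕ}

/-- The Christoffel symbol of the first kind `Γ_{ij,p} = ½ (∂ᵢ gⱼₚ + ∂ⱼ gᵢₚ - ∂ₚ gᵢⱼ)`. -/
def lowChristoffel (G : MetricField n) (p i j : Fin n) (x : Euc n) : ℝ :=
  (1 / 2) * (pd i (fun y => G y j p) x + pd j (fun y => G y i p) x - pd p (fun y => G y i j) x)

/-- The Riemann tensor `R_{pimj}` with all indices lowered, so that `Ricᵢⱼ = gᵏᵖ R_{pikj}`, in terms
of the Christoffel symbols of the first kind. -/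
def lowRiemann (G : MetricField n) (p i m j : Fin n) (x : Euc n) : ℝ :=
  pd m (lowChristoffel G p i j) x - pd j (lowChristoffel G p i m) x -
    ∑ k, christoffel G k i j x * lowChristoffel G k m p x +
    ∑ k, christoffel G k i m x * lowChristoffel G k j p x

/-- The Riemann tensor `Rᵏᵢₘⱼ = ∂ₘ Γᵏᵢⱼ - ∂ⱼ Γᵏᵢₘ + Γᵏₘₗ Γˡᵢⱼ - Γᵏⱼₗ Γˡᵢₘ`. -/
def riemann (G : MetricField n) (k i m j : Fin n) (x : Euc n) : ℝ :=
  pd m (christoffel G k i j) x - pd j (christoffel G k i m) x +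
    ∑ l, (christoffel G k m l x * christoffel G l i j x -
      christoffel G k j l x * christoffel G l i m x)

/-- A nondegenerate symmetric `C²` metric near the point `x`. -/
structure IsRegularAt (G : MetricField n) (x : Euc n) : Prop where
  contDiffAt : ∀ i j, ContDiffAt ℝ 2 (fun y => G y i j) x
  symm : ∀ᶠ y in 𝓝 x, ∀ i j, G y i j = G y j i
  det_ne_zero : (G x).det ≠ 0

theorem christoffel_eq (G : MetricField n) (k i j : Fin n) (x : Euc n) :
    christoffel G k i j x = ∑ l, (G x)⁻¹ k l * lowChristoffel G l i j x := by
  simp only [christoffel, lowChristoffel, Finset.mul_sum]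
  exact Finset.sum_congr rfl fun l _ => by ring

variable {G : MetricField n} {x : Euc n}

namespace IsRegularAt

theorem isUnit_det (h : IsRegularAt G x) : IsUnit (G x).det :=
  isUnit_iff_ne_zero.mpr h.det_ne_zero

theorem symm_at (h : IsRegularAt G x) (i j : Fin n) : G x i j = G x j i :=
  h.symm.self_of_nhds i j

theorem inv_symm (h : IsRegularAt G x) (i j : Fin n) : (G x)⁻¹ i j = (G x)⁻¹ j i := by
  have : (G x).transpose = G x := by ext i j; exact h.symm_at j i
  conv_lhs => rw [← this, ← Matrix.transpose_nonsing_inv, Matrix.transpose_apply]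

theorem eventually (h : IsRegularAt G x) : ∀ᶠ y in 𝓝 x, IsRegularAt G y := by
  have h1 : ∀ᶠ y in 𝓝 x, ∀ i j, ContDiffAt ℝ 2 (fun y => G y i j) y := by
    simp only [Filter.eventually_all]
    exact fun i j => (h.contDiffAt i j).eventually (by simp)
  filter_upwards [h1, h.symm.eventually_nhds, eventually_det_ne_zero h.contDiffAt h.det_ne_zero]
    with y a b c using ⟨a, b, c⟩

theorem pd_symm (h : IsRegularAt G x) (m i j : Fin n) :
    pd m (fun y => G y i j) x = pd m (fun y => G y j i) x :=
  pd_congr m (h.symm.mono fun _ hy => hy i j)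

theorem differentiableAt (h : IsRegularAt G x) (i j : Fin n) :
    DifferentiableAt ℝ (fun y => G y i j) x :=
  (h.contDiffAt i j).differentiableAt (by norm_num)

theorem lowChristoffel_symm (h : IsRegularAt G x) (p i j : Fin n) :
    lowChristoffel G p i j x = lowChristoffel G p j i x := by
  simp only [lowChristoffel, h.pd_symm p i j]
  ring

theorem christoffel_symm (h : IsRegularAt G x) (k i j : Fin n) :
    christoffel G k i j x = christoffel G k j i x := by
  simp only [christoffel_eq, h.lowChristoffel_symm]

/-- Metric compatibility of the Levi-Civita connection. -/
theorem pd_eq_lowChristoffel (h : IsRegularAt G x) (m i j : Fin n) :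
    pd m (fun y => G y i j) x = lowChristoffel G j m i x + lowChristoffel G i m j x := by
  simp only [lowChristoffel, h.pd_symm m j i, h.pd_symm i m j, h.pd_symm j m i]
  ring

theorem contDiffAt_lowChristoffel (h : IsRegularAt G x) (p i j : Fin n) :
    ContDiffAt ℝ 1 (lowChristoffel G p i j) x := by
  have := fun m i j => (h.contDiffAt i j).pd (l := 1) m (by norm_num)
  exact contDiffAt_const.mul (((this _ _ _).add (this _ _ _)).sub (this _ _ _))

theorem differentiableAt_lowChristoffel (h : IsRegularAt G x) (p i j : Fin n) :
    DifferentiableAt ℝ (lowChristoffel G p i j) x :=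
  (h.contDiffAt_lowChristoffel p i j).differentiableAt (by norm_num)

theorem contDiffAt_christoffel (h : IsRegularAt G x) (k i j : Fin n) :
    ContDiffAt ℝ 1 (christoffel G k i j) x := by
  have : christoffel G k i j = fun y => ∑ l, (G y)⁻¹ k l * lowChristoffel G l i j y :=
    funext (christoffel_eq G k i j)
  rw [this]
  exact ContDiffAt.sum fun l _ => ((contDiffAt_inv_entry h.contDiffAt h.det_ne_zero k l).of_le
    (by norm_num)).mul (h.contDiffAt_lowChristoffel l i j)

theorem differentiableAt_christoffel (h : IsRegularAt G x) (k i j : Fin n) :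
    DifferentiableAt ℝ (christoffel G k i j) x :=
  (h.contDiffAt_christoffel k i j).differentiableAt (by norm_num)

theorem continuousAt_ricci (h : IsRegularAt G x) (i j : Fin n) : ContinuousAt (ricci G i j) x := by
  have h0 := fun k i j => (h.contDiffAt_christoffel k i j).continuousAt
  have h1 := fun m k i j => ((h.contDiffAt_christoffel k i j).pd (l := 0) m
    (by norm_num)).continuousAt
  exact (tendsto_finsetSum _ fun k _ => (h1 _ _ _ _).sub (h1 _ _ _ _)).add
    (tendsto_finsetSum _ fun k _ => tendsto_finsetSum _ fun l _ =>
      ((h0 _ _ _).mul (h0 _ _ _)).sub ((h0 _ _ _).mul (h0 _ _ _)))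

theorem sum_mul_inv (h : IsRegularAt G x) (p l : Fin n) :
    ∑ k, G x p k * (G x)⁻¹ k l = if p = l then 1 else 0 := by
  rw [← Matrix.mul_apply, Matrix.mul_nonsing_inv _ h.isUnit_det, Matrix.one_apply]

theorem sum_inv_mul (h : IsRegularAt G x) (p l : Fin n) :
    ∑ k, (G x)⁻¹ p k * G x k l = if p = l then 1 else 0 := by
  rw [← Matrix.mul_apply, Matrix.nonsing_inv_mul _ h.isUnit_det, Matrix.one_apply]

theorem sum_mul_christoffel (h : IsRegularAt G x) (p i j : Fin n) :
    ∑ k, G x p k * christoffel G k i j x = lowChristoffel G p i j x := by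
  simp only [christoffel_eq, Finset.mul_sum]
  rw [Finset.sum_comm]
  simp only [← mul_assoc, ← Finset.sum_mul, h.sum_mul_inv]
  simp

/-- The lowered Riemann tensor is obtained from the usual one by lowering an index. -/
theorem sum_mul_riemann (h : IsRegularAt G x) (p i m j : Fin n) :
    ∑ k, G x p k * riemann G k i m j x = lowRiemann G p i m j x := by
  -- the derivative of `Γ_{ij,p} = g_{pk} Γᵏᵢⱼ`
  have key : ∀ m i j, pd m (lowChristoffel G p i j) x =
      ∑ k, G x p k * pd m (christoffel G k i j) x +
      ∑ l, christoffel G l i j x * lowChristoffel G l m p x +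
      ∑ k, G x p k * ∑ l, christoffel G k m l x * christoffel G l i j x := by
    intro m i j
    have e : lowChristoffel G p i j =ᶠ[𝓝 x] fun y => ∑ k, G y p k * christoffel G k i j y :=
      h.eventually.mono fun y hy => (hy.sum_mul_christoffel p i j).symm
    rw [pd_congr m e, pd_sum _ _ fun k _ =>
      (h.differentiableAt p k).fun_mul (h.differentiableAt_christoffel k i j)]
    simp only [pd_mul m (h.differentiableAt _ _) (h.differentiableAt_christoffel _ _ _),
      h.pd_eq_lowChristoffel, Finset.mul_sum (s := Finset.univ)
        (f := fun l => christoffel G _ m l x * christoffel G l i j x)]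
    rw [Finset.sum_comm (γ := Fin n)]
    simp only [← mul_assoc, ← Finset.sum_mul, h.sum_mul_christoffel, ← Finset.sum_add_distrib]
    exact Finset.sum_congr rfl fun l _ => by ring
  simp only [lowRiemann, riemann, key, Finset.sum_sub_distrib, mul_add, mul_sub,
    Finset.sum_add_distrib]
  ring

theorem ricci_eq (h : IsRegularAt G x) (i j : Fin n) :
    ricci G i j x = ∑ k, ∑ p, (G x)⁻¹ k p * lowRiemann G p i k j x := by
  rw [ricci, ← Finset.sum_add_distrib]
  refine Finset.sum_congr rfl fun k _ => ?_
  simp only [← h.sum_mul_riemann, Finset.mul_sum]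
  rw [Finset.sum_comm]
  simp only [← mul_assoc, ← Finset.sum_mul, h.sum_inv_mul]
  simp [riemann]

theorem pd_lowChristoffel (h : IsRegularAt G x) (m p i j : Fin n) :
    pd m (lowChristoffel G p i j) x = (1 / 2) *
      (pd m (pd i (fun y => G y j p)) x + pd m (pd j (fun y => G y i p)) x -
        pd m (pd p (fun y => G y i j)) x) := by
  have hd : ∀ m i j, DifferentiableAt ℝ (pd m (fun y => G y i j)) x := fun m i j =>
    ((h.contDiffAt i j).pd (l := 1) m (by norm_num)).differentiableAt (by norm_num)
  rw [show lowChristoffel G p i j = fun y => (1 / 2) * (pd i (fun y => G y j p) y +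
    pd j (fun y => G y i p) y - pd p (fun y => G y i j) y) from rfl, pd_const_mul,
    pd_sub _ ((hd _ _ _).fun_add (hd _ _ _)) (hd _ _ _), pd_add _ (hd _ _ _) (hd _ _ _)]

theorem pd_christoffel (h : IsRegularAt G x) (m k i j : Fin n) :
    pd m (christoffel G k i j) x = ∑ l, (pd m (fun y => (G y)⁻¹ k l) x *
      lowChristoffel G l i j x + (G x)⁻¹ k l * pd m (lowChristoffel G l i j) x) := by
  have hi : ∀ k l, DifferentiableAt ℝ (fun y => (G y)⁻¹ k l) x := fun k l =>
    (contDiffAt_inv_entry h.contDiffAt h.det_ne_zero k l).differentiableAt (by norm_num)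
  rw [show christoffel G k i j = fun y => ∑ l, (G y)⁻¹ k l * lowChristoffel G l i j y from
    funext (christoffel_eq G k i j),
    pd_sum _ _ fun l _ => (hi k l).fun_mul (h.differentiableAt_lowChristoffel l i j)]
  exact Finset.sum_congr rfl fun l _ => pd_mul m (hi k l) (h.differentiableAt_lowChristoffel l i j)

theorem lowRiemann_antisymm (h : IsRegularAt G x) (p i m j : Fin n) :
    lowRiemann G p i m j x = -lowRiemann G i p m j x := by
  have e2 : ∀ k l i j, pd k (pd l (fun y => G y i j)) x = pd k (pd l (fun y => G y j i)) x :=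
    fun k l i j => pd_congr k (pd_eventuallyEq l (h.symm.mono fun y hy => hy i j))
  -- the inner products of the Christoffel symbols are symmetric
  have e3 : ∀ i j m p, ∑ k, christoffel G k i j x * lowChristoffel G k m p x =
      ∑ k, christoffel G k p m x * lowChristoffel G k j i x := by
    intro i j m p
    simp only [christoffel_eq, Finset.sum_mul]
    rw [Finset.sum_comm]
    refine Finset.sum_congr rfl fun k _ => Finset.sum_congr rfl fun l _ => ?_
    rw [h.inv_symm l k, h.lowChristoffel_symm k i j, h.lowChristoffel_symm l m p]
    ring
  simp only [lowRiemann, h.pd_lowChristoffel]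
  rw [e3 i j m p, e3 i m j p]
  linear_combination (1 / 2) * (e2 m i j p + e2 m p j i - e2 j i m p + e2 j p i m +
    pd_comm (h.contDiffAt i p) m j + pd_comm (h.contDiffAt p i) m j)

end IsRegularAt

end Curvature

/-! ### The Gauss equation for a parametrized submanifold -/

section Contractions

variable {n p : ℕ}

/-- The contraction `A_{ij} Uⁱ Vʲ`. -/
def contract₂ (A : Fin n → Fin n → ℝ) (U V : Fin n → ℝ) : ℝ :=
  ∑ i, ∑ j, A i j * U i * V j

/-- The contraction `C_{lij} Uⁱ Vʲ Wˡ`; the index order is that of `lowChristoffel`. -/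
def contract₃ (C : Fin n → Fin n → Fin n → ℝ) (U V W : Fin n → ℝ) : ℝ :=
  ∑ i, ∑ j, ∑ l, C l i j * U i * V j * W l

theorem pd_contract₂ {A : Euc p → Fin n → Fin n → ℝ} {U V : Euc p → Fin n → ℝ} {v : Euc p}
    (α : Fin p) (hA : ∀ i j, DifferentiableAt ℝ (fun w => A w i j) v)
    (hU : ∀ i, DifferentiableAt ℝ (fun w => U w i) v)
    (hV : ∀ i, DifferentiableAt ℝ (fun w => V w i) v) :
    pd α (fun w => contract₂ (A w) (U w) (V w)) v =
      contract₂ (fun i j => pd α (fun w => A w i j) v) (U v) (V v) +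
      contract₂ (A v) (fun i => pd α (fun w => U w i) v) (V v) +
      contract₂ (A v) (U v) (fun i => pd α (fun w => V w i) v) := by
  have h1 := fun i j => (hA i j).fun_mul (hU i)
  have h2 := fun i j => (h1 i j).fun_mul (hV j)
  simp only [contract₂]
  rw [pd_sum _ _ fun i _ => DifferentiableAt.fun_sum fun j _ => h2 i j]
  simp only [pd_sum _ _ fun j _ => h2 _ j, pd_mul _ (h1 _ _) (hV _), pd_mul _ (hA _ _) (hU _),
    ← Finset.sum_add_distrib]
  exact Finset.sum_congr rfl fun i _ => Finset.sum_congr rfl fun j _ => by ring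

/-- The scalar product `G(U, V)` at the point `x`. -/
def metricInner (G : MetricField n) (x : Euc n) (U V : Fin n → ℝ) : ℝ :=
  contract₂ (fun i j => G x i j) U V

variable {G : MetricField n} {x : Euc n}

theorem metricInner_add_left (U U' V : Fin n → ℝ) :
    metricInner G x (fun i => U i + U' i) V = metricInner G x U V + metricInner G x U' V := by
  simp only [metricInner, contract₂, mul_add, add_mul, Finset.sum_add_distrib]

theorem metricInner_add_right (U V V' : Fin n → ℝ) :
    metricInner G x U (fun i => V i + V' i) = metricInner G x U V + metricInner G x U V' := by
  simp only [metricInner, contract₂, mul_add, Finset.sum_add_distrib]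

theorem IsRegularAt.metricInner_comm (h : IsRegularAt G x) (U V : Fin n → ℝ) :
    metricInner G x U V = metricInner G x V U := by
  simp only [metricInner, contract₂]
  rw [Finset.sum_comm]
  exact Finset.sum_congr rfl fun i _ => Finset.sum_congr rfl fun j _ => by
    rw [h.symm_at]; ring

end Contractions

section Pullback

variable {n p : ℕ} (G : MetricField n) (X : Euc p → Euc n)

/-- The coordinate tangent vector `∂_α X`. -/
def tangent (α : Fin p) (v : Euc p) (i : Fin n) : ℝ := pd α (fun w => X w i) v

/-- The second derivative `∂_α ∂_β X`. -/
def tangent₂ (α β : Fin p) (v : Euc p) (i : Fin n) : ℝ := pd α (fun w => tangent X β w i) v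

/-- The metric induced by `G` on the parametrized submanifold `X`. -/
def pullback : MetricField p := fun v =>
  Matrix.of fun α β => ∑ i, ∑ j, G (X v) i j * tangent X α v i * tangent X β v j

/-- The vector `Γᵏᵢⱼ Uⁱ Vʲ`. -/
def christoffelVec (U V : Fin n → ℝ) (x : Euc n) (k : Fin n) : ℝ :=
  contract₂ (fun i j => christoffel G k i j x) U V

/-- The covariant derivative `∇_α U` of a vector field `U` along the parametrized submanifold. -/
def covDeriv (α : Fin p) (U : Euc p → Fin n → ℝ) (v : Euc p) (k : Fin n) : ℝ :=
  pd α (fun w => U w k) v + christoffelVec G (U v) (tangent X α v) (X v) k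

variable {G X} {v : Euc p}

theorem differentiableAt_of_contDiff (hX : ContDiff ℝ 3 X) (v : Euc p) : DifferentiableAt ℝ X v :=
  hX.contDiffAt.differentiableAt (by norm_num)

theorem contDiffAt_tangent (hX : ContDiff ℝ 3 X) (α : Fin p) (i : Fin n) (v : Euc p) :
    ContDiffAt ℝ 2 (fun w => tangent X α w i) v := by
  have : ContDiffAt ℝ 3 (fun w => X w i) v :=
    ((EuclideanSpace.proj i : Euc n →L[ℝ] ℝ).contDiff.comp hX).contDiffAt
  exact this.pd α (by norm_num)

theorem differentiableAt_tangent (hX : ContDiff ℝ 3 X) (α : Fin p) (i : Fin n) (v : Euc p) :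
    DifferentiableAt ℝ (fun w => tangent X α w i) v :=
  (contDiffAt_tangent hX α i v).differentiableAt (by norm_num)

theorem metricInner_christoffelVec {x : Euc n} (h : IsRegularAt G x) (U V W : Fin n → ℝ) :
    metricInner G x (christoffelVec G U V x) W =
      contract₃ (fun l i j => lowChristoffel G l i j x) U V W := by
  simp only [metricInner, contract₂, contract₃, christoffelVec, ← h.sum_mul_christoffel,
    Finset.mul_sum, Finset.sum_mul]
  -- the order of summation `k, l, i, j` becomes `i, j, l, k`
  have e : ∀ f : Fin n → Fin n → Fin n → Fin n → ℝ,
      ∑ k, ∑ l, ∑ i, ∑ j, f k l i j = ∑ i, ∑ j, ∑ l, ∑ k, f k l i j := by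
    intro f
    rw [Finset.sum_comm]
    simp only [Finset.sum_comm (s := Finset.univ) (t := Finset.univ)
      (f := fun k i => ∑ j, f k _ i j)]
    rw [Finset.sum_comm]
    refine Finset.sum_congr rfl fun i _ => ?_
    simp only [Finset.sum_comm (s := Finset.univ) (t := Finset.univ) (f := fun k j => f k _ i j)]
    rw [Finset.sum_comm]
  rw [e]
  refine Finset.sum_congr rfl fun i _ => Finset.sum_congr rfl fun j _ =>
    Finset.sum_congr rfl fun l _ => Finset.sum_congr rfl fun k _ => ?_
  rw [h.symm_at k l]
  ring

theorem contract₂_pd_comp (h : IsRegularAt G (X v)) (hX : DifferentiableAt ℝ X v) (α : Fin p)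
    (U V : Fin n → ℝ) :
    contract₂ (fun i j => pd α (fun w => G (X w) i j) v) U V =
      contract₃ (fun l i j => lowChristoffel G l i j (X v)) U (tangent X α v) V +
      contract₃ (fun l i j => lowChristoffel G l i j (X v)) V (tangent X α v) U := by
  simp only [contract₂, contract₃, tangent, pd_comp α (h.differentiableAt _ _) hX,
    h.pd_eq_lowChristoffel, Finset.sum_mul, add_mul, Finset.sum_add_distrib]
  congr 1
  · refine Finset.sum_congr rfl fun i _ => ?_
    rw [Finset.sum_comm]
    refine Finset.sum_congr rfl fun k _ => Finset.sum_congr rfl fun j _ => ?_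
    rw [h.lowChristoffel_symm j i k]
    ring
  · rw [Finset.sum_comm]
    refine Finset.sum_congr rfl fun j _ => ?_
    rw [Finset.sum_comm]
    refine Finset.sum_congr rfl fun k _ => Finset.sum_congr rfl fun i _ => ?_
    rw [h.lowChristoffel_symm i j k]
    ring

/-- Metric compatibility of the covariant derivative along the submanifold. -/
theorem pd_metricInner (h : IsRegularAt G (X v)) (hX : DifferentiableAt ℝ X v) (α : Fin p)
    {U V : Euc p → Fin n → ℝ} (hU : ∀ i, DifferentiableAt ℝ (fun w => U w i) v)
    (hV : ∀ i, DifferentiableAt ℝ (fun w => V w i) v) :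
    pd α (fun w => metricInner G (X w) (U w) (V w)) v =
      metricInner G (X v) (covDeriv G X α U v) (V v) +
      metricInner G (X v) (U v) (covDeriv G X α V v) := by
  have e1 : metricInner G (X v) (covDeriv G X α U v) (V v) = _ := metricInner_add_left _ _ _
  have e2 : metricInner G (X v) (U v) (covDeriv G X α V v) = _ := metricInner_add_right _ _ _
  have hG : ∀ i j, DifferentiableAt ℝ (fun w => G (X w) i j) v :=
    fun i j => (h.differentiableAt i j).fun_comp' v hX
  have e3 := pd_contract₂ (A := fun w i j => G (X w) i j) α hG hU hV
  rw [contract₂_pd_comp h hX] at e3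
  change pd α (fun w => contract₂ (fun i j => G (X w) i j) (U w) (V w)) v = _
  rw [e3, e1, e2, h.metricInner_comm (U v) (christoffelVec _ _ _ _),
    metricInner_christoffelVec h, metricInner_christoffelVec h]
  simp only [metricInner]
  ring

/-- The torsion-free property: `∇_α ∂_β X = ∇_β ∂_α X`. -/
theorem covDeriv_tangent_comm (h : IsRegularAt G (X v)) (hX : ContDiff ℝ 3 X) (α β : Fin p) :
    covDeriv G X α (tangent X β) v = covDeriv G X β (tangent X α) v := by
  funext k
  have h1 : ContDiffAt ℝ 2 (fun w => X w k) v :=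
    ((EuclideanSpace.proj k : Euc n →L[ℝ] ℝ).contDiff.comp hX).contDiffAt.of_le (by norm_num)
  have h2 := pd_comm h1 α β
  simp only [covDeriv, christoffelVec, contract₂]
  congr 1
  rw [Finset.sum_comm]
  exact Finset.sum_congr rfl fun i _ => Finset.sum_congr rfl fun j _ => by
    rw [h.christoffel_symm k j i]; ring

theorem contDiffAt_comp_param {f : Euc n → ℝ} {l : WithTop ℕ∞} (hl : l ≤ 3)
    (hf : ContDiffAt ℝ l f (X v)) (hX : ContDiff ℝ 3 X) : ContDiffAt ℝ l (fun w => f (X w)) v :=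
  hf.comp v (hX.contDiffAt.of_le hl)

theorem eventually_isRegularAt (h : IsRegularAt G (X v)) (hX : ContDiff ℝ 3 X) :
    ∀ᶠ w in 𝓝 v, IsRegularAt G (X w) :=
  hX.continuous.continuousAt.eventually h.eventually

theorem differentiableAt_covDeriv (h : IsRegularAt G (X v)) (hX : ContDiff ℝ 3 X) (α : Fin p)
    {U : Euc p → Fin n → ℝ} (hU : ∀ i, ContDiffAt ℝ 2 (fun w => U w i) v) (k : Fin n) :
    DifferentiableAt ℝ (fun w => covDeriv G X α U w k) v := by
  refine DifferentiableAt.fun_add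
    (((hU k).pd (l := 1) α (by norm_num)).differentiableAt (by norm_num)) ?_
  unfold christoffelVec contract₂
  refine DifferentiableAt.fun_sum fun i _ => DifferentiableAt.fun_sum fun j _ => ?_
  exact (((contDiffAt_comp_param (by norm_num) (h.contDiffAt_christoffel k i j)
    hX).differentiableAt (by norm_num)).fun_mul ((hU i).differentiableAt (by norm_num))).fun_mul
    (differentiableAt_tangent hX α j v)

/-- The commutator of covariant derivatives is given by the Riemann tensor. -/
theorem covDeriv_covDeriv_sub (h : IsRegularAt G (X v)) (hX : ContDiff ℝ 3 X) (α β : Fin p)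
    {U : Euc p → Fin n → ℝ} (hU : ∀ i, ContDiffAt ℝ 2 (fun w => U w i) v) (k : Fin n) :
    covDeriv G X α (covDeriv G X β U) v k - covDeriv G X β (covDeriv G X α U) v k =
      ∑ i, ∑ m, ∑ j, riemann G k i m j (X v) * U v i * tangent X α v m * tangent X β v j := by
  have hUd : ∀ i, DifferentiableAt ℝ (fun w => U w i) v :=
    fun i => (hU i).differentiableAt (by norm_num)
  have hc : ∀ i j, DifferentiableAt ℝ (fun w => christoffel G k i j (X w)) v := fun i j =>
    (contDiffAt_comp_param (by norm_num) (h.contDiffAt_christoffel k i j) hX).differentiableAt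
      (by norm_num)
  have key : ∀ α β, covDeriv G X α (covDeriv G X β U) v k =
      pd α (pd β (fun w => U w k)) v +
      (∑ i, ∑ j, ∑ m, pd m (christoffel G k i j) (X v) * U v i * tangent X α v m *
        tangent X β v j +
      contract₂ (fun i j => christoffel G k i j (X v)) (fun i => pd α (fun w => U w i) v)
        (tangent X β v) +
      contract₂ (fun i j => christoffel G k i j (X v)) (U v) (tangent₂ X α β v)) +
      (contract₂ (fun i j => christoffel G k i j (X v)) (fun i => pd β (fun w => U w i) v)
        (tangent X α v) +
      ∑ l, ∑ m, ∑ i, ∑ j, christoffel G k m l (X v) * christoffel G l i j (X v) *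
        U v i * tangent X α v m * tangent X β v j) := by
    intro α β
    have h1 : DifferentiableAt ℝ (fun w => pd β (fun w => U w k) w) v :=
      ((hU k).pd (l := 1) β (by norm_num)).differentiableAt (by norm_num)
    have h2 : DifferentiableAt ℝ (fun w => christoffelVec G (U w) (tangent X β w) (X w) k) v := by
      unfold christoffelVec contract₂
      exact DifferentiableAt.fun_sum fun i _ => DifferentiableAt.fun_sum fun j _ =>
        ((hc i j).fun_mul (hUd i)).fun_mul (differentiableAt_tangent hX β j v)
    have e1 : pd α (fun w => covDeriv G X β U w k) v = _ := pd_add α h1 h2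
    have e2 := pd_contract₂ (A := fun w i j => christoffel G k i j (X w)) α hc hUd
      (fun i => differentiableAt_tangent hX β i v)
    have e3 : pd α (fun w => christoffelVec G (U w) (tangent X β w) (X w) k) v = _ := e2
    rw [covDeriv, e1, e3]
    congr 1
    · congr 3
      simp only [contract₂, pd_comp α ((h.differentiableAt_christoffel k _ _))
        (differentiableAt_of_contDiff hX v), Finset.sum_mul]
      exact Finset.sum_congr rfl fun i _ => Finset.sum_congr rfl fun j _ =>
        Finset.sum_congr rfl fun m _ => by simp only [tangent]; ring
    · simp only [christoffelVec, covDeriv, contract₂, mul_add, add_mul, Finset.sum_add_distrib,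
        Finset.mul_sum, Finset.sum_mul]
      congr 1
      exact Finset.sum_congr rfl fun l _ => Finset.sum_congr rfl fun m _ =>
        Finset.sum_congr rfl fun i _ => Finset.sum_congr rfl fun j _ => by
          rw [h.christoffel_symm k l m]; ring
  have hT : tangent₂ X α β v = tangent₂ X β α v := by
    funext i
    exact pd_comm (((EuclideanSpace.proj i : Euc n →L[ℝ] ℝ).contDiff.comp hX).contDiffAt.of_le
      (by norm_num)) α β
  have e : ∀ f : Fin n → Fin n → Fin n → Fin n → ℝ,
      ∑ l, ∑ m, ∑ i, ∑ j, f l m i j = ∑ i, ∑ m, ∑ j, ∑ l, f l m i j := by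
    intro f
    have e1 : ∀ l, ∑ m, ∑ i, ∑ j, f l m i j = ∑ i, ∑ m, ∑ j, f l m i j :=
      fun l => Finset.sum_comm
    simp only [e1]
    rw [Finset.sum_comm]
    refine Finset.sum_congr rfl fun i _ => ?_
    rw [Finset.sum_comm]
    exact Finset.sum_congr rfl fun m _ => Finset.sum_comm
  have s3 : ∀ α β, ∑ i, ∑ j, ∑ m, pd m (christoffel G k i j) (X v) * U v i * tangent X α v m *
      tangent X β v j = ∑ i, ∑ m, ∑ j, pd m (christoffel G k i j) (X v) * U v i *
      tangent X α v m * tangent X β v j :=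
    fun α β => Finset.sum_congr rfl fun i _ => Finset.sum_comm
  have s4 : ∀ α β, ∑ l, ∑ m, ∑ i, ∑ j, christoffel G k m l (X v) * christoffel G l i j (X v) *
        U v i * tangent X α v m * tangent X β v j = ∑ i, ∑ m, ∑ j, ∑ l,
        christoffel G k m l (X v) * christoffel G l i j (X v) *
        U v i * tangent X α v m * tangent X β v j := fun α β => e _
  -- the terms with derivatives of `U` cancel in the difference
  rw [key α β, key β α, hT, pd_comm (hU k) α β, s4 α β, s4 β α, s3 α β]
  simp only [riemann, add_mul, sub_mul, Finset.sum_mul, Finset.sum_add_distrib,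
    Finset.sum_sub_distrib]
  have s1 : ∑ i, ∑ j, ∑ m, pd m (christoffel G k i j) (X v) * U v i * tangent X β v m *
      tangent X α v j = ∑ i, ∑ m, ∑ j, pd j (christoffel G k i m) (X v) * U v i *
      tangent X α v m * tangent X β v j :=
    Finset.sum_congr rfl fun i _ => Finset.sum_congr rfl fun m _ =>
      Finset.sum_congr rfl fun j _ => by ring
  have s2 : ∑ i, ∑ m, ∑ j, ∑ l, christoffel G k m l (X v) * christoffel G l i j (X v) *
        U v i * tangent X β v m * tangent X α v j =
      ∑ i, ∑ m, ∑ j, ∑ l, christoffel G k j l (X v) * christoffel G l i m (X v) *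
        U v i * tangent X α v m * tangent X β v j := by
    refine Finset.sum_congr rfl fun i _ => ?_
    rw [Finset.sum_comm]
    exact Finset.sum_congr rfl fun m _ => Finset.sum_congr rfl fun j _ =>
      Finset.sum_congr rfl fun l _ => by ring
  rw [s1, s2]
  ring

end Pullback

section GaussEquation

variable {n p : ℕ} {G : MetricField n} {X : Euc p → Euc n} {v : Euc p}

theorem isRegularAt_pullback (h : IsRegularAt G (X v)) (hX : ContDiff ℝ 3 X)
    (hdet : (pullback G X v).det ≠ 0) : IsRegularAt (pullback G X) v where
  contDiffAt α β := by
    change ContDiffAt ℝ 2 (fun w => ∑ i, ∑ j, G (X w) i j * tangent X α w i * tangent X β w j) v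
    exact ContDiffAt.sum fun i _ => ContDiffAt.sum fun j _ =>
      ((contDiffAt_comp_param (by norm_num) (h.contDiffAt i j) hX).mul
        (contDiffAt_tangent hX α i v)).mul (contDiffAt_tangent hX β j v)
  symm := (eventually_isRegularAt h hX).mono fun _ hw _ _ => hw.metricInner_comm _ _
  det_ne_zero := hdet

/-- The Levi-Civita connection of the induced metric is the tangential part of the ambient one. -/
theorem lowChristoffel_pullback (h : IsRegularAt G (X v)) (hX : ContDiff ℝ 3 X) (ε α β : Fin p) :
    lowChristoffel (pullback G X) ε α β v =
      metricInner G (X v) (covDeriv G X α (tangent X β) v) (tangent X ε v) := by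
  have e : ∀ m α β, pd m (fun w => pullback G X w α β) v =
      metricInner G (X v) (covDeriv G X m (tangent X α) v) (tangent X β v) +
      metricInner G (X v) (covDeriv G X m (tangent X β) v) (tangent X α v) := by
    intro m α β
    rw [h.metricInner_comm (covDeriv G X m (tangent X β) v)]
    exact pd_metricInner h (differentiableAt_of_contDiff hX v) m
      (fun i => differentiableAt_tangent hX α i v) (fun i => differentiableAt_tangent hX β i v)
  rw [lowChristoffel, e, e, e, covDeriv_tangent_comm h hX β α, covDeriv_tangent_comm h hX ε α,
    covDeriv_tangent_comm h hX ε β]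
  ring

/-- The contraction `R_{pimj} Uᵖ Vⁱ Wᵐ Zʲ`. -/
def riemannContract (G : MetricField n) (x : Euc n) (U V W Z : Fin n → ℝ) : ℝ :=
  ∑ i, ∑ m, ∑ j, ∑ p, lowRiemann G p i m j x * U p * V i * W m * Z j

/-- The Gauss equation before the splitting into tangential and normal parts. -/
theorem lowRiemann_pullback (h : IsRegularAt G (X v)) (hX : ContDiff ℝ 3 X) (ε γ α β : Fin p) :
    lowRiemann (pullback G X) ε γ α β v =
      riemannContract G (X v) (tangent X ε v) (tangent X γ v) (tangent X α v) (tangent X β v) +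
      (metricInner G (X v) (covDeriv G X γ (tangent X β) v) (covDeriv G X α (tangent X ε) v) -
        ∑ δ, christoffel (pullback G X) δ γ β v * lowChristoffel (pullback G X) δ α ε v) -
      (metricInner G (X v) (covDeriv G X γ (tangent X α) v) (covDeriv G X β (tangent X ε) v) -
        ∑ δ, christoffel (pullback G X) δ γ α v * lowChristoffel (pullback G X) δ β ε v) := by
  have hd := differentiableAt_of_contDiff hX v
  have e : ∀ α β, pd α (lowChristoffel (pullback G X) ε γ β) v =
      metricInner G (X v) (covDeriv G X α (covDeriv G X β (tangent X γ)) v) (tangent X ε v) +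
      metricInner G (X v) (covDeriv G X γ (tangent X β) v) (covDeriv G X α (tangent X ε) v) := by
    intro α β
    have e1 : lowChristoffel (pullback G X) ε γ β =ᶠ[𝓝 v] fun w =>
        metricInner G (X w) (covDeriv G X β (tangent X γ) w) (tangent X ε w) := by
      filter_upwards [eventually_isRegularAt h hX] with w hw
      rw [lowChristoffel_pullback hw hX, covDeriv_tangent_comm hw hX]
    rw [pd_congr α e1, covDeriv_tangent_comm h hX γ β]
    exact pd_metricInner h hd α (fun i => differentiableAt_covDeriv h hX β
      (fun i => contDiffAt_tangent hX γ i v) i) (fun i => differentiableAt_tangent hX ε i v)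
  have e2 : metricInner G (X v) (covDeriv G X α (covDeriv G X β (tangent X γ)) v)
        (tangent X ε v) -
      metricInner G (X v) (covDeriv G X β (covDeriv G X α (tangent X γ)) v) (tangent X ε v) =
      riemannContract G (X v) (tangent X ε v) (tangent X γ v) (tangent X α v)
        (tangent X β v) := by
    have e3 := covDeriv_covDeriv_sub h hX α β (fun i => contDiffAt_tangent hX γ i v)
    simp only [metricInner, contract₂, ← Finset.sum_sub_distrib, ← sub_mul, ← mul_sub, e3,
      riemannContract, ← h.sum_mul_riemann, Finset.sum_mul, Finset.mul_sum]
    have r : ∀ f : Fin n → Fin n → Fin n → Fin n → Fin n → ℝ,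
        ∑ k, ∑ q, ∑ i, ∑ m, ∑ j, f k q i m j = ∑ i, ∑ m, ∑ j, ∑ q, ∑ k, f k q i m j := by
      intro f
      calc ∑ k, ∑ q, ∑ i, ∑ m, ∑ j, f k q i m j
          = ∑ q, ∑ k, ∑ i, ∑ m, ∑ j, f k q i m j := Finset.sum_comm
        _ = ∑ q, ∑ i, ∑ m, ∑ j, ∑ k, f k q i m j := Finset.sum_congr rfl fun q _ =>
            Finset.sum_comm.trans <| Finset.sum_congr rfl fun i _ =>
              Finset.sum_comm.trans <| Finset.sum_congr rfl fun m _ => Finset.sum_comm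
        _ = _ := Finset.sum_comm.trans <| Finset.sum_congr rfl fun i _ =>
              Finset.sum_comm.trans <| Finset.sum_congr rfl fun m _ => Finset.sum_comm
    rw [r]
    refine Finset.sum_congr rfl fun i _ => Finset.sum_congr rfl fun m _ => Finset.sum_congr rfl
      fun j _ => Finset.sum_congr rfl fun q _ => Finset.sum_congr rfl fun k _ => ?_
    rw [h.symm_at k q]
    ring
  rw [lowRiemann, e, e, ← e2]
  ring

end GaussEquation

section Hypersurface

variable {p : ℕ} {G : MetricField (p + 1)} {X : Euc p → Euc (p + 1)} {v : Euc p}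
  {N : Fin (p + 1) → ℝ}

/-- The inverse metric splits into its tangential part and the square of the unit normal. -/
theorem inv_eq_tangential_add_normal (h : IsRegularAt G (X v)) (hdet : (pullback G X v).det ≠ 0)
    (hN : metricInner G (X v) N N = 1)
    (hT : ∀ α, metricInner G (X v) N (tangent X α v) = 0) (i j : Fin (p + 1)) :
    (G (X v))⁻¹ i j =
      ∑ α, ∑ β, (pullback G X v)⁻¹ α β * tangent X α v i * tangent X β v j + N i * N j := by
  -- `P` has the columns `∂_α X` and `N`, and `Pᵀ G P` is block diagonal
  let P : Matrix (Fin (p + 1)) (Fin p ⊕ Unit) ℝ :=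
    Matrix.of fun i a => Sum.elim (fun α => tangent X α v i) (fun _ => N i) a
  let S : Matrix (Fin p ⊕ Unit) (Fin p ⊕ Unit) ℝ :=
    Matrix.fromBlocks (pullback G X v)⁻¹ 0 0 1
  have hcomm : ∀ U V, metricInner G (X v) U V = metricInner G (X v) V U := h.metricInner_comm
  have hPGP : P.transpose * G (X v) * P = Matrix.fromBlocks (pullback G X v) 0 0 1 := by
    have e : ∀ a b, (P.transpose * G (X v) * P) a b =
        metricInner G (X v) (fun i => P i a) (fun i => P i b) := by
      intro a b
      simp only [Matrix.mul_apply, Matrix.transpose_apply, metricInner, contract₂, Finset.sum_mul]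
      rw [Finset.sum_comm]
      exact Finset.sum_congr rfl fun i _ => Finset.sum_congr rfl fun j _ => by ring
    ext a b
    rw [e]
    rcases a with α | a <;> rcases b with β | b
    · rfl
    · exact (hcomm _ _).trans (hT α)
    · exact hT β
    · simpa [P] using hN
  have hSP : (S * P.transpose * G (X v)) * P = 1 := by
    rw [Matrix.mul_assoc, Matrix.mul_assoc, ← Matrix.mul_assoc P.transpose, hPGP]
    simp only [S]
    rw [Matrix.fromBlocks_multiply]
    simp [Matrix.nonsing_inv_mul _ (isUnit_iff_ne_zero.mpr hdet)]
  have hPS : P * (S * P.transpose * G (X v)) = 1 :=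
    (Matrix.mul_eq_one_comm_of_card_eq _ _ _ (by simp)).mp hSP
  have hinv : (G (X v))⁻¹ = P * S * P.transpose :=
    Matrix.inv_eq_left_inv (by simpa only [Matrix.mul_assoc] using hPS)
  rw [hinv]
  simp only [Matrix.mul_apply, Matrix.transpose_apply, Fintype.sum_sum_type, S,
    Matrix.fromBlocks_apply₁₁, Matrix.fromBlocks_apply₁₂, Matrix.fromBlocks_apply₂₁,
    Matrix.fromBlocks_apply₂₂, Matrix.zero_apply, mul_zero, Finset.sum_const_zero, add_zero,
    zero_add, P, Matrix.of_apply, Sum.elim_inl, Sum.elim_inr, Finset.sum_mul]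
  congr 1
  · rw [Finset.sum_comm]
    exact Finset.sum_congr rfl fun i _ => Finset.sum_congr rfl fun j _ => by ring
  · simp

/-- The scalar product splits into its tangential and normal parts. -/
theorem metricInner_eq_tangential_add_normal (h : IsRegularAt G (X v))
    (hdet : (pullback G X v).det ≠ 0) (hN : metricInner G (X v) N N = 1)
    (hT : ∀ α, metricInner G (X v) N (tangent X α v) = 0) (U V : Fin (p + 1) → ℝ) :
    metricInner G (X v) U V =
      ∑ α, ∑ β, (pullback G X v)⁻¹ α β * metricInner G (X v) U (tangent X α v) *
        metricInner G (X v) V (tangent X β v) +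
      metricInner G (X v) U N * metricInner G (X v) V N := by
  have low : ∀ U W, metricInner G (X v) U W = ∑ i, (∑ k, G (X v) k i * U k) * W i := by
    intro U W
    simp only [metricInner, contract₂, Finset.sum_mul]
    exact Finset.sum_comm
  have e : metricInner G (X v) U V = ∑ i, ∑ j, (∑ k, G (X v) k i * U k) *
      (∑ k, G (X v) k j * V k) * (G (X v))⁻¹ i j := by
    rw [low]
    refine Finset.sum_congr rfl fun i _ => ?_
    simp only [mul_assoc, ← Finset.mul_sum]
    congr 1
    simp only [Finset.sum_mul]
    rw [Finset.sum_comm]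
    have : ∀ k, ∑ j, G (X v) k j * V k * (G (X v))⁻¹ i j = (if k = i then 1 else 0) * V k := by
      intro k
      rw [← h.sum_mul_inv, Finset.sum_mul]
      exact Finset.sum_congr rfl fun j _ => by rw [h.inv_symm i j]; ring
    simp [this]
  rw [e]
  simp only [inv_eq_tangential_add_normal h hdet hN hT, mul_add, Finset.sum_add_distrib]
  congr 1
  · simp only [low, Finset.mul_sum (s := Finset.univ (α := Fin p))]
    have r : ∀ f : Fin (p + 1) → Fin (p + 1) → Fin p → Fin p → ℝ,
        ∑ i, ∑ j, ∑ α, ∑ β, f i j α β = ∑ α, ∑ β, ∑ i, ∑ j, f i j α β := by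
      intro f
      calc ∑ i, ∑ j, ∑ α, ∑ β, f i j α β = ∑ i, ∑ α, ∑ β, ∑ j, f i j α β :=
            Finset.sum_congr rfl fun i _ => Finset.sum_comm.trans <|
              Finset.sum_congr rfl fun α _ => Finset.sum_comm
        _ = _ := Finset.sum_comm.trans <| Finset.sum_congr rfl fun α _ => Finset.sum_comm
    rw [r]
    refine Finset.sum_congr rfl fun α _ => Finset.sum_congr rfl fun β _ => ?_
    rw [mul_assoc, Finset.sum_mul_sum, Finset.mul_sum]
    refine Finset.sum_congr rfl fun i _ => ?_
    rw [Finset.mul_sum]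
    exact Finset.sum_congr rfl fun j _ => by ring
  · rw [low, low, Finset.sum_mul_sum]
    exact Finset.sum_congr rfl fun i _ => Finset.sum_congr rfl fun j _ => by ring

/-- The Gauss equation of a hypersurface. -/
theorem gauss_equation (h : IsRegularAt G (X v)) (hX : ContDiff ℝ 3 X)
    (hdet : (pullback G X v).det ≠ 0) (hN : metricInner G (X v) N N = 1)
    (hT : ∀ α, metricInner G (X v) N (tangent X α v) = 0) (ε γ α β : Fin p) :
    lowRiemann (pullback G X) ε γ α β v =
      riemannContract G (X v) (tangent X ε v) (tangent X γ v) (tangent X α v) (tangent X β v) +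
      metricInner G (X v) (covDeriv G X γ (tangent X β) v) N *
        metricInner G (X v) (covDeriv G X α (tangent X ε) v) N -
      metricInner G (X v) (covDeriv G X γ (tangent X α) v) N *
        metricInner G (X v) (covDeriv G X β (tangent X ε) v) N := by
  have hS := isRegularAt_pullback h hX hdet
  have e : ∀ β α, ∑ δ, christoffel (pullback G X) δ γ β v *
      lowChristoffel (pullback G X) δ α ε v =
      ∑ δ, ∑ κ, (pullback G X v)⁻¹ δ κ *
        metricInner G (X v) (covDeriv G X γ (tangent X β) v) (tangent X δ v) *
        metricInner G (X v) (covDeriv G X α (tangent X ε) v) (tangent X κ v) := by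
    intro β α
    simp only [christoffel_eq, lowChristoffel_pullback h hX, Finset.sum_mul]
    rw [Finset.sum_comm]
    exact Finset.sum_congr rfl fun δ _ => Finset.sum_congr rfl fun κ _ => by
      rw [hS.inv_symm κ δ]
  rw [lowRiemann_pullback h hX, e, e, metricInner_eq_tangential_add_normal h hdet hN hT
    (covDeriv G X γ (tangent X β) v), metricInner_eq_tangential_add_normal h hdet hN hT
    (covDeriv G X γ (tangent X α) v)]
  ring

end Hypersurface

section TracedGauss

variable {n p : ℕ}

theorem lowRiemann_antisymm_right (G : MetricField n) (q i m j : Fin n) (x : Euc n) :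
    lowRiemann G q i m j x = -lowRiemann G q i j m x := by
  simp only [lowRiemann]
  ring

/-- For an algebraic curvature tensor and an inverse metric `K + N ⊗ N`, the scalar curvature is the
trace over `K` plus twice the Ricci curvature in the direction `N`. -/
theorem sum_split_normal (R : Fin n → Fin n → Fin n → Fin n → ℝ)
    (h1 : ∀ q i m j, R q i m j = -R i q m j) (h2 : ∀ q i m j, R q i m j = -R q i j m)
    (K : Fin n → Fin n → ℝ) (hK : ∀ i j, K i j = K j i) (N : Fin n → ℝ) :
    ∑ i, ∑ j, (K i j + N i * N j) * ∑ k, ∑ q, (K k q + N k * N q) * R q i k j =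
      ∑ i, ∑ j, K i j * ∑ k, ∑ q, K k q * R q i k j +
        2 * ∑ i, ∑ j, (∑ k, ∑ q, (K k q + N k * N q) * R q i k j) * N i * N j := by
  -- the purely normal part vanishes by antisymmetry, and the two mixed parts agree
  have e1 : ∑ i, ∑ j, ∑ k, ∑ q, N i * N j * (N k * N q * R q i k j) = 0 := by
    have s : ∑ i, ∑ j, ∑ k, ∑ q, N i * N j * (N k * N q * R q i k j) =
        -∑ i, ∑ j, ∑ k, ∑ q, N i * N j * (N k * N q * R q i k j) := by
      have r : ∀ f : Fin n → Fin n → Fin n → Fin n → ℝ,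
          ∑ i, ∑ j, ∑ k, ∑ q, f i j k q = ∑ q, ∑ j, ∑ k, ∑ i, f i j k q := by
        intro f
        calc ∑ i, ∑ j, ∑ k, ∑ q, f i j k q = ∑ i, ∑ q, ∑ j, ∑ k, f i j k q :=
              Finset.sum_congr rfl fun i _ => (Finset.sum_congr rfl fun j _ =>
                Finset.sum_comm).trans Finset.sum_comm
          _ = ∑ q, ∑ i, ∑ j, ∑ k, f i j k q := Finset.sum_comm
          _ = _ := Finset.sum_congr rfl fun q _ => Finset.sum_comm.trans <|
              Finset.sum_congr rfl fun j _ => Finset.sum_comm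
      conv_lhs => rw [r]
      simp only [← Finset.sum_neg_distrib]
      exact Finset.sum_congr rfl fun i _ => Finset.sum_congr rfl fun j _ =>
        Finset.sum_congr rfl fun k _ => Finset.sum_congr rfl fun q _ => by rw [h1 i q]; ring
    linarith
  have e2 : ∑ i, ∑ j, ∑ k, ∑ q, K i j * (N k * N q * R q i k j) =
      ∑ i, ∑ j, ∑ k, ∑ q, N i * N j * (K k q * R q i k j) := by
    have r : ∀ f : Fin n → Fin n → Fin n → Fin n → ℝ,
        ∑ i, ∑ j, ∑ k, ∑ q, f i j k q = ∑ q, ∑ k, ∑ j, ∑ i, f i j k q := by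
      intro f
      calc ∑ i, ∑ j, ∑ k, ∑ q, f i j k q = ∑ i, ∑ q, ∑ k, ∑ j, f i j k q :=
            Finset.sum_congr rfl fun i _ => (Finset.sum_comm.trans <|
              Finset.sum_congr rfl fun k _ => Finset.sum_comm).trans Finset.sum_comm
        _ = ∑ q, ∑ i, ∑ k, ∑ j, f i j k q := Finset.sum_comm
        _ = _ := Finset.sum_congr rfl fun q _ => Finset.sum_comm.trans <|
            Finset.sum_congr rfl fun k _ => Finset.sum_comm
    conv_lhs => rw [r]
    exact Finset.sum_congr rfl fun i _ => Finset.sum_congr rfl fun j _ =>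
      Finset.sum_congr rfl fun k _ => Finset.sum_congr rfl fun q _ => by
        rw [h1 i q, h2 q i, hK q k]; ring
  have e3 : ∀ c : ℝ, ∀ f : Fin n → Fin n → ℝ, c * ∑ k, ∑ q, f k q = ∑ k, ∑ q, c * f k q := by
    intro c f
    simp only [Finset.mul_sum]
  have e4 : ∑ i, ∑ j, (∑ k, ∑ q, (K k q + N k * N q) * R q i k j) * N i * N j =
      ∑ i, ∑ j, ∑ k, ∑ q, N i * N j * ((K k q + N k * N q) * R q i k j) :=
    Finset.sum_congr rfl fun i _ => Finset.sum_congr rfl fun j _ => by rw [← e3]; ring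
  have e5 : ∑ i, ∑ j, ∑ k, ∑ q, N i * N j * ((K k q + N k * N q) * R q i k j) =
      ∑ i, ∑ j, ∑ k, ∑ q, N i * N j * (K k q * R q i k j) := by
    simp only [add_mul, mul_add, Finset.sum_add_distrib, e1, add_zero]
  rw [e4, e5]
  generalize hY : ∑ i, ∑ j, ∑ k, ∑ q, N i * N j * (K k q * R q i k j) = Y at e2 ⊢
  simp only [e3, add_mul, mul_add, Finset.sum_add_distrib, e1, e2, hY]
  ring

theorem sum_contract (s : Fin p → Fin p → ℝ) (T : Fin p → Fin n → ℝ) (Q : Fin n → Fin n → ℝ) :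
    ∑ i, ∑ j, (∑ α, ∑ β, s α β * T α i * T β j) * Q i j =
      ∑ α, ∑ β, s α β * ∑ i, ∑ j, Q i j * T α i * T β j := by
  simp only [Finset.sum_mul, Finset.mul_sum]
  calc ∑ i, ∑ j, ∑ α, ∑ β, s α β * T α i * T β j * Q i j
      = ∑ i, ∑ α, ∑ β, ∑ j, s α β * T α i * T β j * Q i j :=
        Finset.sum_congr rfl fun i _ => Finset.sum_comm.trans <|
          Finset.sum_congr rfl fun α _ => Finset.sum_comm
    _ = ∑ α, ∑ β, ∑ i, ∑ j, s α β * T α i * T β j * Q i j :=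
        Finset.sum_comm.trans <| Finset.sum_congr rfl fun α _ => Finset.sum_comm
    _ = _ := Finset.sum_congr rfl fun α _ => Finset.sum_congr rfl fun β _ =>
        Finset.sum_congr rfl fun i _ => Finset.sum_congr rfl fun j _ => by ring

variable {G : MetricField (p + 1)} {X : Euc p → Euc (p + 1)} {v : Euc p}
  {N : Fin (p + 1) → ℝ}

/-- The traced Gauss equation: the scalar curvature of a hypersurface with unit normal `N` is
`R - 2 Ric(N, N) + H² - |A|²`. -/
theorem scalarCurvature_pullback (h : IsRegularAt G (X v)) (hX : ContDiff ℝ 3 X)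
    (hdet : (pullback G X v).det ≠ 0) (hN : metricInner G (X v) N N = 1)
    (hT : ∀ α, metricInner G (X v) N (tangent X α v) = 0) :
    scalarCurvature (pullback G X) v =
      scalarCurvature G (X v) - 2 * ∑ i, ∑ j, ricci G i j (X v) * N i * N j +
      ∑ γ, ∑ β, (pullback G X v)⁻¹ γ β * ∑ α, ∑ ε, (pullback G X v)⁻¹ α ε *
        (metricInner G (X v) (covDeriv G X γ (tangent X β) v) N *
          metricInner G (X v) (covDeriv G X α (tangent X ε) v) N -
        metricInner G (X v) (covDeriv G X γ (tangent X α) v) N *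
          metricInner G (X v) (covDeriv G X β (tangent X ε) v) N) := by
  have hS := isRegularAt_pullback h hX hdet
  have hK : ∀ i j, (∑ α, ∑ β, (pullback G X v)⁻¹ α β * tangent X α v i * tangent X β v j) =
      ∑ α, ∑ β, (pullback G X v)⁻¹ α β * tangent X α v j * tangent X β v i := by
    intro i j
    rw [Finset.sum_comm]
    exact Finset.sum_congr rfl fun α _ => Finset.sum_congr rfl fun β _ => by
      rw [hS.inv_symm β α]; ring
  have split := sum_split_normal (fun q i m j => lowRiemann G q i m j (X v))
    (fun q i m j => h.lowRiemann_antisymm q i m j)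
    (fun q i m j => lowRiemann_antisymm_right G q i m j (X v)) _ hK N
  simp only [← inv_eq_tangential_add_normal h hdet hN hT, ← h.ricci_eq] at split
  have e1 : scalarCurvature G (X v) - 2 * ∑ i, ∑ j, ricci G i j (X v) * N i * N j =
      ∑ γ, ∑ β, (pullback G X v)⁻¹ γ β * ∑ α, ∑ ε, (pullback G X v)⁻¹ α ε *
        riemannContract G (X v) (tangent X ε v) (tangent X γ v) (tangent X α v)
          (tangent X β v) := by
    have key : ∀ Q : Fin (p + 1) → Fin (p + 1) → ℝ,
        ∑ i, ∑ j, (∑ α, ∑ β, (pullback G X v)⁻¹ α β * tangent X α v i * tangent X β v j) * Q i j =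
          ∑ α, ∑ β, (pullback G X v)⁻¹ α β *
            ∑ i, ∑ j, Q i j * tangent X α v i * tangent X β v j := fun Q =>
      sum_contract (fun α β => (pullback G X v)⁻¹ α β) (fun α i => tangent X α v i) Q
    rw [scalarCurvature, split, add_sub_cancel_right]
    refine (key _).trans ?_
    refine Finset.sum_congr rfl fun γ _ => Finset.sum_congr rfl fun β _ => ?_
    congr 1
    simp only [key]
    simp only [riemannContract, Finset.sum_mul, Finset.mul_sum]
    calc ∑ i, ∑ j, ∑ α, ∑ ε, ∑ k, ∑ q, (pullback G X v)⁻¹ α ε *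
          (lowRiemann G q i k j (X v) * tangent X α v k * tangent X ε v q) * tangent X γ v i *
          tangent X β v j
        = ∑ α, ∑ ε, ∑ i, ∑ j, ∑ k, ∑ q, (pullback G X v)⁻¹ α ε *
          (lowRiemann G q i k j (X v) * tangent X α v k * tangent X ε v q) * tangent X γ v i *
          tangent X β v j := by
          refine (Finset.sum_congr rfl fun i _ => Finset.sum_comm.trans <|
            Finset.sum_congr rfl fun α _ => Finset.sum_comm).trans ?_
          exact Finset.sum_comm.trans <| Finset.sum_congr rfl fun α _ => Finset.sum_comm
      _ = _ := by
          refine Finset.sum_congr rfl fun α _ => Finset.sum_congr rfl fun ε _ =>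
            Finset.sum_congr rfl fun i _ => Finset.sum_comm.trans <| ?_
          exact Finset.sum_congr rfl fun k _ => Finset.sum_congr rfl fun j _ =>
            Finset.sum_congr rfl fun q _ => by ring
  rw [e1, scalarCurvature, ← Finset.sum_add_distrib]
  refine Finset.sum_congr rfl fun γ _ => ?_
  rw [← Finset.sum_add_distrib]
  refine Finset.sum_congr rfl fun β _ => ?_
  rw [hS.ricci_eq, ← mul_add]
  congr 1
  rw [← Finset.sum_add_distrib]
  refine Finset.sum_congr rfl fun α _ => ?_
  rw [← Finset.sum_add_distrib]
  refine Finset.sum_congr rfl fun ε _ => ?_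
  rw [← mul_add, gauss_equation h hX hdet hN hT]
  ring

end TracedGauss

/-! ### The mass density of an ellipsoid -/

section Normal

theorem pd_comp_coord {n : ℕ} {φ : ℝ → ℝ} {φ' : ℝ} {x : Euc n} (α i : Fin n)
    (h : HasDerivAt φ φ' (x i)) :
    pd α (fun w => φ (w i)) x = φ' * if i = α then 1 else 0 := by
  have h1 : HasFDerivAt (fun w : Euc n => w i) (EuclideanSpace.proj i : Euc n →L[ℝ] ℝ) x :=
    (EuclideanSpace.proj i : Euc n →L[ℝ] ℝ).hasFDerivAt
  have h2 := h.comp_hasFDerivAt x h1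
  change fderiv ℝ (φ ∘ fun w : Euc n => w i) x _ = _
  rw [h2.fderiv]
  simp

theorem differentiableAt_coord {n : ℕ} (i : Fin n) (x : Euc n) :
    DifferentiableAt ℝ (fun w : Euc n => w i) x :=
  (EuclideanSpace.proj i : Euc n →L[ℝ] ℝ).differentiableAt

theorem pd_ellipsoidFun (b : ℝ) (l : Fin 3) (x : Euc 3) :
    pd l (ellipsoidFun b) x = ![2 * x 0, 2 * x 1, 2 * x 2 / b ^ 2] l := by
  have h : ∀ i : Fin 3, DifferentiableAt ℝ (fun w : Euc 3 => w i ^ 2) x :=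
    fun i => (differentiableAt_coord i x).pow 2
  have h' : ∀ i : Fin 3, HasDerivAt (fun t : ℝ => t ^ 2) (2 * x i) (x i) := fun i => by
    simpa using hasDerivAt_pow 2 (x i)
  have e : ellipsoidFun b = fun w => w 0 ^ 2 + w 1 ^ 2 + (1 / b ^ 2) * w 2 ^ 2 := by
    funext w; simp only [ellipsoidFun]; ring
  rw [e, pd_add l ((h 0).fun_add (h 1)) ((h 2).const_mul _), pd_add l (h 0) (h 1), pd_const_mul,
    pd_comp_coord l 0 (h' 0), pd_comp_coord l 1 (h' 1), pd_comp_coord l 2 (h' 2)]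
  fin_cases l <;> simp
  ring

/-- The square `gⁱʲ ∂ᵢf ∂ⱼf` of the length of the gradient of `f = ellipsoidFun b`. -/
def gradSq (G : MetricField 3) (b : ℝ) (x : Euc 3) : ℝ :=
  ∑ i, ∑ j, (G x)⁻¹ i j * pd i (ellipsoidFun b) x * pd j (ellipsoidFun b) x

theorem unitNormal_eq (G : MetricField 3) (b : ℝ) (k : Fin 3) (x : Euc 3) :
    unitNormal G b k x = (∑ l, (G x)⁻¹ k l * pd l (ellipsoidFun b) x) / √(gradSq G b x) := rfl

variable {G : MetricField 3} {b : ℝ} {x : Euc 3}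

theorem grad_ellipsoidFun_ne_zero (hb : b ≠ 0) (hx : x ≠ 0) :
    (fun l => pd l (ellipsoidFun b) x) ≠ 0 := by
  intro h
  apply hx
  have h' := fun l => congrFun h l
  simp only [pd_ellipsoidFun] at h'
  have h0 := h' 0
  have h1 := h' 1
  have h2 := h' 2
  simp at h0 h1 h2
  ext i
  fin_cases i
  · simpa using h0
  · simpa using h1
  · simpa [hb] using h2

theorem gradSq_pos (hG : (G x).PosDef) (hb : b ≠ 0) (hx : x ≠ 0) : 0 < gradSq G b x := by
  have h := hG.inv.dotProduct_mulVec_pos (grad_ellipsoidFun_ne_zero hb hx)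
  refine h.trans_eq ?_
  simp only [gradSq, dotProduct, Matrix.mulVec, Finset.mul_sum, Pi.star_apply, star_trivial]
  exact Finset.sum_congr rfl fun i _ => Finset.sum_congr rfl fun j _ => by ring

theorem metricInner_unitNormal (h : IsRegularAt G x) (V : Fin 3 → ℝ) :
    metricInner G x (fun k => unitNormal G b k x) V =
      (∑ j, pd j (ellipsoidFun b) x * V j) / √(gradSq G b x) := by
  have e : ∀ j, ∑ k, G x k j * unitNormal G b k x =
      pd j (ellipsoidFun b) x / √(gradSq G b x) := by
    intro j
    simp only [unitNormal_eq, mul_div_assoc', ← Finset.sum_div, Finset.mul_sum]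
    rw [Finset.sum_comm]
    simp only [← mul_assoc, ← Finset.sum_mul, h.symm_at _ j, h.sum_mul_inv]
    simp
  simp only [metricInner, contract₂]
  rw [Finset.sum_comm, Finset.sum_div]
  simp only [← Finset.sum_mul, e]
  exact Finset.sum_congr rfl fun j _ => by ring

theorem metricInner_unitNormal_self (h : IsRegularAt G x) (hG : (G x).PosDef) (hb : b ≠ 0)
    (hx : x ≠ 0) :
    metricInner G x (fun k => unitNormal G b k x) (fun k => unitNormal G b k x) = 1 := by
  have hpos := gradSq_pos hG hb hx
  rw [metricInner_unitNormal h]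
  simp only [unitNormal_eq, mul_div_assoc', ← Finset.sum_div]
  rw [div_div, Real.mul_self_sqrt hpos.le, div_eq_one_iff_eq hpos.ne', gradSq]
  refine Finset.sum_congr rfl fun i _ => ?_
  rw [Finset.mul_sum]
  exact Finset.sum_congr rfl fun j _ => by ring

theorem contDiffAt_pd_ellipsoidFun (b : ℝ) (l : Fin 3) (x : Euc 3) :
    ContDiffAt ℝ 2 (pd l (ellipsoidFun b)) x := by
  have : ContDiffAt ℝ 3 (ellipsoidFun b) x := by
    have h : ∀ i : Fin 3, ContDiffAt ℝ 3 (fun w : Euc 3 => w i) x :=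
      fun i => (EuclideanSpace.proj i : Euc 3 →L[ℝ] ℝ).contDiff.contDiffAt
    exact (((h 0).pow 2).add ((h 1).pow 2)).add (((h 2).pow 2).div_const _)
  exact this.pd l (by norm_num)

theorem contDiffAt_unitNormal (h : IsRegularAt G x) (hG : (G x).PosDef) (hb : b ≠ 0)
    (hx : x ≠ 0) (k : Fin 3) : ContDiffAt ℝ 2 (unitNormal G b k) x := by
  have hi := fun i j => contDiffAt_inv_entry h.contDiffAt h.det_ne_zero i j
  have hw := fun l => contDiffAt_pd_ellipsoidFun b l x
  have hq : ContDiffAt ℝ 2 (gradSq G b) x := ContDiffAt.sum fun i _ => ContDiffAt.sum fun j _ =>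
    ((hi i j).mul (hw i)).mul (hw j)
  have hpos := gradSq_pos hG hb hx
  exact (ContDiffAt.sum fun l _ => (hi k l).mul (hw l)).div (hq.sqrt hpos.ne')
    (Real.sqrt_pos.mpr hpos).ne'

end Normal

section Ellipsoid

variable {G : MetricField 3} {a b : ℝ} {u : Euc 2}

theorem contDiff_ellipsoidParam (a b : ℝ) : ContDiff ℝ 3 (ellipsoidParam a b) := by
  have h : ∀ i : Fin 2, ContDiff ℝ 3 (fun w : Euc 2 => w i) :=
    fun i => (EuclideanSpace.proj i : Euc 2 →L[ℝ] ℝ).contDiff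
  rw [contDiff_euclidean]
  intro i
  fin_cases i
  · exact (contDiff_const.mul (h 0).sin).mul (h 1).cos
  · exact (contDiff_const.mul (h 0).sin).mul (h 1).sin
  · exact contDiff_const.mul (h 0).cos

theorem tangentVec_eq (a b : ℝ) (α : Fin 2) (i : Fin 3) (u : Euc 2) :
    tangentVec a b α i u =
      ![![a * Real.cos (u 0) * Real.cos (u 1), a * Real.cos (u 0) * Real.sin (u 1),
          -(a * b * Real.sin (u 0))],
        ![-(a * Real.sin (u 0) * Real.sin (u 1)), a * Real.sin (u 0) * Real.cos (u 1), 0]] α i := by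
  have hs : ∀ i, DifferentiableAt ℝ (fun w : Euc 2 => Real.sin (w i)) u :=
    fun i => (differentiableAt_coord i u).sin
  have hc : ∀ i, DifferentiableAt ℝ (fun w : Euc 2 => Real.cos (w i)) u :=
    fun i => (differentiableAt_coord i u).cos
  have es : ∀ α i, pd α (fun w : Euc 2 => Real.sin (w i)) u =
      Real.cos (u i) * if i = α then 1 else 0 :=
    fun α i => pd_comp_coord α i (Real.hasDerivAt_sin (u i))
  have ec : ∀ α i, pd α (fun w : Euc 2 => Real.cos (w i)) u =
      -Real.sin (u i) * if i = α then 1 else 0 :=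
    fun α i => pd_comp_coord α i (Real.hasDerivAt_cos (u i))
  have e0 : pd α (fun w : Euc 2 => a * Real.sin (w 0) * Real.cos (w 1)) u = _ :=
    pd_mul α ((hs 0).const_mul a) (hc 1)
  have e1 : pd α (fun w : Euc 2 => a * Real.sin (w 0) * Real.sin (w 1)) u = _ :=
    pd_mul α ((hs 0).const_mul a) (hs 1)
  have e2 : pd α (fun w : Euc 2 => a * b * Real.cos (w 0)) u = _ :=
    pd_const_mul α (a * b) _ u
  rw [pd_const_mul, es, ec] at e0
  rw [pd_const_mul, es, es] at e1
  rw [ec] at e2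
  have : tangentVec a b α i u = ![pd α (fun w : Euc 2 => a * Real.sin (w 0) * Real.cos (w 1)) u,
      pd α (fun w : Euc 2 => a * Real.sin (w 0) * Real.sin (w 1)) u,
      pd α (fun w : Euc 2 => a * b * Real.cos (w 0)) u] i := by
    fin_cases i <;> rfl
  rw [this, e0, e1, e2]
  fin_cases α <;> fin_cases i <;> simp

theorem ellipsoidParam_ne_zero (ha : a ≠ 0) (hb : b ≠ 0) (u : Euc 2) :
    ellipsoidParam a b u ≠ 0 := by
  intro h
  have h0 : a * Real.sin (u 0) * Real.cos (u 1) = 0 := congrFun (congrArg WithLp.ofLp h) 0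
  have h1 : a * Real.sin (u 0) * Real.sin (u 1) = 0 := congrFun (congrArg WithLp.ofLp h) 1
  have h2 : a * b * Real.cos (u 0) = 0 := congrFun (congrArg WithLp.ofLp h) 2
  have hc : Real.cos (u 0) = 0 := by simpa [ha, hb] using h2
  have hs : Real.sin (u 0) ≠ 0 := by
    intro hs
    have := Real.sin_sq_add_cos_sq (u 0)
    simp [hs, hc] at this
  have h0' : Real.cos (u 1) = 0 := by simpa [ha, hs] using h0
  have h1' : Real.sin (u 1) = 0 := by simpa [ha, hs] using h1
  have := Real.sin_sq_add_cos_sq (u 1)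
  simp [h0', h1'] at this

/-- The parametrization is an immersion away from the poles. -/
theorem det_inducedMetric_ne_zero (ha : a ≠ 0) (hb : b ≠ 0) (hu : Real.sin (u 0) ≠ 0)
    (hG : (G (ellipsoidParam a b u)).PosDef) : (inducedMetric G a b u).det ≠ 0 := by
  let T : Matrix (Fin 3) (Fin 2) ℝ := Matrix.of fun i α => tangentVec a b α i u
  have hT : Function.Injective T.mulVec := by
    rw [← Matrix.coe_mulVecLin, injective_iff_map_eq_zero]
    intro ξ hξ
    have h := fun i => congrFun hξ i
    simp only [Matrix.mulVecLin_apply, Matrix.mulVec, dotProduct, Fin.sum_univ_two, T,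
      Matrix.of_apply, tangentVec_eq] at h
    have h0 := h 0
    have h1 := h 1
    have h2 := h 2
    simp [ha, hb, hu] at h0 h1 h2
    rw [h2] at h0 h1
    have hsc := Real.sin_sq_add_cos_sq (u 1)
    have h3 : a * Real.sin (u 0) * ξ 1 = 0 := by
      linear_combination -Real.sin (u 1) * h0 + Real.cos (u 1) * h1 -
        a * Real.sin (u 0) * ξ 1 * hsc
    have h4 : ξ 1 = 0 := by simpa [ha, hu] using h3
    ext i
    fin_cases i
    · exact h2
    · exact h4
  have h := (hG.conjTranspose_mul_mul_same hT).det_pos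
  have e : inducedMetric G a b u = T.conjTranspose * G (ellipsoidParam a b u) * T := by
    ext α β
    simp only [Matrix.mul_apply, Matrix.conjTranspose_apply, star_trivial, T, Matrix.of_apply,
      inducedMetric, Finset.sum_mul]
    rw [Finset.sum_comm]
    exact Finset.sum_congr rfl fun i _ => Finset.sum_congr rfl fun j _ => by ring
  rw [e]
  exact h.ne'

/-- The ellipsoid lies in a level set of `ellipsoidFun`. -/
theorem sum_grad_mul_tangentVec (hb : b ≠ 0) (α : Fin 2) (u : Euc 2) :
    ∑ j, pd j (ellipsoidFun b) (ellipsoidParam a b u) * tangentVec a b α j u = 0 := by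
  simp only [pd_ellipsoidFun, tangentVec_eq, Fin.sum_univ_three]
  have hsc := Real.sin_sq_add_cos_sq (u 1)
  fin_cases α
  · simp [ellipsoidParam]
    field_simp
    linear_combination 2 * a ^ 2 * Real.sin (u 0) * Real.cos (u 0) * hsc
  · simp [ellipsoidParam]
    ring

/-- The second fundamental form as a covariant derivative along the parametrized ellipsoid. -/
theorem secondFF_eq_covDeriv (h : IsRegularAt G (ellipsoidParam a b u))
    (hn : ∀ k, DifferentiableAt ℝ (unitNormal G b k) (ellipsoidParam a b u)) (α β : Fin 2) :
    secondFF G a b α β u = metricInner G (ellipsoidParam a b u)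
      (covDeriv G (ellipsoidParam a b) α (fun w k => unitNormal G b k (ellipsoidParam a b w)) u)
      (tangent (ellipsoidParam a b) β u) := by
  have e : ∀ k, covDeriv G (ellipsoidParam a b) α
      (fun w k => unitNormal G b k (ellipsoidParam a b w)) u k =
      ∑ i, tangentVec a b α i u * covNormal G b i k (ellipsoidParam a b u) := by
    intro k
    simp only [covDeriv, covNormal, mul_add, Finset.sum_add_distrib,
      pd_comp α (hn k) (differentiableAt_of_contDiff (contDiff_ellipsoidParam a b) u)]
    congr 1
    · exact Finset.sum_congr rfl fun i _ => by simp only [tangentVec]; ring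
    · simp only [christoffelVec, contract₂, Finset.mul_sum]
      rw [Finset.sum_comm]
      exact Finset.sum_congr rfl fun i _ => Finset.sum_congr rfl fun j _ => by
        rw [h.christoffel_symm k j i]; simp only [tangent, tangentVec]; ring
  simp only [secondFF, metricInner, contract₂, e, Finset.mul_sum, Finset.sum_mul]
  rw [Finset.sum_comm]
  refine Finset.sum_congr rfl fun k _ => ?_
  rw [Finset.sum_comm]
  exact Finset.sum_congr rfl fun j _ => Finset.sum_congr rfl fun i _ => by
    simp only [tangent, tangentVec]; ring

/-- The algebra behind the cancellation `(H² - |A|²) - H²/2 + |Å|² = 0` in dimension two. -/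
theorem trace_free_identity (S T A : Matrix (Fin 2) (Fin 2) ℝ)
    (hTS : ∀ i j, ∑ k, T i k * S k j = if i = j then 1 else 0) (hT : ∀ i j, T i j = T j i)
    (hS : ∀ i j, S i j = S j i) (hA : ∀ i j, A i j = A j i) :
    (∑ γ, ∑ β, T γ β * ∑ α, ∑ ε, T α ε * (A γ β * A α ε - A γ α * A β ε)) -
      (∑ α, ∑ β, T α β * A α β) ^ 2 / 2 +
      ∑ α, ∑ β, ∑ γ, ∑ δ, T α γ * T β δ * (A α β - (∑ α, ∑ β, T α β * A α β) / 2 * S α β) *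
        (A γ δ - (∑ α, ∑ β, T α β * A α β) / 2 * S γ δ) = 0 := by
  have h00 := hTS 0 0
  have h01 := hTS 0 1
  have h10 := hTS 1 0
  have h11 := hTS 1 1
  simp only [Fin.sum_univ_two, hT 1 0, hS 1 0, hA 1 0] at *
  simp only [if_true, Fin.zero_eq_one_iff, Fin.one_eq_zero_iff, OfNat.ofNat_ne_one, if_false]
    at h00 h01 h10 h11
  generalize T 0 0 = t0 at *
  generalize T 0 1 = t1 at *
  generalize T 1 1 = t2 at *
  generalize S 0 0 = s0 at *
  generalize S 0 1 = s1 at *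
  generalize S 1 1 = s2 at *
  generalize A 0 0 = a0 at *
  generalize A 0 1 = a1 at *
  generalize A 1 1 = a2 at *
  linear_combination
    -(t0 * a0 + t1 * a1 + (t1 * a1 + t2 * a2)) *
      (a0 * t0 * h00 + a0 * t1 * h01 + a1 * t0 * h10 + a1 * t1 * h11 +
        a1 * t1 * h00 + a1 * t2 * h01 + a2 * t1 * h10 + a2 * t2 * h11) +
    (t0 * a0 + t1 * a1 + (t1 * a1 + t2 * a2)) ^ 2 / 4 *
      (s0 * t0 * h00 + s0 * t1 * h01 + s1 * t0 * h10 + s1 * t1 * h11 +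
        s1 * t1 * h00 + s1 * t2 * h01 + s2 * t1 * h10 + s2 * t2 * h11 + h00 + h11)

/-- The function `R - 2 Ric(n, n)` of the ambient metric which, by the Gauss equation, is the
integrand of the mass. -/
def massDensity (G : MetricField 3) (b : ℝ) (x : Euc 3) : ℝ :=
  scalarCurvature G x - 2 * ∑ i, ∑ j, ricci G i j x * unitNormal G b i x * unitNormal G b j x

/-- By the Gauss equation `R_σ - H²/2 + |Å|² = R - 2 Ric(n, n)` along the ellipsoid. -/
theorem integrand_eq_massDensity (ha : a ≠ 0) (hb : b ≠ 0) (hu : Real.sin (u 0) ≠ 0)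
    (h : IsRegularAt G (ellipsoidParam a b u)) (hG : (G (ellipsoidParam a b u)).PosDef) :
    scalarCurvature (inducedMetric G a b) u - meanCurvature G a b u ^ 2 / 2 +
      traceFreeNormSq G a b u = massDensity G b (ellipsoidParam a b u) := by
  have hX := contDiff_ellipsoidParam a b
  have hx := ellipsoidParam_ne_zero ha hb u
  have hdet : (pullback G (ellipsoidParam a b) u).det ≠ 0 :=
    det_inducedMetric_ne_zero ha hb hu hG
  have hS := isRegularAt_pullback h hX hdet
  have hNN := metricInner_unitNormal_self h hG hb hx
  have horth : ∀ w, IsRegularAt G (ellipsoidParam a b w) → ∀ α,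
      metricInner G (ellipsoidParam a b w) (fun k => unitNormal G b k (ellipsoidParam a b w))
        (tangent (ellipsoidParam a b) α w) = 0 := by
    intro w hw α
    rw [metricInner_unitNormal hw]
    exact (div_eq_zero_iff).mpr (Or.inl (sum_grad_mul_tangentVec hb α w))
  have hn : ∀ k, DifferentiableAt ℝ (unitNormal G b k) (ellipsoidParam a b u) :=
    fun k => (contDiffAt_unitNormal h hG hb hx k).differentiableAt (by norm_num)
  -- differentiating `⟨n, ∂_β X⟩ = 0`
  have hA : ∀ α β, metricInner G (ellipsoidParam a b u)
      (covDeriv G (ellipsoidParam a b) α (tangent (ellipsoidParam a b) β) u)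
      (fun k => unitNormal G b k (ellipsoidParam a b u)) = -secondFF G a b α β u := by
    intro α β
    have h0 := pd_metricInner h (differentiableAt_of_contDiff hX u) α
      (U := fun w k => unitNormal G b k (ellipsoidParam a b w))
      (V := tangent (ellipsoidParam a b) β)
      (fun k => (hn k).fun_comp' u (differentiableAt_of_contDiff hX u))
      (fun i => differentiableAt_tangent hX β i u)
    rw [pd_congr α (g := fun _ => 0) ((eventually_isRegularAt h hX).mono
      fun w hw => horth w hw β), pd_const, ← secondFF_eq_covDeriv h hn] at h0
    rw [h.metricInner_comm]
    linarith
  have hsym : ∀ α β, secondFF G a b α β u = secondFF G a b β α u := by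
    intro α β
    have := hA α β
    rw [covDeriv_tangent_comm h hX, hA] at this
    linarith
  have hR : scalarCurvature (inducedMetric G a b) u = _ :=
    scalarCurvature_pullback h hX hdet hNN (horth u h)
  simp only [hA, neg_mul_neg] at hR
  have hid := trace_free_identity (inducedMetric G a b u) (inducedMetric G a b u)⁻¹
    (Matrix.of fun α β => secondFF G a b α β u) hS.sum_inv_mul hS.inv_symm hS.symm_at hsym
  simp only [Matrix.of_apply] at hid
  rw [hR]
  simp only [meanCurvature, traceFreeNormSq, traceFreeFF, massDensity]
  have e : pullback G (ellipsoidParam a b) u = inducedMetric G a b u := rfl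
  rw [e]
  linarith

end Ellipsoid

/-! ### Rescaling to a fixed ellipsoid -/

/-- The metric `G(a y)`; up to the factor `a²` it is the pullback of `G` under `y ↦ a y`. -/
def rescale (G : MetricField 3) (a : ℝ) : MetricField 3 := fun y => G (a • y)

section Rescale

variable (G : MetricField 3) {a : ℝ} (b : ℝ) (y : Euc 3)

theorem christoffel_rescale (a : ℝ) (k i j : Fin 3) (y : Euc 3) :
    christoffel (rescale G a) k i j y = a * christoffel G k i j (a • y) := by
  have e : ∀ m i j, pd m (fun y => G (a • y) i j) y = a * pd m (fun x => G x i j) (a • y) :=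
    fun m i j => pd_smul_arg m a (fun x => G x i j) y
  simp only [christoffel, rescale, e, Finset.mul_sum]
  exact Finset.sum_congr rfl fun l _ => by ring

theorem ricci_rescale (a : ℝ) (i j : Fin 3) (y : Euc 3) :
    ricci (rescale G a) i j y = a ^ 2 * ricci G i j (a • y) := by
  have e : ∀ m k i j, pd m (christoffel (rescale G a) k i j) y =
      a ^ 2 * pd m (christoffel G k i j) (a • y) := by
    intro m k i j
    rw [show christoffel (rescale G a) k i j = fun y => a * christoffel G k i j (a • y) from
      funext (christoffel_rescale G a k i j), pd_const_mul, pd_smul_arg]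
    ring
  simp only [ricci, e, christoffel_rescale, mul_add, Finset.mul_sum]
  congr 1
  · exact Finset.sum_congr rfl fun k _ => by ring
  · exact Finset.sum_congr rfl fun k _ => Finset.sum_congr rfl fun l _ => by ring

theorem pd_ellipsoidFun_smul (l : Fin 3) :
    pd l (ellipsoidFun b) (a • y) = a * pd l (ellipsoidFun b) y := by
  rw [pd_ellipsoidFun, pd_ellipsoidFun]
  fin_cases l <;> simp <;> ring

theorem unitNormal_rescale (ha : 0 < a) (k : Fin 3) :
    unitNormal (rescale G a) b k y = unitNormal G b k (a • y) := by
  have e : gradSq G b (a • y) = a ^ 2 * gradSq (rescale G a) b y := by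
    simp only [gradSq, pd_ellipsoidFun_smul, Finset.mul_sum, rescale]
    exact Finset.sum_congr rfl fun i _ => Finset.sum_congr rfl fun j _ => by ring
  rw [unitNormal_eq, unitNormal_eq, e, Real.sqrt_mul (sq_nonneg a), Real.sqrt_sq ha.le]
  have e2 : ∑ l, (G (a • y))⁻¹ k l * pd l (ellipsoidFun b) (a • y) =
      a * ∑ l, (rescale G a y)⁻¹ k l * pd l (ellipsoidFun b) y := by
    simp only [pd_ellipsoidFun_smul, Finset.mul_sum, rescale]
    exact Finset.sum_congr rfl fun i _ => by ring
  rw [e2, mul_div_mul_left _ _ ha.ne']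

theorem massDensity_rescale (ha : 0 < a) :
    massDensity (rescale G a) b y = a ^ 2 * massDensity G b (a • y) := by
  simp only [massDensity, scalarCurvature, ricci_rescale, unitNormal_rescale G b y ha, rescale,
    mul_sub, Finset.mul_sum]
  congr 1
  · exact Finset.sum_congr rfl fun i _ => Finset.sum_congr rfl fun j _ => by ring
  · exact Finset.sum_congr rfl fun i _ => Finset.sum_congr rfl fun j _ => by ring

theorem ellipsoidParam_eq_smul (a b : ℝ) (u : Euc 2) :
    ellipsoidParam a b u = a • ellipsoidParam 1 b u := by
  ext i
  fin_cases i <;> simp [ellipsoidParam] <;> ring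

theorem sqrt_det_inducedMetric (a b : ℝ) (u : Euc 2) :
    √(inducedMetric G a b u).det = a ^ 2 * √(inducedMetric (rescale G a) 1 b u).det := by
  have e1 : ∀ α i, tangentVec a b α i u = a * tangentVec 1 b α i u := by
    intro α i
    rw [tangentVec_eq, tangentVec_eq]
    fin_cases α <;> fin_cases i <;> simp <;> ring
  have e2 : inducedMetric G a b u = (a ^ 2) • inducedMetric (rescale G a) 1 b u := by
    ext α β
    simp only [inducedMetric, Matrix.smul_apply, Matrix.of_apply, smul_eq_mul, Finset.mul_sum,
      rescale, ← ellipsoidParam_eq_smul, e1 _ _]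
    exact Finset.sum_congr rfl fun i _ => Finset.sum_congr rfl fun j _ => by ring
  rw [e2, Matrix.det_smul, Fintype.card_fin, Real.sqrt_mul (by positivity),
    Real.sqrt_sq (by positivity)]

end Rescale

/-- The integrand of the rescaled mass on the unit ellipsoid. -/
def scaledIntegrand (G : MetricField 3) (b a : ℝ) (u : Euc 2) : ℝ :=
  a * massDensity (rescale G a) b (ellipsoidParam 1 b u) *
    √(inducedMetric (rescale G a) 1 b u).det

/-- The double integral over the parameter domain of the ellipsoid. -/
def paramIntegral (F : Euc 2 → ℝ) : ℝ :=
  ∫ θ in (0 : ℝ)..Real.pi, ∫ φ in (0 : ℝ)..(2 * Real.pi), F !₂[θ, φ]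

/-- The mass of `Σ_a` as an integral over `Σ_1`: the factor `a` from the area cancels the factor
`a⁻¹` from the integral. -/
theorem haywardMass_eq {G : MetricField 3} {a b : ℝ} (ha : 0 < a) (hb : b ≠ 0)
    (h : ∀ u, IsRegularAt G (ellipsoidParam a b u))
    (hG : ∀ u, (G (ellipsoidParam a b u)).PosDef) :
    haywardMass G a b = 1 / (8 * Real.pi) *
      √(paramIntegral (fun u => √(inducedMetric (rescale G a) 1 b u).det) / (16 * Real.pi)) *
      paramIntegral (scaledIntegrand G b a) := by
  have harea : area G a b =
      a ^ 2 * paramIntegral (fun u => √(inducedMetric (rescale G a) 1 b u).det) := by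
    simp only [area, surfaceIntegral, paramIntegral, one_mul, sqrt_det_inducedMetric G a b,
      intervalIntegral.integral_const_mul]
  have hint : surfaceIntegral G a b (fun u => scalarCurvature (inducedMetric G a b) u -
      meanCurvature G a b u ^ 2 / 2 + traceFreeNormSq G a b u) =
      a⁻¹ * paramIntegral (scaledIntegrand G b a) := by
    simp only [surfaceIntegral, paramIntegral, ← intervalIntegral.integral_const_mul]
    -- the poles `θ = 0, π`, where the induced metric degenerates, are left out
    refine intervalIntegral.integral_congr_Ioo_of_le Real.pi_pos.le ?_
    intro θ hθ
    refine intervalIntegral.integral_congr fun φ _ => ?_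
    have hs : Real.sin ((!₂[θ, φ] : Euc 2) 0) ≠ 0 := (Real.sin_pos_of_mem_Ioo hθ).ne'
    simp only [scaledIntegrand]
    rw [integrand_eq_massDensity ha.ne' hb hs (h _) (hG _), sqrt_det_inducedMetric,
      massDensity_rescale _ _ _ ha, ← ellipsoidParam_eq_smul]
    field_simp
  rw [haywardMass, harea, hint, mul_div_assoc, Real.sqrt_mul (sq_nonneg a), Real.sqrt_sq ha.le]
  field_simp

/-! ### Asymptotic expansions of metrics -/

open Filter

section Expansion

/-- As `a → ∞` the functions `F a` converge to `f` at `y₀`, locally uniformly and together with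
their first and second partial derivatives. -/
structure JetTendsto (F : ℝ → Euc 3 → ℝ) (f : Euc 3 → ℝ) (y₀ : Euc 3) : Prop where
  val : Tendsto (fun q : ℝ × Euc 3 => F q.1 q.2) (atTop ×ˢ 𝓝 y₀) (𝓝 (f y₀))
  pd₁ : ∀ k, Tendsto (fun q : ℝ × Euc 3 => pd k (F q.1) q.2) (atTop ×ˢ 𝓝 y₀) (𝓝 (pd k f y₀))
  pd₂ : ∀ k l, Tendsto (fun q : ℝ × Euc 3 => pd k (pd l (F q.1)) q.2) (atTop ×ˢ 𝓝 y₀)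
    (𝓝 (pd k (pd l f) y₀))

/-- The metric `G` has the expansion `G(a y) = δ + h(y) / a + o(1 / a)` as `a → ∞`, which may be
differentiated twice in `y`. -/
structure HasExpansion (G h : MetricField 3) : Prop where
  regular : ∃ ρ : ℝ, ∀ x, ρ < ‖x‖ →
    (∀ i j, ContDiffAt ℝ 2 (fun y => G y i j) x) ∧ ∀ i j, G x i j = G x j i
  jet : ∀ y₀, y₀ ≠ 0 → ∀ i j, JetTendsto
    (fun a y => a * (rescale G a y i j - (1 : Matrix (Fin 3) (Fin 3) ℝ) i j)) (fun y => h y i j) y₀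

/-- The linearized Ricci tensor of the perturbation `h` of the Euclidean metric. -/
def linRicci (h : MetricField 3) (i j : Fin 3) (y : Euc 3) : ℝ :=
  ∑ k, ((1 / 2) * (pd k (pd i (fun y => h y j k)) y + pd k (pd j (fun y => h y i k)) y -
      pd k (pd k (fun y => h y i j)) y) -
    (1 / 2) * (pd j (pd i (fun y => h y k k)) y + pd j (pd k (fun y => h y i k)) y -
      pd j (pd k (fun y => h y i k)) y))

/-- The linearization of `massDensity` at the Euclidean metric. -/
def linMassDensity (h : MetricField 3) (b : ℝ) (y : Euc 3) : ℝ :=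
  ∑ i, linRicci h i i y -
    2 * ∑ i, ∑ j, linRicci h i j y * unitNormal (fun _ => 1) b i y * unitNormal (fun _ => 1) b j y

theorem posDef_of_near_one {A : Matrix (Fin 3) (Fin 3) ℝ} (hsymm : ∀ i j, A i j = A j i)
    (h : ∀ i j, |A i j - (1 : Matrix (Fin 3) (Fin 3) ℝ) i j| < 1 / 6) : A.PosDef := by
  rw [Matrix.posDef_iff_dotProduct_mulVec]
  refine ⟨Matrix.IsHermitian.ext fun i j => hsymm j i, fun x hx => ?_⟩
  have hpos : 0 < x 0 ^ 2 + x 1 ^ 2 + x 2 ^ 2 := by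
    by_contra hn
    apply hx
    have h0 : x 0 = 0 := by nlinarith [sq_nonneg (x 0), sq_nonneg (x 1), sq_nonneg (x 2)]
    have h1 : x 1 = 0 := by nlinarith [sq_nonneg (x 0), sq_nonneg (x 1), sq_nonneg (x 2)]
    have h2 : x 2 = 0 := by nlinarith [sq_nonneg (x 0), sq_nonneg (x 1), sq_nonneg (x 2)]
    ext i
    fin_cases i <;> assumption
  have key : ∀ i j, -((x i ^ 2 + x j ^ 2) / 12) ≤
      (A i j - (1 : Matrix (Fin 3) (Fin 3) ℝ) i j) * x i * x j := by
    intro i j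
    have h1 := abs_le.mp ((abs_mul _ (x i * x j)).trans_le
      (mul_le_mul_of_nonneg_right (h i j).le (abs_nonneg (x i * x j))))
    have h2 : |x i * x j| ≤ (x i ^ 2 + x j ^ 2) / 2 := by
      rw [abs_le]
      constructor <;> nlinarith [sq_nonneg (x i + x j), sq_nonneg (x i - x j)]
    linarith [h1.1]
  have e : star x ⬝ᵥ A.mulVec x = x 0 ^ 2 + x 1 ^ 2 + x 2 ^ 2 +
      ∑ i, ∑ j, (A i j - (1 : Matrix (Fin 3) (Fin 3) ℝ) i j) * x i * x j := by
    simp [dotProduct, Matrix.mulVec, Fin.sum_univ_three, Matrix.one_apply]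
    ring
  have hs := Finset.sum_le_sum fun i (_ : i ∈ Finset.univ) =>
    Finset.sum_le_sum fun j (_ : j ∈ Finset.univ) => key i j
  rw [e]
  refine lt_of_lt_of_le ?_ (add_le_add_right hs _)
  simp only [Fin.sum_univ_three]
  linarith

theorem tendsto_zero_of_mul_atTop {f : ℝ × Euc 3 → ℝ} {y₀ : Euc 3} {c : ℝ}
    (h : Tendsto (fun q : ℝ × Euc 3 => q.1 * f q) (atTop ×ˢ 𝓝 y₀) (𝓝 c)) :
    Tendsto f (atTop ×ˢ 𝓝 y₀) (𝓝 0) := by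
  have h1 : Tendsto (fun q : ℝ × Euc 3 => q.1⁻¹) (atTop ×ˢ 𝓝 y₀) (𝓝 0) :=
    tendsto_inv_atTop_zero.comp tendsto_fst
  have h2 := h1.mul h
  rw [zero_mul] at h2
  refine h2.congr' ?_
  filter_upwards [tendsto_fst.eventually (eventually_ne_atTop (0 : ℝ))] with q hq
  field_simp

theorem pd_const_mul_sub_const (k : Fin 3) (a c : ℝ) (f : Euc 3 → ℝ) :
    pd k (fun y => a * (f y - c)) = fun y => a * pd k f y := by
  funext y
  rw [pd_const_mul, pd, pd, fderiv_sub_const]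

variable {G h : MetricField 3} {y₀ : Euc 3}

namespace HasExpansion

theorem tendsto_pd (H : HasExpansion G h) (hy : y₀ ≠ 0) (k i j : Fin 3) :
    Tendsto (fun q : ℝ × Euc 3 => q.1 * pd k (fun y => rescale G q.1 y i j) q.2)
      (atTop ×ˢ 𝓝 y₀) (𝓝 (pd k (fun y => h y i j) y₀)) := by
  simpa only [pd_const_mul_sub_const] using (H.jet y₀ hy i j).pd₁ k

theorem tendsto_pd_pd (H : HasExpansion G h) (hy : y₀ ≠ 0) (k l i j : Fin 3) :
    Tendsto (fun q : ℝ × Euc 3 => q.1 * pd k (pd l (fun y => rescale G q.1 y i j)) q.2)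
      (atTop ×ˢ 𝓝 y₀) (𝓝 (pd k (pd l (fun y => h y i j)) y₀)) := by
  simpa only [pd_const_mul_sub_const, pd_const_mul] using (H.jet y₀ hy i j).pd₂ k l

theorem tendsto_entry (H : HasExpansion G h) (hy : y₀ ≠ 0) (i j : Fin 3) :
    Tendsto (fun q : ℝ × Euc 3 => rescale G q.1 q.2 i j) (atTop ×ˢ 𝓝 y₀)
      (𝓝 ((1 : Matrix (Fin 3) (Fin 3) ℝ) i j)) := by
  simpa using (tendsto_zero_of_mul_atTop (H.jet y₀ hy i j).val).add_const
    ((1 : Matrix (Fin 3) (Fin 3) ℝ) i j)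

theorem tendsto_inv_entry (H : HasExpansion G h) (hy : y₀ ≠ 0) (i j : Fin 3) :
    Tendsto (fun q : ℝ × Euc 3 => (rescale G q.1 q.2)⁻¹ i j) (atTop ×ˢ 𝓝 y₀)
      (𝓝 ((1 : Matrix (Fin 3) (Fin 3) ℝ) i j)) := by
  have h1 : Tendsto (fun q : ℝ × Euc 3 => rescale G q.1 q.2) (atTop ×ˢ 𝓝 y₀)
      (𝓝 (1 : Matrix (Fin 3) (Fin 3) ℝ)) :=
    tendsto_pi_nhds.mpr fun i => tendsto_pi_nhds.mpr fun j => H.tendsto_entry hy i j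
  have h2 : ContinuousAt Inv.inv (1 : Matrix (Fin 3) (Fin 3) ℝ) := by
    refine continuousAt_matrix_inv _ ?_
    simp [Ring.inverse_eq_inv']
  have h3 := h2.tendsto.comp h1
  rw [inv_one] at h3
  exact tendsto_pi_nhds.mp (tendsto_pi_nhds.mp h3 i) j

theorem eventually_regular (H : HasExpansion G h) (hy : y₀ ≠ 0) :
    ∀ᶠ q : ℝ × Euc 3 in atTop ×ˢ 𝓝 y₀,
      IsRegularAt G (q.1 • q.2) ∧ (G (q.1 • q.2)).PosDef := by
  obtain ⟨ρ, hρ⟩ := H.regular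
  have h1 : Tendsto (fun q : ℝ × Euc 3 => ‖q.1 • q.2‖) (atTop ×ˢ 𝓝 y₀) atTop := by
    have h2 : Tendsto (fun q : ℝ × Euc 3 => q.1 * ‖q.2‖) (atTop ×ˢ 𝓝 y₀) atTop :=
      tendsto_fst.atTop_mul_pos (norm_pos_iff.mpr hy) tendsto_snd.norm
    refine h2.congr' ?_
    filter_upwards [tendsto_fst.eventually (eventually_ge_atTop (0 : ℝ))] with q hq
    rw [norm_smul, Real.norm_of_nonneg hq]
  have h2 : ∀ i j, ∀ᶠ q : ℝ × Euc 3 in atTop ×ˢ 𝓝 y₀,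
      |rescale G q.1 q.2 i j - (1 : Matrix (Fin 3) (Fin 3) ℝ) i j| < 1 / 6 := by
    intro i j
    have := (H.tendsto_entry hy i j).eventually
      (Metric.ball_mem_nhds _ (by norm_num : (0 : ℝ) < 1 / 6))
    simpa only [Metric.mem_ball, Real.dist_eq] using this
  simp only [← eventually_all] at h2
  filter_upwards [h1.eventually_gt_atTop ρ, h2] with q hq h3
  have hpos : (G (q.1 • q.2)).PosDef := posDef_of_near_one (hρ _ hq).2 h3
  exact ⟨⟨(hρ _ hq).1, ((continuous_norm.tendsto _).eventually (lt_mem_nhds hq)).mono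
    fun y hy => (hρ y hy).2, hpos.det_pos.ne'⟩, hpos⟩

theorem _root_.HaywardMass.IsRegularAt.rescale {a : ℝ} {y : Euc 3} (h : IsRegularAt G (a • y)) :
    IsRegularAt (rescale G a) y where
  contDiffAt i j := (h.contDiffAt i j).comp y (contDiff_const_smul a).contDiffAt
  symm := (continuous_const_smul a).continuousAt.eventually h.symm
  det_ne_zero := h.det_ne_zero

theorem eventually_isRegularAt_rescale (H : HasExpansion G h) (hy : y₀ ≠ 0) :
    ∀ᶠ q : ℝ × Euc 3 in atTop ×ˢ 𝓝 y₀, IsRegularAt (rescale G q.1) q.2 :=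
  (H.eventually_regular hy).mono fun _ hq => hq.1.rescale

theorem tendsto_lowChristoffel (H : HasExpansion G h) (hy : y₀ ≠ 0) (p i j : Fin 3) :
    Tendsto (fun q : ℝ × Euc 3 => q.1 * lowChristoffel (rescale G q.1) p i j q.2)
      (atTop ×ˢ 𝓝 y₀) (𝓝 (lowChristoffel h p i j y₀)) := by
  refine ((((H.tendsto_pd hy i j p).add (H.tendsto_pd hy j i p)).sub
    (H.tendsto_pd hy p i j)).const_mul (1 / 2)).congr fun q => ?_
  simp only [lowChristoffel]
  ring

/-- The inverse metric tends to `δ`, so raising the index has no effect in the limit. -/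
theorem tendsto_christoffel (H : HasExpansion G h) (hy : y₀ ≠ 0) (k i j : Fin 3) :
    Tendsto (fun q : ℝ × Euc 3 => q.1 * christoffel (rescale G q.1) k i j q.2)
      (atTop ×ˢ 𝓝 y₀) (𝓝 (lowChristoffel h k i j y₀)) := by
  have h1 := tendsto_finsetSum Finset.univ fun l _ =>
    (H.tendsto_inv_entry hy k l).mul (H.tendsto_lowChristoffel hy l i j)
  simp only [Matrix.one_apply, ite_mul, one_mul, zero_mul, Finset.sum_ite_eq, Finset.mem_univ,
    if_true] at h1
  refine h1.congr fun q => ?_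
  rw [christoffel_eq, Finset.mul_sum]
  exact Finset.sum_congr rfl fun l _ => by ring

theorem tendsto_pd_christoffel (H : HasExpansion G h) (hy : y₀ ≠ 0) (m k i j : Fin 3) :
    Tendsto (fun q : ℝ × Euc 3 => q.1 * pd m (christoffel (rescale G q.1) k i j) q.2)
      (atTop ×ˢ 𝓝 y₀) (𝓝 ((1 / 2) * (pd m (pd i (fun y => h y j k)) y₀ +
        pd m (pd j (fun y => h y i k)) y₀ - pd m (pd k (fun y => h y i j)) y₀))) := by
  -- the derivatives of the inverse metric tend to zero
  have h1 : ∀ l, Tendsto (fun q : ℝ × Euc 3 => -∑ s, ∑ r, (rescale G q.1 q.2)⁻¹ k r *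
      pd m (fun y => rescale G q.1 y r s) q.2 * (rescale G q.1 q.2)⁻¹ s l)
      (atTop ×ˢ 𝓝 y₀) (𝓝 0) := by
    intro l
    have := (tendsto_finsetSum Finset.univ fun s _ => tendsto_finsetSum Finset.univ fun r _ =>
      ((H.tendsto_inv_entry hy k r).mul (tendsto_zero_of_mul_atTop (H.tendsto_pd hy m r s))).mul
        (H.tendsto_inv_entry hy s l)).neg
    simpa using this
  have h2 := tendsto_finsetSum Finset.univ fun l _ =>
    ((h1 l).mul (H.tendsto_lowChristoffel hy l i j)).add ((H.tendsto_inv_entry hy k l).mul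
      ((((H.tendsto_pd_pd hy m i j l).add (H.tendsto_pd_pd hy m j i l)).sub
        (H.tendsto_pd_pd hy m l i j)).const_mul (1 / 2)))
  simp only [Matrix.one_apply, ite_mul, one_mul, zero_mul, zero_add, Finset.sum_ite_eq,
    Finset.mem_univ, if_true] at h2
  refine h2.congr' ?_
  filter_upwards [H.eventually_isRegularAt_rescale hy] with q hq
  rw [hq.pd_christoffel, Finset.mul_sum]
  refine Finset.sum_congr rfl fun l _ => ?_
  rw [pd_inv_entry (fun i j => (hq.contDiffAt i j).of_le (by norm_num)) hq.det_ne_zero,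
    hq.pd_lowChristoffel]
  ring

/-- The products of Christoffel symbols are of second order and do not contribute. -/
theorem tendsto_ricci (H : HasExpansion G h) (hy : y₀ ≠ 0) (i j : Fin 3) :
    Tendsto (fun q : ℝ × Euc 3 => q.1 * ricci (rescale G q.1) i j q.2)
      (atTop ×ˢ 𝓝 y₀) (𝓝 (linRicci h i j y₀)) := by
  have h0 : ∀ k i j, Tendsto (fun q : ℝ × Euc 3 => christoffel (rescale G q.1) k i j q.2)
      (atTop ×ˢ 𝓝 y₀) (𝓝 0) :=
    fun k i j => tendsto_zero_of_mul_atTop (H.tendsto_christoffel hy k i j)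
  have h1 := tendsto_finsetSum Finset.univ fun k _ =>
    (H.tendsto_pd_christoffel hy k k i j).sub (H.tendsto_pd_christoffel hy j k i k)
  have h2 := tendsto_finsetSum Finset.univ fun k _ => tendsto_finsetSum Finset.univ fun l _ =>
    ((H.tendsto_christoffel hy k k l).mul (h0 l i j)).sub
      ((H.tendsto_christoffel hy k j l).mul (h0 l i k))
  simp only [mul_zero, sub_zero, Finset.sum_const_zero] at h2
  have h3 := h1.add h2
  rw [add_zero] at h3
  refine (h3.congr fun q => ?_).trans_eq ?_
  · simp only [ricci, mul_add, Finset.mul_sum]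
    congr 1
    · exact Finset.sum_congr rfl fun k _ => by ring
    · exact Finset.sum_congr rfl fun k _ => Finset.sum_congr rfl fun l _ => by ring
  · rfl

theorem tendsto_gradSq (H : HasExpansion G h) (hy : y₀ ≠ 0) (b : ℝ) :
    Tendsto (fun q : ℝ × Euc 3 => gradSq (rescale G q.1) b q.2)
      (atTop ×ˢ 𝓝 y₀) (𝓝 (gradSq (fun _ => 1) b y₀)) := by
  have hw : ∀ l, Tendsto (fun q : ℝ × Euc 3 => pd l (ellipsoidFun b) q.2) (atTop ×ˢ 𝓝 y₀)
      (𝓝 (pd l (ellipsoidFun b) y₀)) := fun l =>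
    (contDiffAt_pd_ellipsoidFun b l y₀).continuousAt.tendsto.comp tendsto_snd
  have := tendsto_finsetSum Finset.univ fun i _ => tendsto_finsetSum Finset.univ fun j _ =>
    ((H.tendsto_inv_entry hy i j).mul (hw i)).mul (hw j)
  simpa only [gradSq, inv_one] using this

theorem tendsto_unitNormal (H : HasExpansion G h) (hy : y₀ ≠ 0) {b : ℝ} (hb : b ≠ 0)
    (k : Fin 3) :
    Tendsto (fun q : ℝ × Euc 3 => unitNormal (rescale G q.1) b k q.2)
      (atTop ×ˢ 𝓝 y₀) (𝓝 (unitNormal (fun _ => 1) b k y₀)) := by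
  have hw : ∀ l, Tendsto (fun q : ℝ × Euc 3 => pd l (ellipsoidFun b) q.2) (atTop ×ˢ 𝓝 y₀)
      (𝓝 (pd l (ellipsoidFun b) y₀)) := fun l =>
    (contDiffAt_pd_ellipsoidFun b l y₀).continuousAt.tendsto.comp tendsto_snd
  have hpos : 0 < gradSq (fun _ => 1) b y₀ := gradSq_pos Matrix.PosDef.one hb hy
  have := (tendsto_finsetSum Finset.univ fun l _ => (H.tendsto_inv_entry hy k l).mul (hw l)).div
    (H.tendsto_gradSq hy b).sqrt (Real.sqrt_pos.mpr hpos).ne'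
  simp only [unitNormal_eq, inv_one]
  exact this

theorem tendsto_massDensity (H : HasExpansion G h) (hy : y₀ ≠ 0) {b : ℝ} (hb : b ≠ 0) :
    Tendsto (fun q : ℝ × Euc 3 => q.1 * massDensity (rescale G q.1) b q.2)
      (atTop ×ˢ 𝓝 y₀) (𝓝 (linMassDensity h b y₀)) := by
  have h1 := tendsto_finsetSum Finset.univ fun i _ => tendsto_finsetSum Finset.univ fun j _ =>
    (H.tendsto_inv_entry hy i j).mul (H.tendsto_ricci hy i j)
  have h2 := (tendsto_finsetSum Finset.univ fun i _ => tendsto_finsetSum Finset.univ fun j _ =>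
    ((H.tendsto_ricci hy i j).mul (H.tendsto_unitNormal hy hb i)).mul
      (H.tendsto_unitNormal hy hb j)).const_mul 2
  simp only [Matrix.one_apply, ite_mul, one_mul, zero_mul, Finset.sum_ite_eq, Finset.mem_univ,
    if_true] at h1
  refine (h1.sub h2).congr fun q => ?_
  simp only [massDensity, scalarCurvature, mul_sub, Finset.mul_sum]
  congr 1 <;> exact Finset.sum_congr rfl fun i _ => Finset.sum_congr rfl fun j _ => by ring

end HasExpansion

end Expansion

/-! ### Convergence of the mass -/

section ParamIntegral

theorem eventually_forall_mem_of_isCompact {Y : Type*} [TopologicalSpace Y] {K : Set Y}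
    (hK : IsCompact K) {P : ℝ → Y → Prop}
    (h : ∀ y ∈ K, ∀ᶠ q : ℝ × Y in atTop ×ˢ 𝓝 y, P q.1 q.2) :
    ∀ᶠ a in atTop, ∀ y ∈ K, P a y := by
  have h1 : {q : ℝ × Y | P q.1 q.2} ∈ atTop ×ˢ 𝓝ˢ K := hK.mem_prod_nhdsSet_of_forall h
  have h2 : ∀ᶠ q : ℝ × Y in atTop ×ˢ 𝓟 K, P q.1 q.2 :=
    Filter.prod_mono le_rfl principal_le_nhdsSet h1
  exact eventually_prod_principal_iff.mp h2

theorem continuous_of_tendsto_prod_nhds {Y : Type*} [TopologicalSpace Y] {F : ℝ → Y → ℝ}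
    {f : Y → ℝ} (hlim : ∀ u, Tendsto (fun q : ℝ × Y => F q.1 q.2) (atTop ×ˢ 𝓝 u) (𝓝 (f u))) :
    Continuous f := by
  rw [continuous_iff_continuousAt]
  intro u
  rw [ContinuousAt, Metric.tendsto_nhds]
  intro ε hε
  have h1 := (hlim u).eventually (Metric.closedBall_mem_nhds (f u) (half_pos hε))
  obtain ⟨pa, ha, pb, hb, hab⟩ := eventually_prod_iff.mp h1
  filter_upwards [hb] with w hw
  have h2 : Tendsto (fun a => F a w) atTop (𝓝 (f w)) :=
    (hlim w).comp (tendsto_id.prodMk (tendsto_const_nhds : Tendsto (fun _ => w) atTop (𝓝 w)))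
  have h3 : f w ∈ Metric.closedBall (f u) (ε / 2) :=
    Metric.isClosed_closedBall.mem_of_tendsto h2 (ha.mono fun a haa => hab haa hw)
  exact lt_of_le_of_lt h3 (half_lt_self hε)

theorem continuous_param : Continuous fun q : ℝ × ℝ => (!₂[q.1, q.2] : Euc 2) := by
  refine (PiLp.continuous_toLp 2 _).comp (continuous_pi fun i => ?_)
  fin_cases i
  · exact continuous_fst
  · exact continuous_snd

/-- Convergence along `atTop ×ˢ 𝓝 u` for all `u` is locally uniform, hence uniform on the compact
parameter domain. -/
theorem tendsto_paramIntegral {F : ℝ → Euc 2 → ℝ} {f : Euc 2 → ℝ}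
    (hF : ∀ᶠ a in atTop, Continuous (F a))
    (hlim : ∀ u, Tendsto (fun q : ℝ × Euc 2 => F q.1 q.2) (atTop ×ˢ 𝓝 u) (𝓝 (f u))) :
    Tendsto (fun a => paramIntegral (F a)) atTop (𝓝 (paramIntegral f)) := by
  have hf : Continuous f := continuous_of_tendsto_prod_nhds hlim
  let K : Set (Euc 2) := (fun q : ℝ × ℝ => (!₂[q.1, q.2] : Euc 2)) ''
    (Set.Icc 0 Real.pi ×ˢ Set.Icc 0 (2 * Real.pi))
  have hK : IsCompact K := (isCompact_Icc.prod isCompact_Icc).image continuous_param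
  have hunif : ∀ ε > 0, ∀ᶠ a in atTop, ∀ u ∈ K, |F a u - f u| < ε := by
    intro ε hε
    refine eventually_forall_mem_of_isCompact hK fun u _ => ?_
    have h1 : Tendsto (fun q : ℝ × Euc 2 => F q.1 q.2 - f q.2) (atTop ×ˢ 𝓝 u) (𝓝 0) := by
      simpa using (hlim u).sub ((hf.tendsto u).comp tendsto_snd)
    have h2 := h1.eventually (Metric.ball_mem_nhds 0 hε)
    simpa only [Metric.mem_ball, Real.dist_eq, sub_zero] using h2
  rw [Metric.tendsto_nhds]
  intro ε hε
  have hπ := Real.pi_pos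
  have hδ : 0 < ε / (4 * Real.pi ^ 2) := by positivity
  filter_upwards [hF, hunif _ hδ] with a hFa ha
  have c : ∀ {g : Euc 2 → ℝ}, Continuous g → Continuous fun q : ℝ × ℝ => g !₂[q.1, q.2] :=
    fun hg => hg.comp continuous_param
  have hin : ∀ {g : Euc 2 → ℝ}, Continuous g → ∀ θ,
      IntervalIntegrable (fun φ => g !₂[θ, φ]) MeasureTheory.volume 0 (2 * Real.pi) :=
    fun hg θ => ((c hg).comp (Continuous.prodMk_right θ)).intervalIntegrable _ _
  have hout : ∀ {g : Euc 2 → ℝ}, Continuous g → IntervalIntegrable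
      (fun θ => ∫ φ in (0 : ℝ)..(2 * Real.pi), g !₂[θ, φ]) MeasureTheory.volume 0 Real.pi :=
    fun hg => (intervalIntegral.continuous_parametric_intervalIntegral_of_continuous'
      (f := fun θ φ => _) (c hg) _ _).intervalIntegrable _ _
  have e : paramIntegral (F a) - paramIntegral f = ∫ θ in (0 : ℝ)..Real.pi,
      ∫ φ in (0 : ℝ)..(2 * Real.pi), (F a !₂[θ, φ] - f !₂[θ, φ]) := by
    rw [paramIntegral, paramIntegral, ← intervalIntegral.integral_sub (hout hFa) (hout hf)]
    exact intervalIntegral.integral_congr fun θ _ =>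
      (intervalIntegral.integral_sub (hin hFa θ) (hin hf θ)).symm
  rw [Real.dist_eq, e, ← Real.norm_eq_abs]
  have hb1 : ∀ θ ∈ Set.uIoc 0 Real.pi, ‖∫ φ in (0 : ℝ)..(2 * Real.pi),
      (F a !₂[θ, φ] - f !₂[θ, φ])‖ ≤ ε / (4 * Real.pi ^ 2) * |2 * Real.pi - 0| := by
    intro θ hθ
    rw [Set.uIoc_of_le hπ.le] at hθ
    refine intervalIntegral.norm_integral_le_of_norm_le_const fun φ hφ => ?_
    rw [Set.uIoc_of_le (by positivity)] at hφ
    exact (ha _ ⟨(θ, φ), ⟨Set.Ioc_subset_Icc_self hθ, Set.Ioc_subset_Icc_self hφ⟩, rfl⟩).le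
  refine (intervalIntegral.norm_integral_le_of_norm_le_const hb1).trans_lt ?_
  rw [sub_zero, sub_zero, abs_of_pos hπ, abs_of_pos (by positivity)]
  field_simp
  norm_num

end ParamIntegral

section Limit

variable {G h : MetricField 3} {b : ℝ}

theorem norm_sq_ellipsoidParam (b : ℝ) (u : Euc 2) :
    ‖ellipsoidParam 1 b u‖ ^ 2 = Real.sin (u 0) ^ 2 + b ^ 2 * Real.cos (u 0) ^ 2 := by
  rw [EuclideanSpace.real_norm_sq_eq, Fin.sum_univ_three]
  simp [ellipsoidParam]
  linear_combination Real.sin (u 0) ^ 2 * Real.sin_sq_add_cos_sq (u 1)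

theorem ellipsoidParam_mem_annulus (hb : 1 ≤ b) (u : Euc 2) :
    ellipsoidParam 1 b u ∈ {y : Euc 3 | 1 ≤ ‖y‖} ∩ Metric.closedBall 0 b := by
  have h := norm_sq_ellipsoidParam b u
  have h1 := Real.sin_sq_add_cos_sq (u 0)
  have hb2 : 1 ≤ b ^ 2 := one_le_pow₀ hb
  refine ⟨?_, ?_⟩
  · refine (one_le_sq_iff₀ (norm_nonneg _)).mp ?_
    nlinarith [sq_nonneg (Real.cos (u 0))]
  · rw [mem_closedBall_zero_iff]
    refine (sq_le_sq₀ (norm_nonneg _) (by linarith)).mp ?_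
    nlinarith [sq_nonneg (Real.sin (u 0))]

theorem isCompact_annulus (b : ℝ) :
    IsCompact ({y : Euc 3 | 1 ≤ ‖y‖} ∩ Metric.closedBall 0 b) :=
  (isCompact_closedBall 0 b).inter_left (isClosed_le continuous_const continuous_norm)

theorem continuousAt_massDensity {x : Euc 3} (h : IsRegularAt G x) (hG : (G x).PosDef)
    (hb : b ≠ 0) (hx : x ≠ 0) : ContinuousAt (massDensity G b) x := by
  have h1 := fun i j => (contDiffAt_inv_entry h.contDiffAt h.det_ne_zero i j).continuousAt
  have h2 := fun k => (contDiffAt_unitNormal h hG hb hx k).continuousAt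
  have h3 := fun i j => h.continuousAt_ricci i j
  exact (tendsto_finsetSum _ fun i _ => tendsto_finsetSum _ fun j _ => (h1 i j).mul (h3 i j)).sub
    ((tendsto_finsetSum _ fun i _ => tendsto_finsetSum _ fun j _ =>
      ((h3 i j).mul (h2 i)).mul (h2 j)).const_mul 2)

theorem continuous_tangentVec (a b : ℝ) (α : Fin 2) (i : Fin 3) :
    Continuous (tangentVec a b α i) :=
  continuous_iff_continuousAt.mpr fun u =>
    (contDiffAt_tangent (contDiff_ellipsoidParam a b) α i u).continuousAt

theorem inducedMetric_apply (G : MetricField 3) (a b : ℝ) (u : Euc 2) (α β : Fin 2) :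
    inducedMetric G a b u α β = ∑ i, ∑ j,
      G (ellipsoidParam a b u) i j * tangentVec a b α i u * tangentVec a b β j u := rfl

/-- The area elements of the rescaled ellipsoids converge to the Euclidean one. -/
theorem HasExpansion.tendsto_areaElement (H : HasExpansion G h) (hb : b ≠ 0) (u : Euc 2) :
    Tendsto (fun q : ℝ × Euc 2 => √(inducedMetric (rescale G q.1) 1 b q.2).det)
      (atTop ×ˢ 𝓝 u) (𝓝 √(inducedMetric (fun _ => 1) 1 b u).det) := by
  have hq : Tendsto (fun q : ℝ × Euc 2 => (q.1, ellipsoidParam 1 b q.2)) (atTop ×ˢ 𝓝 u)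
      (atTop ×ˢ 𝓝 (ellipsoidParam 1 b u)) :=
    tendsto_fst.prodMk (((contDiff_ellipsoidParam 1 b).continuous.tendsto u).comp tendsto_snd)
  have ht : ∀ α i, Tendsto (fun q : ℝ × Euc 2 => tangentVec 1 b α i q.2) (atTop ×ˢ 𝓝 u)
      (𝓝 (tangentVec 1 b α i u)) :=
    fun α i => ((continuous_tangentVec 1 b α i).tendsto u).comp tendsto_snd
  have he : ∀ α β, Tendsto (fun q : ℝ × Euc 2 => inducedMetric (rescale G q.1) 1 b q.2 α β)
      (atTop ×ˢ 𝓝 u) (𝓝 (inducedMetric (fun _ => 1) 1 b u α β)) := by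
    intro α β
    simp only [inducedMetric_apply]
    exact tendsto_finsetSum _ fun i _ => tendsto_finsetSum _ fun j _ =>
      (((H.tendsto_entry (ellipsoidParam_ne_zero one_ne_zero hb u) i j).comp hq).mul
        (ht α i)).mul (ht β j)
  simp only [Matrix.det_fin_two]
  exact (((he 0 0).mul (he 1 1)).sub ((he 0 1).mul (he 1 0))).sqrt

theorem HasExpansion.tendsto_scaledIntegrand (H : HasExpansion G h) (hb : b ≠ 0) (u : Euc 2) :
    Tendsto (fun q : ℝ × Euc 2 => scaledIntegrand G b q.1 q.2) (atTop ×ˢ 𝓝 u)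
      (𝓝 (linMassDensity h b (ellipsoidParam 1 b u) *
        √(inducedMetric (fun _ => 1) 1 b u).det)) := by
  have hq : Tendsto (fun q : ℝ × Euc 2 => (q.1, ellipsoidParam 1 b q.2)) (atTop ×ˢ 𝓝 u)
      (atTop ×ˢ 𝓝 (ellipsoidParam 1 b u)) :=
    tendsto_fst.prodMk (((contDiff_ellipsoidParam 1 b).continuous.tendsto u).comp tendsto_snd)
  exact ((H.tendsto_massDensity (ellipsoidParam_ne_zero one_ne_zero hb u) hb).comp hq).mul
    (H.tendsto_areaElement hb u)

/-- The Hayward mass of large ellipsoids depends, in the limit, only on the first order term of the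
expansion of the metric at infinity. -/
theorem HasExpansion.tendsto_haywardMass (H : HasExpansion G h) (hb : 1 ≤ b) :
    Tendsto (fun a => haywardMass G a b) atTop (𝓝 (1 / (8 * Real.pi) *
      √(paramIntegral (fun u => √(inducedMetric (fun _ => 1) 1 b u).det) / (16 * Real.pi)) *
      paramIntegral (fun u => linMassDensity h b (ellipsoidParam 1 b u) *
        √(inducedMetric (fun _ => 1) 1 b u).det))) := by
  have hb0 : b ≠ 0 := by linarith
  have hreg : ∀ᶠ a in atTop, ∀ y ∈ {y : Euc 3 | 1 ≤ ‖y‖} ∩ Metric.closedBall 0 b,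
      IsRegularAt G (a • y) ∧ (G (a • y)).PosDef :=
    eventually_forall_mem_of_isCompact (P := fun a y => IsRegularAt G (a • y) ∧
      (G (a • y)).PosDef) (isCompact_annulus b) fun y hy =>
      H.eventually_regular (norm_pos_iff.mp (zero_lt_one.trans_le hy.1))
  have hreg' : ∀ᶠ a in atTop, ∀ u : Euc 2, IsRegularAt G (ellipsoidParam a b u) ∧
      (G (ellipsoidParam a b u)).PosDef := by
    filter_upwards [hreg] with a ha u
    rw [ellipsoidParam_eq_smul]
    exact ha _ (ellipsoidParam_mem_annulus hb u)
  have hcont : ∀ᶠ a in atTop,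
      Continuous (fun u => √(inducedMetric (rescale G a) 1 b u).det) := by
    filter_upwards [hreg'] with a ha
    have he : ∀ α β, Continuous (fun u => inducedMetric (rescale G a) 1 b u α β) := by
      intro α β
      simp only [inducedMetric_apply]
      refine continuous_finsetSum _ fun i _ => continuous_finsetSum _ fun j _ => ?_
      refine (Continuous.mul ?_ (continuous_tangentVec 1 b α i)).mul (continuous_tangentVec 1 b β j)
      refine continuous_iff_continuousAt.mpr fun u => ?_
      have hu := (ha u).1
      rw [ellipsoidParam_eq_smul] at hu
      exact (hu.rescale.contDiffAt i j).continuousAt.comp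
        (f := ellipsoidParam 1 b) (contDiff_ellipsoidParam 1 b).continuous.continuousAt
    simp only [Matrix.det_fin_two]
    exact (((he 0 0).mul (he 1 1)).sub ((he 0 1).mul (he 1 0))).sqrt
  have hcont2 : ∀ᶠ a in atTop, Continuous (scaledIntegrand G b a) := by
    filter_upwards [hreg', hcont] with a ha hc
    refine (continuous_const.mul (continuous_iff_continuousAt.mpr fun u => ?_)).mul hc
    have hu := ha u
    rw [ellipsoidParam_eq_smul] at hu
    exact (continuousAt_massDensity hu.1.rescale hu.2 hb0
      (ellipsoidParam_ne_zero one_ne_zero hb0 u)).comp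
      (f := ellipsoidParam 1 b) (contDiff_ellipsoidParam 1 b).continuous.continuousAt
  have h1 := tendsto_paramIntegral hcont fun u => H.tendsto_areaElement hb0 u
  have h2 := tendsto_paramIntegral hcont2 fun u => H.tendsto_scaledIntegrand hb0 u
  refine (((h1.div_const _).sqrt.const_mul _).mul h2).congr' ?_
  filter_upwards [hreg', eventually_gt_atTop 0] with a ha ha0
  exact (haywardMass_eq ha0 hb0 (fun u => (ha u).1) (fun u => (ha u).2)).symm

end Limit

/-! ### The expansion of asymptotically Schwarzschild metrics -/

section Schwarzschild

variable {y₀ : Euc 3}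

theorem contDiffAt_pd_param {Φ : ℝ → Euc 3 → ℝ} {p : ℝ × Euc 3} {n l : WithTop ℕ∞}
    (h : ContDiffAt ℝ n (fun q : ℝ × Euc 3 => Φ q.1 q.2) p) (hl : l + 1 ≤ n) (k : Fin 3) :
    ContDiffAt ℝ l (fun q : ℝ × Euc 3 => pd k (Φ q.1) q.2) p := by
  have h1 : ContDiffAt ℝ n (Function.uncurry fun (q : ℝ × Euc 3) (y : Euc 3) => Φ q.1 y)
      (p, p.2) :=
    ContDiffAt.comp (p, p.2) (f := fun r : (ℝ × Euc 3) × Euc 3 => (r.1.1, r.2))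
      (g := fun q : ℝ × Euc 3 => Φ q.1 q.2) h
      ((contDiffAt_fst.comp _ contDiffAt_fst).prodMk contDiffAt_snd)
  exact (ContDiffAt.fderiv h1 contDiffAt_snd hl).clm_apply contDiffAt_const

/-- A family of functions depending smoothly on `ε = 1 / a` converges with its derivatives. -/
theorem JetTendsto.of_contDiffAt {Φ : ℝ → Euc 3 → ℝ}
    (h : ContDiffAt ℝ 2 (fun q : ℝ × Euc 3 => Φ q.1 q.2) (0, y₀)) :
    JetTendsto (fun a => Φ a⁻¹) (Φ 0) y₀ := by
  have hl : Tendsto (fun q : ℝ × Euc 3 => (q.1⁻¹, q.2)) (atTop ×ˢ 𝓝 y₀) (𝓝 (0, y₀)) :=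
    (tendsto_inv_atTop_zero.comp tendsto_fst).prodMk_nhds tendsto_snd
  have h1 := fun k => contDiffAt_pd_param h (l := 1) (by norm_num) k
  have h2 := fun k l => contDiffAt_pd_param (Φ := fun ε y => pd l (Φ ε) y) (h1 l) (l := 0)
    (by norm_num) k
  exact ⟨h.continuousAt.tendsto.comp hl, fun k => (h1 k).continuousAt.tendsto.comp hl,
    fun k l => (h2 k l).continuousAt.tendsto.comp hl⟩

theorem JetTendsto.congr {F F' : ℝ → Euc 3 → ℝ} {f : Euc 3 → ℝ} (h : JetTendsto F f y₀)
    (he : ∀ᶠ q : ℝ × Euc 3 in atTop ×ˢ 𝓝 y₀, F q.1 =ᶠ[𝓝 q.2] F' q.1) : JetTendsto F' f y₀ where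
  val := h.val.congr' (he.mono fun _ hq => hq.self_of_nhds)
  pd₁ k := (h.pd₁ k).congr' (he.mono fun _ hq => pd_congr k hq)
  pd₂ k l := (h.pd₂ k l).congr' (he.mono fun _ hq => pd_congr k (pd_eventuallyEq l hq))

theorem JetTendsto.add_zero {F E : ℝ → Euc 3 → ℝ} {f : Euc 3 → ℝ} (h : JetTendsto F f y₀)
    (hE : JetTendsto E (fun _ => 0) y₀)
    (hF : ∀ᶠ q : ℝ × Euc 3 in atTop ×ˢ 𝓝 y₀, ContDiffAt ℝ 2 (F q.1) q.2)
    (hE' : ∀ᶠ q : ℝ × Euc 3 in atTop ×ˢ 𝓝 y₀, ContDiffAt ℝ 2 (E q.1) q.2) :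
    JetTendsto (fun a y => F a y + E a y) f y₀ := by
  have d1 : ∀ {g : Euc 3 → ℝ} {y : Euc 3}, ContDiffAt ℝ 2 g y → DifferentiableAt ℝ g y :=
    fun h => h.differentiableAt (by norm_num)
  have d2 : ∀ {g : Euc 3 → ℝ} {y : Euc 3} (l : Fin 3), ContDiffAt ℝ 2 g y →
      DifferentiableAt ℝ (pd l g) y :=
    fun l h => (h.pd (l := 1) l (by norm_num)).differentiableAt (by norm_num)
  refine ⟨?_, fun k => ?_, fun k l => ?_⟩
  · simpa using h.val.add hE.val
  · have := (h.pd₁ k).add (hE.pd₁ k)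
    rw [pd_const, _root_.add_zero] at this
    refine this.congr' ?_
    filter_upwards [hF, hE'] with q h1 h2
    exact (pd_add k (d1 h1) (d1 h2)).symm
  · have := (h.pd₂ k l).add (hE.pd₂ k l)
    have hz : pd l (fun _ : Euc 3 => (0 : ℝ)) = fun _ => 0 := funext fun _ => pd_const l 0
    rw [hz, pd_const, _root_.add_zero] at this
    refine this.congr' ?_
    filter_upwards [hF, hE'] with q h1 h2
    have e : pd l (fun y => F q.1 y + E q.1 y) =ᶠ[𝓝 q.2]
        fun y => pd l (F q.1) y + pd l (E q.1) y := by
      filter_upwards [h1.eventually (by simp), h2.eventually (by simp)] with y h3 h4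
      exact pd_add l (d1 h3) (d1 h4)
    rw [pd_congr k e, pd_add k (d2 l h1) (d2 l h2)]

/-- The first order term `2 m yᵢ yⱼ / |y|³` of the Schwarzschild metric at infinity. -/
def schwarzschildLin (m : ℝ) : MetricField 3 := fun y =>
  Matrix.of fun i j => 2 * m * (y i * y j) / ‖y‖ ^ 3

/-- The family `(ĝᵢⱼ(y / ε) - δᵢⱼ) / ε`, extended smoothly to `ε = 0`. -/
def schwarzschildFamily (m : ℝ) (i j : Fin 3) (ε : ℝ) (y : Euc 3) : ℝ :=
  2 * m * (y i * y j) / (‖y‖ ^ 2 * (‖y‖ - 2 * m * ε))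

theorem contDiffAt_schwarzschildFamily (m : ℝ) (i j : Fin 3) {ε : ℝ} {y : Euc 3} (hy : y ≠ 0)
    (h : 2 * m * ε < ‖y‖) :
    ContDiffAt ℝ 2 (fun q : ℝ × Euc 3 => schwarzschildFamily m i j q.1 q.2) (ε, y) := by
  have hc : ∀ i : Fin 3, ContDiffAt ℝ 2 (fun q : ℝ × Euc 3 => q.2 i) (ε, y) := fun i =>
    ((EuclideanSpace.proj i : Euc 3 →L[ℝ] ℝ).contDiff.contDiffAt).comp _ contDiffAt_snd
  have hn : ContDiffAt ℝ 2 (fun q : ℝ × Euc 3 => ‖q.2‖) (ε, y) := contDiffAt_snd.norm ℝ hy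
  refine (contDiffAt_const.mul ((hc i).mul (hc j))).div ((hn.pow 2).mul
    (hn.sub (contDiffAt_const.mul contDiffAt_fst))) ?_
  exact mul_ne_zero (pow_ne_zero _ (norm_ne_zero_iff.mpr hy)) (sub_pos.mpr h).ne'

theorem schwarzschildFamily_inv {m a : ℝ} (ha : 0 < a) {y : Euc 3} (hy : y ≠ 0)
    (h : 2 * m * a⁻¹ < ‖y‖) (i j : Fin 3) :
    schwarzschildFamily m i j a⁻¹ y =
      a * (rescale (schwarzschild m) a y i j - (1 : Matrix (Fin 3) (Fin 3) ℝ) i j) := by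
  have hr : 0 < ‖y‖ := norm_pos_iff.mpr hy
  have h1 : ‖y‖ - 2 * m * a⁻¹ ≠ 0 := (sub_pos.mpr h).ne'
  have h2 : a * ‖y‖ - 2 * m ≠ 0 := by
    intro h0
    apply h1
    field_simp
    linarith
  have h3 : (1 - 2 * m / (a * ‖y‖))⁻¹ = a * ‖y‖ / (a * ‖y‖ - 2 * m) := by
    rw [one_sub_div (by positivity), inv_div]
  have h4 : (‖y‖ - 2 * m * a⁻¹) = (a * ‖y‖ - 2 * m) / a := by field_simp
  simp only [rescale, schwarzschild, Matrix.of_apply, Matrix.one_apply, add_sub_cancel_left,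
    norm_smul, Real.norm_of_nonneg ha.le, PiLp.smul_apply, smul_eq_mul, schwarzschildFamily]
  rw [h3, h4]
  obtain ⟨D, hD⟩ : ∃ D, a * ‖y‖ - 2 * m = D := ⟨_, rfl⟩
  rw [hD] at h2 ⊢
  field_simp
  rw [← hD]
  ring

theorem schwarzschildFamily_zero (m : ℝ) (i j : Fin 3) :
    schwarzschildFamily m i j 0 = fun y => schwarzschildLin m y i j := by
  funext y
  simp only [schwarzschildFamily, schwarzschildLin, Matrix.of_apply, mul_zero, sub_zero]
  congr 1

theorem contDiffAt_schwarzschild {m : ℝ} {x : Euc 3} (h : 2 * |m| < ‖x‖) (i j : Fin 3) :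
    ContDiffAt ℝ 2 (fun y => schwarzschild m y i j) x := by
  have hx : x ≠ 0 := norm_pos_iff.mp (lt_of_le_of_lt (by positivity) h)
  have hr : ‖x‖ ≠ 0 := norm_ne_zero_iff.mpr hx
  have hn : ContDiffAt ℝ 2 (fun y : Euc 3 => ‖y‖) x := contDiffAt_norm ℝ hx
  have hc : ∀ i : Fin 3, ContDiffAt ℝ 2 (fun y : Euc 3 => y i) x := fun i =>
    (EuclideanSpace.proj i : Euc 3 →L[ℝ] ℝ).contDiff.contDiffAt
  have h1 : 1 - 2 * m / ‖x‖ ≠ 0 := by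
    rw [one_sub_div hr]
    exact div_ne_zero (by linarith [le_abs_self m]) hr
  exact contDiffAt_const.add (((((contDiffAt_const.sub (contDiffAt_const.div hn hr)).inv h1).sub
    contDiffAt_const)).mul (((hc i).mul (hc j)).div (hn.pow 2) (pow_ne_zero _ hr)))

theorem schwarzschild_symm (m : ℝ) (x : Euc 3) (i j : Fin 3) :
    schwarzschild m x i j = schwarzschild m x j i := by
  simp only [schwarzschild, Matrix.of_apply, eq_comm (a := i), mul_comm (x i)]

theorem eventually_mul_inv_lt (m : ℝ) (hy : y₀ ≠ 0) :
    ∀ᶠ q : ℝ × Euc 3 in atTop ×ˢ 𝓝 y₀, 0 < q.1 ∧ q.2 ≠ 0 ∧ 2 * m * q.1⁻¹ < ‖q.2‖ := by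
  have h1 : Tendsto (fun q : ℝ × Euc 3 => 2 * m * q.1⁻¹) (atTop ×ˢ 𝓝 y₀) (𝓝 0) := by
    simpa using (tendsto_inv_atTop_zero.comp tendsto_fst :
      Tendsto (fun q : ℝ × Euc 3 => q.1⁻¹) (atTop ×ˢ 𝓝 y₀) (𝓝 0)).const_mul (2 * m)
  filter_upwards [h1.eventually_lt tendsto_snd.norm (norm_pos_iff.mpr hy),
    tendsto_fst.eventually (eventually_gt_atTop (0 : ℝ)),
    tendsto_snd.eventually (isOpen_ne.mem_nhds hy)] with q h2 h3 h4
  exact ⟨h3, h4, h2⟩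

theorem jetTendsto_schwarzschild (m : ℝ) (hy : y₀ ≠ 0) (i j : Fin 3) :
    JetTendsto (fun a y => a * (rescale (schwarzschild m) a y i j -
      (1 : Matrix (Fin 3) (Fin 3) ℝ) i j)) (fun y => schwarzschildLin m y i j) y₀ := by
  have h1 := JetTendsto.of_contDiffAt (contDiffAt_schwarzschildFamily m i j (ε := 0) hy
    (by simpa using hy))
  rw [schwarzschildFamily_zero] at h1
  refine h1.congr ?_
  filter_upwards [eventually_mul_inv_lt m hy] with q ⟨h2, h3, h4⟩
  filter_upwards [isOpen_ne.mem_nhds h3, (continuous_norm.tendsto _).eventually (lt_mem_nhds h4)]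
    with y h5 h6
  exact schwarzschildFamily_inv h2 h5 h6 i j

theorem hasExpansion_schwarzschild (m : ℝ) :
    HasExpansion (schwarzschild m) (schwarzschildLin m) where
  regular := ⟨2 * |m|, fun _ hx => ⟨contDiffAt_schwarzschild hx, schwarzschild_symm m _⟩⟩
  jet _ hy := jetTendsto_schwarzschild m hy

theorem tendsto_smul_cobounded (hy : y₀ ≠ 0) :
    Tendsto (fun q : ℝ × Euc 3 => q.1 • q.2) (atTop ×ˢ 𝓝 y₀) (Bornology.cobounded (Euc 3)) := by
  rw [← tendsto_norm_atTop_iff_cobounded]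
  have h2 : Tendsto (fun q : ℝ × Euc 3 => q.1 * ‖q.2‖) (atTop ×ˢ 𝓝 y₀) atTop :=
    tendsto_fst.atTop_mul_pos (norm_pos_iff.mpr hy) tendsto_snd.norm
  refine h2.congr' ?_
  filter_upwards [tendsto_fst.eventually (eventually_ge_atTop (0 : ℝ))] with q hq
  rw [norm_smul, Real.norm_of_nonneg hq]

theorem tendsto_of_decay {τ : Euc 3 → ℝ} {k : ℕ}
    (h : (fun x => ‖x‖ ^ k * ‖iteratedFDeriv ℝ k τ x‖) =O[Bornology.cobounded (Euc 3)]
      fun x => 1 / ‖x‖ ^ 2) (hy : y₀ ≠ 0) :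
    Tendsto (fun q : ℝ × Euc 3 => q.1 ^ (k + 1) * ‖iteratedFDeriv ℝ k τ (q.1 • q.2)‖)
      (atTop ×ˢ 𝓝 y₀) (𝓝 0) := by
  have hr : Tendsto (fun q : ℝ × Euc 3 => ‖q.2‖) (atTop ×ˢ 𝓝 y₀) (𝓝 ‖y₀‖) := tendsto_snd.norm
  have hr0 : ‖y₀‖ ≠ 0 := norm_ne_zero_iff.mpr hy
  obtain ⟨C, hC⟩ := (h.comp_tendsto (tendsto_smul_cobounded hy)).bound
  have hlim : Tendsto (fun q : ℝ × Euc 3 => C * (q.1⁻¹ * (‖q.2‖ ^ (k + 2))⁻¹))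
      (atTop ×ˢ 𝓝 y₀) (𝓝 0) := by
    have h1 : Tendsto (fun q : ℝ × Euc 3 => q.1⁻¹) (atTop ×ˢ 𝓝 y₀) (𝓝 0) :=
      tendsto_inv_atTop_zero.comp tendsto_fst
    simpa using (h1.mul ((hr.pow (k + 2)).inv₀ (pow_ne_zero _ hr0))).const_mul C
  refine squeeze_zero' ?_ ?_ hlim
  · filter_upwards [tendsto_fst.eventually (eventually_gt_atTop (0 : ℝ))] with q hq
    positivity
  · filter_upwards [hC, tendsto_fst.eventually (eventually_gt_atTop (0 : ℝ)),
      tendsto_snd.eventually (isOpen_ne.mem_nhds hy)] with q h1 h2 h3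
    have h4 : 0 < ‖q.2‖ := norm_pos_iff.mpr h3
    simp only [Function.comp_apply, norm_mul, norm_pow, norm_norm, norm_smul,
      Real.norm_of_nonneg h2.le, norm_div, norm_one] at h1
    have h5 : q.1 ^ (k + 1) * ‖iteratedFDeriv ℝ k τ (q.1 • q.2)‖ =
        q.1 * (‖q.2‖ ^ k)⁻¹ * ((q.1 * ‖q.2‖) ^ k * ‖iteratedFDeriv ℝ k τ (q.1 • q.2)‖) := by
      field_simp
      ring
    rw [h5]
    refine (mul_le_mul_of_nonneg_left h1 (by positivity)).trans_eq ?_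
    field_simp
    ring

/-- A perturbation that decays like `|x|⁻²`, with its derivatives, does not contribute. -/
theorem jetTendsto_zero_of_decay {τ : Euc 3 → ℝ} {ρ : ℝ}
    (hτ : ∀ x, ρ < ‖x‖ → ContDiffAt ℝ 2 τ x)
    (h : ∀ k : ℕ, k ≤ 2 → (fun x => ‖x‖ ^ k * ‖iteratedFDeriv ℝ k τ x‖)
      =O[Bornology.cobounded (Euc 3)] fun x => 1 / ‖x‖ ^ 2) (hy : y₀ ≠ 0) :
    JetTendsto (fun a y => a * τ (a • y)) (fun _ => 0) y₀ := by
  have hpos : ∀ᶠ q : ℝ × Euc 3 in atTop ×ˢ 𝓝 y₀, 0 < q.1 :=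
    tendsto_fst.eventually (eventually_gt_atTop (0 : ℝ))
  have e : ∀ i : Fin 3, ‖(EuclideanSpace.single i (1 : ℝ) : Euc 3)‖ = 1 := fun i => by simp
  refine ⟨?_, fun k => ?_, fun k l => ?_⟩
  · refine squeeze_zero_norm' ?_ (tendsto_of_decay (h 0 (by norm_num)) hy)
    filter_upwards [hpos] with q hq
    rw [norm_mul, Real.norm_of_nonneg hq.le, norm_iteratedFDeriv_zero, zero_add, pow_one]
  · rw [pd_const]
    refine squeeze_zero_norm' ?_ (tendsto_of_decay (h 1 (by norm_num)) hy)
    filter_upwards [hpos] with q hq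
    rw [pd_const_mul, pd_smul_arg, ← mul_assoc, norm_mul, norm_mul, Real.norm_of_nonneg hq.le,
      ← pow_two, norm_iteratedFDeriv_one]
    refine mul_le_mul_of_nonneg_left ?_ (by positivity)
    exact ((fderiv ℝ τ _).le_opNorm _).trans_eq (by rw [e, mul_one])
  · have hz : pd l (fun _ : Euc 3 => (0 : ℝ)) = fun _ => 0 := funext fun _ => pd_const l 0
    rw [hz, pd_const]
    refine squeeze_zero_norm' ?_ (tendsto_of_decay (h 2 le_rfl) hy)
    filter_upwards [hpos, (tendsto_norm_cobounded_atTop.comp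
      (tendsto_smul_cobounded hy)).eventually_gt_atTop ρ] with q hq h1
    have e1 : pd l (fun y => q.1 * τ (q.1 • y)) = fun y => q.1 ^ 2 * pd l τ (q.1 • y) := by
      funext y
      rw [pd_const_mul, pd_smul_arg]
      ring
    rw [e1, pd_const_mul, pd_smul_arg, ← mul_assoc, norm_mul, ← pow_succ,
      pd_pd_eq_fderiv_fderiv (hτ _ h1), Real.norm_of_nonneg (by positivity)]
    refine mul_le_mul_of_nonneg_left ?_ (by positivity)
    have h2 := (iteratedFDeriv ℝ 2 τ (q.1 • q.2)).le_opNorm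
      ![EuclideanSpace.single k (1 : ℝ), EuclideanSpace.single l (1 : ℝ)]
    rw [iteratedFDeriv_two_apply] at h2
    simpa [Fin.prod_univ_two] using h2

theorem hasExpansion_of_decay {G : MetricField 3} {m ρ : ℝ}
    (hG : ∀ x, ρ < ‖x‖ → (∀ i j, ContDiffAt ℝ 2 (fun y => G y i j) x) ∧ ∀ i j, G x i j = G x j i)
    (h : ∀ i j : Fin 3, ∀ k : ℕ, k ≤ 2 →
      (fun x => ‖x‖ ^ k * ‖iteratedFDeriv ℝ k (fun y => G y i j - schwarzschild m y i j) x‖)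
        =O[Bornology.cobounded (Euc 3)] fun x => 1 / ‖x‖ ^ 2) :
    HasExpansion G (schwarzschildLin m) where
  regular := ⟨ρ, hG⟩
  jet y₀ hy i j := by
    have hτ : ∀ x, max ρ (2 * |m|) < ‖x‖ →
        ContDiffAt ℝ 2 (fun y => G y i j - schwarzschild m y i j) x := fun x hx =>
      ((hG x ((le_max_left _ _).trans_lt hx)).1 i j).sub
        (contDiffAt_schwarzschild ((le_max_right _ _).trans_lt hx) i j)
    have hlarge := (tendsto_norm_cobounded_atTop.comp
      (tendsto_smul_cobounded hy)).eventually_gt_atTop (max ρ (2 * |m|))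
    have h1 := (jetTendsto_schwarzschild m hy i j).add_zero
      (jetTendsto_zero_of_decay hτ (h i j) hy)
      (hlarge.mono fun q hq => contDiffAt_const.mul (((contDiffAt_schwarzschild
        ((le_max_right _ _).trans_lt hq) i j).comp q.2
          (contDiff_const_smul q.1).contDiffAt).sub contDiffAt_const))
      (hlarge.mono fun q hq => contDiffAt_const.mul ((hτ _ hq).comp q.2
          (contDiff_const_smul q.1).contDiffAt))
    refine h1.congr (Eventually.of_forall fun q => Eventually.of_forall fun y => ?_)
    simp only [rescale]
    ring

end Schwarzschild

section Chart

variable {M : Type*} [TopologicalSpace M] [ChartedSpace (EuclideanSpace ℝ (Fin 3)) M]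
  [IsManifold (𝓡 3) ∞ M]

open Bundle in
/-- The chart at infinity is smooth and the metric is a `C³` section, so its components
are `C³`. -/
theorem contDiffAt_chartMetric
    (g : Bundle.ContMDiffRiemannianMetric (𝓡 3) 3 (EuclideanSpace ℝ (Fin 3))
      (fun p : M => TangentSpace (𝓡 3) p))
    {Φ : OpenPartialHomeomorph M (EuclideanSpace ℝ (Fin 3))}
    (hΦ : Φ ∈ IsManifold.maximalAtlas (𝓡 3) ∞ M) {x : Euc 3} (hx : x ∈ Φ.target) (i j : Fin 3) :
    ContDiffAt ℝ 3 (fun y => chartMetric g Φ y i j) x := by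
  have hΦs : ContMDiffOn (𝓡 3) (𝓡 3) ∞ Φ.symm Φ.target :=
    contMDiffOn_symm_of_mem_maximalAtlas hΦ
  have hnhds : Φ.target ∈ 𝓝 x := Φ.open_target.mem_nhds hx
  -- the coordinate vector fields are smooth sections of the tangent bundle along `Φ.symm`
  have hv : ∀ i : Fin 3, ContMDiffAt (𝓡 3) (𝓡 3).tangent 3
      (fun y => TotalSpace.mk' (EuclideanSpace ℝ (Fin 3)) (E := fun p : M => TangentSpace (𝓡 3) p)
        (Φ.symm y) (mfderiv (𝓡 3) (𝓡 3) Φ.symm y (EuclideanSpace.single i (1 : ℝ)))) x := by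
    intro i
    have h1 := hΦs.contMDiffOn_tangentMapWithin (m := 3) (by norm_cast)
      Φ.open_target.uniqueMDiffOn
    have h2 : ContMDiffAt (𝓡 3) (𝓡 3).tangent 3
        (fun y : Euc 3 => (⟨y, EuclideanSpace.single i (1 : ℝ)⟩ :
          TangentBundle (𝓡 3) (EuclideanSpace ℝ (Fin 3)))) x :=
      contMDiffAt_vectorSpace_iff_contDiffAt.mpr contDiffAt_const
    have h3 := ContMDiffWithinAt.comp x (h1 ⟨x, EuclideanSpace.single i (1 : ℝ)⟩ hx)
      (h2.contMDiffWithinAt (s := Φ.target)) (fun y hy => hy)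
    refine (h3.contMDiffAt hnhds).congr_of_eventuallyEq ?_
    filter_upwards [hnhds] with y hy
    simp only [Function.comp_apply, tangentMapWithin, mfderivWithin_of_isOpen Φ.open_target hy]
  have hb : ContMDiffAt (𝓡 3) (𝓡 3) 3 Φ.symm x :=
    ((hΦs x hx).contMDiffAt hnhds).of_le (by norm_cast)
  have h := ContMDiffAt.clm_bundle_apply₂ (F₁ := EuclideanSpace ℝ (Fin 3))
    (F₂ := EuclideanSpace ℝ (Fin 3)) (E₃ := Bundle.Trivial M ℝ) (F₃ := ℝ)
    (g.contMDiff.contMDiffAt.comp x hb) (hv i) (hv j)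
  simp only [contMDiffAt_totalSpace] at h
  exact contMDiffAt_iff_contDiffAt.mp h.2

theorem IsAsymptoticallySchwarzschild.hasExpansion {m : ℝ}
    {g : Bundle.ContMDiffRiemannianMetric (𝓡 3) 3 (EuclideanSpace ℝ (Fin 3))
      (fun p : M => TangentSpace (𝓡 3) p)}
    {Φ : OpenPartialHomeomorph M (EuclideanSpace ℝ (Fin 3))}
    (h : IsAsymptoticallySchwarzschild m g Φ) :
    HasExpansion (chartMetric g Φ) (schwarzschildLin m) := by
  obtain ⟨R₀, hR⟩ := h.target_eq
  refine hasExpansion_of_decay (ρ := R₀) (fun x hx => ⟨fun i j => ?_, fun i j => g.symm _ _ _⟩)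
    fun i j k hk => h.decay i j k (by omega)
  exact (contDiffAt_chartMetric g h.mem_maximalAtlas (by rw [hR]; exact hx) i j).of_le
    (by norm_num)

end Chart

/-! ### The linearized Ricci tensor of the Schwarzschild metric -/

section Linearized

variable {y : Euc 3}

theorem contDiffAt_norm_zpow (hy : y ≠ 0) (p : ℤ) :
    ContDiffAt ℝ 2 (fun w : Euc 3 => ‖w‖ ^ p) y := by
  have h := contDiffAt_norm ℝ (n := 2) hy
  have hn : ‖y‖ ≠ 0 := norm_ne_zero_iff.mpr hy
  cases p with
  | ofNat k => simpa using h.pow k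
  | negSucc k => simpa only [zpow_negSucc] using (h.pow (k + 1)).fun_inv (pow_ne_zero _ hn)

theorem pd_norm_zpow (hy : y ≠ 0) (p : ℤ) (k : Fin 3) :
    pd k (fun w : Euc 3 => ‖w‖ ^ p) y = p * y k * ‖y‖ ^ (p - 2) := by
  have hn : ‖y‖ ≠ 0 := norm_ne_zero_iff.mpr hy
  have h2 := (hasStrictFDerivAt_norm_sq y).hasFDerivAt
  have h1 := (contDiffAt_norm ℝ (n := 1) hy).differentiableAt (by norm_num)
  have e := (h1.hasFDerivAt.pow 2).unique h2
  have e1 : 2 * ‖y‖ * pd k (fun w : Euc 3 => ‖w‖) y = 2 * y k := by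
    simpa [pd, EuclideanSpace.inner_single_right] using
      DFunLike.congr_fun e (EuclideanSpace.single k (1 : ℝ))
  have h3 := (hasDerivAt_zpow p ‖y‖ (Or.inl hn)).comp_hasFDerivAt y h1.hasFDerivAt
  have e2 : pd k (fun w : Euc 3 => ‖w‖ ^ p) y =
      p * ‖y‖ ^ (p - 1) * pd k (fun w : Euc 3 => ‖w‖) y := by
    change fderiv ℝ ((fun t : ℝ => t ^ p) ∘ fun w : Euc 3 => ‖w‖) y _ = _
    rw [h3.fderiv]
    rfl
  have e3 : ‖y‖ ^ (p - 1) = ‖y‖ ^ (p - 2) * ‖y‖ := by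
    rw [← zpow_add_one₀ hn]; congr 1; ring
  rw [e2, e3]
  linear_combination (p : ℝ) * ‖y‖ ^ (p - 2) / 2 * e1

theorem pd_coord (i k : Fin 3) (y : Euc 3) :
    pd k (fun w : Euc 3 => w i) y = if i = k then 1 else 0 := by
  rw [pd_comp_coord (φ := fun t => t) k i (hasDerivAt_id _), one_mul]

theorem pd_coord_mul_coord (i j k : Fin 3) (y : Euc 3) :
    pd k (fun w : Euc 3 => w i * w j) y =
      (if i = k then 1 else 0) * y j + y i * if j = k then 1 else 0 := by
  rw [pd_mul k (differentiableAt_coord i y) (differentiableAt_coord j y), pd_coord, pd_coord]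

theorem pd_schwarzschildLin (m : ℝ) (hy : y ≠ 0) (i j k : Fin 3) :
    pd k (fun w => schwarzschildLin m w i j) y = 2 * m *
      (((if i = k then 1 else 0) * y j + y i * if j = k then 1 else 0) * ‖y‖ ^ (-3 : ℤ) +
        (-3) * (y i * y j * y k) * ‖y‖ ^ (-5 : ℤ)) := by
  have e : (fun w => schwarzschildLin m w i j) =
      fun w : Euc 3 => 2 * m * (w i * w j * ‖w‖ ^ (-3 : ℤ)) := by
    funext w
    simp only [schwarzschildLin, Matrix.of_apply, div_eq_mul_inv, mul_assoc]
    rfl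
  rw [e, pd_const_mul, pd_mul k ((differentiableAt_coord i y).fun_mul (differentiableAt_coord j y))
    ((contDiffAt_norm_zpow hy _).differentiableAt (by norm_num)), pd_coord_mul_coord,
    pd_norm_zpow hy, show (-3 : ℤ) - 2 = -5 from rfl]
  push_cast
  ring

theorem pd_pd_schwarzschildLin (m : ℝ) (hy : y ≠ 0) (i j k l : Fin 3) :
    pd l (pd k (fun w => schwarzschildLin m w i j)) y = 2 * m *
      (((if i = k then 1 else 0) * (if j = l then 1 else 0) +
          (if i = l then 1 else 0) * if j = k then 1 else 0) * ‖y‖ ^ (-3 : ℤ) +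
        (-3) * (((if i = k then 1 else 0) * y j + y i * if j = k then 1 else 0) * y l +
          (((if i = l then 1 else 0) * y j + y i * if j = l then 1 else 0) * y k +
            y i * y j * if k = l then 1 else 0)) * ‖y‖ ^ (-5 : ℤ) +
        15 * (y i * y j * y k * y l) * ‖y‖ ^ (-7 : ℤ)) := by
  have hc := fun i => differentiableAt_coord i y
  have hz := fun p : ℤ => (contDiffAt_norm_zpow hy p).differentiableAt (by norm_num)
  have e : pd k (fun w => schwarzschildLin m w i j) =ᶠ[𝓝 y] fun w => 2 * m *
      (((if i = k then 1 else 0) * w j + (if j = k then 1 else 0) * w i) * ‖w‖ ^ (-3 : ℤ) +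
        (-3) * ((w i * w j * w k) * ‖w‖ ^ (-5 : ℤ))) := by
    filter_upwards [isOpen_ne.mem_nhds hy] with w hw
    rw [pd_schwarzschildLin m hw]
    ring
  rw [pd_congr l e, pd_const_mul,
    pd_add l ((((hc j).const_mul _).fun_add ((hc i).const_mul _)).fun_mul (hz _))
      (((((hc i).fun_mul (hc j)).fun_mul (hc k)).fun_mul (hz _)).const_mul _),
    pd_mul l (((hc j).const_mul _).fun_add ((hc i).const_mul _)) (hz _),
    pd_add l ((hc j).const_mul _) ((hc i).const_mul _), pd_const_mul, pd_const_mul, pd_const_mul,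
    pd_mul l (((hc i).fun_mul (hc j)).fun_mul (hc k)) (hz _),
    pd_mul l ((hc i).fun_mul (hc j)) (hc k), pd_coord_mul_coord,
    pd_coord, pd_coord, pd_coord, pd_norm_zpow hy, pd_norm_zpow hy,
    show (-3 : ℤ) - 2 = -5 from rfl, show (-5 : ℤ) - 2 = -7 from rfl]
  push_cast
  ring

/-- The linearized Ricci tensor of the Schwarzschild metric: it is trace free, with the radial
eigenvalue `-2m / |y|³`. -/
theorem linRicci_schwarzschildLin (m : ℝ) (hy : y ≠ 0) (i j : Fin 3) :
    linRicci (schwarzschildLin m) i j y =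
      m / ‖y‖ ^ 3 * ((if i = j then 1 else 0) - 3 * (y i * y j) / ‖y‖ ^ 2) := by
  have hn : ‖y‖ ≠ 0 := norm_ne_zero_iff.mpr hy
  have hR := EuclideanSpace.real_norm_sq_eq y
  rw [Fin.sum_univ_three] at hR
  -- all powers of `|y|` are reduced to the lowest one, times powers of `|y|² = Σ yₖ²`
  have z3 : ‖y‖ ^ (-3 : ℤ) = (y 0 ^ 2 + y 1 ^ 2 + y 2 ^ 2) ^ 2 * ‖y‖ ^ (-7 : ℤ) := by
    rw [← hR, ← pow_mul, ← zpow_natCast, ← zpow_add₀ hn]; norm_num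
  have z5 : ‖y‖ ^ (-5 : ℤ) = (y 0 ^ 2 + y 1 ^ 2 + y 2 ^ 2) * ‖y‖ ^ (-7 : ℤ) := by
    rw [← hR, ← zpow_natCast, ← zpow_add₀ hn]; norm_num
  have e : m / ‖y‖ ^ 3 * ((if i = j then 1 else 0) - 3 * (y i * y j) / ‖y‖ ^ 2) =
      m * ((if i = j then 1 else 0) * ‖y‖ ^ (-3 : ℤ) - 3 * (y i * y j) * ‖y‖ ^ (-5 : ℤ)) := by
    rw [show ‖y‖ ^ (-3 : ℤ) = (‖y‖ ^ 3)⁻¹ from rfl, show ‖y‖ ^ (-5 : ℤ) = (‖y‖ ^ 5)⁻¹ from rfl]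
    field_simp
  rw [e]
  simp only [linRicci, pd_pd_schwarzschildLin m hy, Fin.sum_univ_three, z3, z5]
  generalize ‖y‖ ^ (-7 : ℤ) = q
  fin_cases i <;> fin_cases j <;> simp <;> ring

end Linearized

/-! ### Positivity of the limit -/

section Positivity

variable {b : ℝ}

theorem linMassDensity_schwarzschildLin (m : ℝ) (hb : b ≠ 0) {y : Euc 3} (hy : y ≠ 0) :
    linMassDensity (schwarzschildLin m) b y = 2 * m / ‖y‖ ^ 3 *
      (3 * (∑ i, y i * unitNormal (fun _ => 1) b i y) ^ 2 / ‖y‖ ^ 2 - 1) := by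
  have hn : ‖y‖ ≠ 0 := norm_ne_zero_iff.mpr hy
  have hR := EuclideanSpace.real_norm_sq_eq y
  have hpos := gradSq_pos (G := fun _ => 1) (b := b) Matrix.PosDef.one hb hy
  have hN : ∑ i, unitNormal (fun _ => 1) b i y ^ 2 = 1 := by
    have e : gradSq (fun _ => 1) b y = ∑ l, pd l (ellipsoidFun b) y ^ 2 := by
      simp [gradSq, Matrix.one_apply, sq]
    simp only [unitNormal_eq, inv_one, Matrix.one_apply, ite_mul, one_mul, zero_mul,
      Finset.sum_ite_eq, Finset.mem_univ, if_true, div_pow, ← Finset.sum_div,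
      Real.sq_sqrt hpos.le]
    rw [e]
    rw [e] at hpos
    exact div_self hpos.ne'
  simp only [linMassDensity, linRicci_schwarzschildLin m hy]
  rw [Fin.sum_univ_three] at hR hN
  simp only [Fin.sum_univ_three, if_true, Fin.reduceEq, if_false]
  generalize unitNormal (fun _ => 1) b 0 y = n0 at *
  generalize unitNormal (fun _ => 1) b 1 y = n1 at *
  generalize unitNormal (fun _ => 1) b 2 y = n2 at *
  generalize ‖y‖ = r at *
  field_simp
  linear_combination 3 * m * hR - 2 * m * r ^ 2 * hN

/-- The square of the support function `⟨y, n⟩` of the ellipsoid. -/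
theorem sum_mul_unitNormal_ellipsoidParam (hb : b ≠ 0) (u : Euc 2) :
    (∑ i, ellipsoidParam 1 b u i * unitNormal (fun _ => 1) b i (ellipsoidParam 1 b u)) ^ 2 =
      b ^ 2 / (Real.cos (u 0) ^ 2 + b ^ 2 * Real.sin (u 0) ^ 2) := by
  have hy := ellipsoidParam_ne_zero one_ne_zero hb u
  have hpos := gradSq_pos (G := fun _ => 1) (b := b) Matrix.PosDef.one hb hy
  simp only [unitNormal_eq, mul_div_assoc', ← Finset.sum_div, div_pow, Real.sq_sqrt hpos.le]
  have h1 := Real.sin_sq_add_cos_sq (u 0)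
  have h2 := Real.sin_sq_add_cos_sq (u 1)
  have e1 : gradSq (fun _ => 1) b (ellipsoidParam 1 b u) =
      4 * ((Real.cos (u 0) ^ 2 + b ^ 2 * Real.sin (u 0) ^ 2) / b ^ 2) := by
    simp [gradSq, Matrix.one_apply, Fin.sum_univ_three, pd_ellipsoidFun, ellipsoidParam]
    field_simp
    linear_combination 4 * b ^ 2 * Real.sin (u 0) ^ 2 * h2
  have e2 : (∑ i, ellipsoidParam 1 b u i * ∑ l, ((1 : Matrix (Fin 3) (Fin 3) ℝ))⁻¹ i l *
      pd l (ellipsoidFun b) (ellipsoidParam 1 b u)) = 2 := by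
    simp [Matrix.one_apply, Fin.sum_univ_three, pd_ellipsoidFun, ellipsoidParam]
    field_simp
    linear_combination Real.sin (u 0) ^ 2 * h2 + h1
  rw [e2, e1]
  rw [e1] at hpos
  have h3 : Real.cos (u 0) ^ 2 + b ^ 2 * Real.sin (u 0) ^ 2 ≠ 0 := by
    intro h; simp [h] at hpos
  field_simp
  norm_num

theorem det_inducedMetric_one (b : ℝ) (u : Euc 2) :
    (inducedMetric (fun _ => 1) 1 b u).det =
      Real.sin (u 0) ^ 2 * (Real.cos (u 0) ^ 2 + b ^ 2 * Real.sin (u 0) ^ 2) := by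
  have h2 := Real.sin_sq_add_cos_sq (u 1)
  rw [Matrix.det_fin_two]
  simp only [inducedMetric_apply, tangentVec_eq]
  simp [Matrix.one_apply, Fin.sum_univ_three]
  generalize Real.sin (u 1) = s at *
  generalize Real.cos (u 1) = c at *
  obtain h2 : s ^ 2 = 1 - c ^ 2 := by linarith
  ring_nf
  rw [show s ^ 4 = (s ^ 2) ^ 2 by ring, h2]
  ring

/-- The integral of a function invariant under rotations about the axis of the ellipsoid. -/
theorem paramIntegral_of_forall {F : Euc 2 → ℝ} {f : ℝ → ℝ}
    (h : ∀ u : Euc 2, 0 ≤ Real.sin (u 0) → F u = f (u 0)) :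
    paramIntegral F = 2 * Real.pi * ∫ θ in (0 : ℝ)..Real.pi, f θ := by
  rw [paramIntegral, ← intervalIntegral.integral_const_mul]
  refine intervalIntegral.integral_congr fun θ hθ => ?_
  rw [Set.uIcc_of_le Real.pi_pos.le] at hθ
  have hs := Real.sin_nonneg_of_mem_Icc hθ
  have e : ∀ φ : ℝ, F !₂[θ, φ] = f θ := fun φ => h !₂[θ, φ] hs
  simp [e]

theorem sqrt_det_inducedMetric_one (b : ℝ) {u : Euc 2} (hu : 0 ≤ Real.sin (u 0)) :
    √(inducedMetric (fun _ => 1) 1 b u).det =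
      √(Real.cos (u 0) ^ 2 + b ^ 2 * Real.sin (u 0) ^ 2) * Real.sin (u 0) := by
  rw [det_inducedMetric_one, Real.sqrt_mul (sq_nonneg _), Real.sqrt_sq hu, mul_comm]

theorem one_le_cos_sq_add (hb : 1 ≤ b) (θ : ℝ) :
    1 ≤ Real.cos θ ^ 2 + b ^ 2 * Real.sin θ ^ 2 := by
  nlinarith [Real.sin_sq_add_cos_sq θ, one_le_pow₀ (n := 2) hb, sq_nonneg (Real.sin θ)]

theorem one_le_sin_sq_add (hb : 1 ≤ b) (θ : ℝ) :
    1 ≤ Real.sin θ ^ 2 + b ^ 2 * Real.cos θ ^ 2 := by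
  nlinarith [Real.sin_sq_add_cos_sq θ, one_le_pow₀ (n := 2) hb, sq_nonneg (Real.cos θ)]

/-- The area element of the ellipsoid dominates that of the unit sphere. -/
theorem four_pi_le_area (hb : 1 ≤ b) :
    4 * Real.pi ≤ paramIntegral fun u => √(inducedMetric (fun _ => 1) 1 b u).det := by
  rw [paramIntegral_of_forall
    (f := fun θ => √(Real.cos θ ^ 2 + b ^ 2 * Real.sin θ ^ 2) * Real.sin θ)
    fun u hu => sqrt_det_inducedMetric_one b hu]
  have h : ∫ θ in (0 : ℝ)..Real.pi, Real.sin θ ≤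
      ∫ θ in (0 : ℝ)..Real.pi, √(Real.cos θ ^ 2 + b ^ 2 * Real.sin θ ^ 2) * Real.sin θ := by
    refine intervalIntegral.integral_mono_on Real.pi_pos.le
      (Real.continuous_sin.intervalIntegrable _ _)
      (Continuous.intervalIntegrable (by fun_prop) _ _) fun θ hθ => ?_
    exact le_mul_of_one_le_left (Real.sin_nonneg_of_mem_Icc hθ)
      (Real.one_le_sqrt.mpr (one_le_cos_sq_add hb θ))
  rw [integral_sin, Real.cos_zero, Real.cos_pi] at h
  nlinarith [Real.pi_pos]

/-- The integrand of the limit mass, divided by `2 m`, as a function of `p = |y|`,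
`q = √(cos²θ + b² sin²θ)`. -/
def massProfile (b p q : ℝ) : ℝ := (3 * b ^ 2 / (p ^ 2 * q ^ 2) - 1) * q / p ^ 3

theorem paramIntegral_linMassDensity (m : ℝ) (hb : b ≠ 0) :
    paramIntegral (fun u => linMassDensity (schwarzschildLin m) b (ellipsoidParam 1 b u) *
      √(inducedMetric (fun _ => 1) 1 b u).det) =
    4 * Real.pi * m * ∫ θ in (0 : ℝ)..Real.pi,
      massProfile b √(Real.sin θ ^ 2 + b ^ 2 * Real.cos θ ^ 2)
        √(Real.cos θ ^ 2 + b ^ 2 * Real.sin θ ^ 2) * Real.sin θ := by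
  rw [paramIntegral_of_forall (f := fun θ => 2 * m *
    (massProfile b √(Real.sin θ ^ 2 + b ^ 2 * Real.cos θ ^ 2)
        √(Real.cos θ ^ 2 + b ^ 2 * Real.sin θ ^ 2) * Real.sin θ))]
  · rw [intervalIntegral.integral_const_mul]; ring
  · intro u hu
    have hy := ellipsoidParam_ne_zero one_ne_zero hb u
    have hn : ‖ellipsoidParam 1 b u‖ ≠ 0 := norm_ne_zero_iff.mpr hy
    rw [linMassDensity_schwarzschildLin m hb hy, sum_mul_unitNormal_ellipsoidParam hb,
      sqrt_det_inducedMetric_one b hu, ← norm_sq_ellipsoidParam, Real.sqrt_sq (norm_nonneg _),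
      massProfile, Real.sq_sqrt (by positivity)]
    rw [← mul_div_assoc 3 (b ^ 2), div_div]
    rw [mul_comm (‖ellipsoidParam 1 b u‖ ^ 2)]
    ring

/-- A primitive of a lower bound of the profile, in the variable `t = cos θ`, with `p² = 1 + k t²`,
`q² = b² - k t²`, `k = b² - 1`. It is an odd function of `t`. -/
def profilePrimitive (b t : ℝ) : ℝ :=
  √(b ^ 2 - (b ^ 2 - 1) * t ^ 2) * (t / √(1 + (b ^ 2 - 1) * t ^ 2) ^ 3 +
    t / √(1 + (b ^ 2 - 1) * t ^ 2)) + t ^ 3 / 3 - t / √(1 + (b ^ 2 - 1) * t ^ 2) / b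

theorem hasDerivAt_profilePrimitive (b t : ℝ) {p q : ℝ} (hp : 0 < p) (hq : 0 < q)
    (hp2 : p ^ 2 = 1 + (b ^ 2 - 1) * t ^ 2) (hq2 : q ^ 2 = b ^ 2 - (b ^ 2 - 1) * t ^ 2) :
    HasDerivAt (profilePrimitive b)
      ((1 - p ^ 4) / (q * p ^ 3) + 3 * q / p ^ 5 - q / p ^ 3 + t ^ 2 - 1 / (b * p ^ 3)) t := by
  have hP : √(1 + (b ^ 2 - 1) * t ^ 2) = p := by rw [← hp2, Real.sqrt_sq hp.le]
  have hQ : √(b ^ 2 - (b ^ 2 - 1) * t ^ 2) = q := by rw [← hq2, Real.sqrt_sq hq.le]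
  have dsq : HasDerivAt (fun t : ℝ => (b ^ 2 - 1) * t ^ 2) ((b ^ 2 - 1) * (2 * t)) t := by
    simpa using (hasDerivAt_pow 2 t).const_mul (b ^ 2 - 1)
  have dp := (dsq.const_add 1).sqrt (by rw [← hp2]; positivity)
  have dq := (dsq.const_sub (b ^ 2)).sqrt (by rw [← hq2]; positivity)
  rw [hP] at dp
  rw [hQ] at dq
  have d1 := (hasDerivAt_id t).fun_div dp (by rw [hP]; positivity)
  have d3 := (hasDerivAt_id t).fun_div (dp.fun_pow 3) (by rw [hP]; positivity)
  have dt : HasDerivAt (fun t : ℝ => t ^ 3 / 3) (t ^ 2) t := by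
    simpa using (hasDerivAt_pow 3 t).div_const 3
  have d := ((dq.fun_mul (d3.fun_add d1)).fun_add dt).fun_sub (d1.div_const b)
  refine d.congr_deriv ?_
  simp only [hP, hQ, id]
  have e : (b ^ 2 - 1) * (2 * t) * t = 2 * (p ^ 2 - 1) := by linear_combination -2 * hp2
  have e1 : (1 * p - t * ((b ^ 2 - 1) * (2 * t) / (2 * p))) / p ^ 2 = 1 / p ^ 3 := by
    field_simp
    linear_combination hp2
  have e3 : (1 * p ^ 3 - t * ((3 : ℕ) * p ^ (3 - 1) * ((b ^ 2 - 1) * (2 * t) / (2 * p)))) /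
      (p ^ 3) ^ 2 = (3 - 2 * p ^ 2) / p ^ 5 := by
    norm_num
    field_simp
    linear_combination 3 * hp2
  rw [e1, e3]
  have e4 : -((b ^ 2 - 1) * (2 * t)) / (2 * q) * (t / p ^ 3 + t / p) =
      (1 - p ^ 4) / (q * p ^ 3) := by
    field_simp
    linear_combination (1 + p ^ 2) * hp2
  rw [e4]
  rw [div_div (1 : ℝ), mul_comm (p ^ 3) b]
  field_simp
  ring

/-- The derivative of `profilePrimitive` is a lower bound of the profile. The difference is
`3 (p² - 1) / (p⁵ q) + (1 / q - 1 / b) (p - 1 / p³) + (p / b - t²)`, where `1 ≤ p`, `q ≤ b` and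
`b t² ≤ b |t| ≤ p`. -/
theorem le_massProfile (hb : 1 ≤ b) {t p q : ℝ} (hp : 0 < p) (hq : 0 < q) (ht : t ^ 2 ≤ 1)
    (hp2 : p ^ 2 = 1 + (b ^ 2 - 1) * t ^ 2) (hq2 : q ^ 2 = b ^ 2 - (b ^ 2 - 1) * t ^ 2) :
    (1 - p ^ 4) / (q * p ^ 3) + 3 * q / p ^ 5 - q / p ^ 3 + t ^ 2 - 1 / (b * p ^ 3) ≤
      massProfile b p q := by
  have hb0 : 0 < b := by linarith
  have hb2 : 1 ≤ b ^ 2 := one_le_pow₀ hb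
  have hp1 : 1 ≤ p := (one_le_sq_iff₀ hp.le).mp (by rw [hp2]; nlinarith [sq_nonneg t])
  have hqb : q ≤ b := (sq_le_sq₀ hq.le hb0.le).mp (by rw [hq2]; nlinarith [sq_nonneg t])
  have hpt : b * |t| ≤ p := by
    refine (sq_le_sq₀ (by positivity) hp.le).mp ?_
    rw [mul_pow, sq_abs, hp2]
    linarith
  have htt : t ^ 2 ≤ |t| := by
    rw [← sq_abs] at ht ⊢
    nlinarith [abs_nonneg t, (sq_le_one_iff₀ (abs_nonneg t)).mp ht]
  have key : massProfile b p q - ((1 - p ^ 4) / (q * p ^ 3) + 3 * q / p ^ 5 - q / p ^ 3 + t ^ 2 -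
      1 / (b * p ^ 3)) = 3 * (p ^ 2 - 1) / (p ^ 5 * q) + (1 / q - 1 / b) * (p - 1 / p ^ 3) +
        (p / b - t ^ 2) := by
    have e : b ^ 2 = p ^ 2 + q ^ 2 - 1 := by linarith
    rw [massProfile, e]
    field_simp
    ring
  have h1 : 0 ≤ 3 * (p ^ 2 - 1) / (p ^ 5 * q) := by
    have : 1 ≤ p ^ 2 := one_le_pow₀ hp1
    exact div_nonneg (by linarith) (by positivity)
  have h2 : 0 ≤ (1 / q - 1 / b) * (p - 1 / p ^ 3) := by
    refine mul_nonneg (sub_nonneg.mpr (one_div_le_one_div_of_le hq hqb)) ?_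
    have : 1 / p ^ 3 ≤ 1 := (div_le_one (by positivity)).mpr (one_le_pow₀ hp1)
    linarith
  have h3 : t ^ 2 ≤ p / b := by
    rw [le_div_iff₀ hb0]
    nlinarith
  linarith

theorem two_thirds_le_integral_massProfile (hb : 1 ≤ b) :
    2 / 3 ≤ ∫ θ in (0 : ℝ)..Real.pi,
      massProfile b √(Real.sin θ ^ 2 + b ^ 2 * Real.cos θ ^ 2)
        √(Real.cos θ ^ 2 + b ^ 2 * Real.sin θ ^ 2) * Real.sin θ := by
  have hb0 : 0 < b := by linarith
  set p : ℝ → ℝ := fun θ => √(Real.sin θ ^ 2 + b ^ 2 * Real.cos θ ^ 2) with hp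
  set q : ℝ → ℝ := fun θ => √(Real.cos θ ^ 2 + b ^ 2 * Real.sin θ ^ 2) with hq
  have hp0 : ∀ θ, 0 < p θ := fun θ =>
    Real.sqrt_pos.mpr (zero_lt_one.trans_le (one_le_sin_sq_add hb θ))
  have hq0 : ∀ θ, 0 < q θ := fun θ =>
    Real.sqrt_pos.mpr (zero_lt_one.trans_le (one_le_cos_sq_add hb θ))
  have hp2 : ∀ θ, p θ ^ 2 = 1 + (b ^ 2 - 1) * Real.cos θ ^ 2 := fun θ => by
    rw [hp, Real.sq_sqrt (by positivity)]
    linear_combination Real.sin_sq_add_cos_sq θ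
  have hq2 : ∀ θ, q θ ^ 2 = b ^ 2 - (b ^ 2 - 1) * Real.cos θ ^ 2 := fun θ => by
    rw [hq, Real.sq_sqrt (by positivity)]
    linear_combination b ^ 2 * Real.sin_sq_add_cos_sq θ
  have hd := fun θ => ((hasDerivAt_profilePrimitive b (Real.cos θ) (hp0 θ) (hq0 θ) (hp2 θ)
    (hq2 θ)).comp θ (Real.hasDerivAt_cos θ)).neg
  have hcp : Continuous p := by fun_prop
  have hcq : Continuous q := by fun_prop
  have hcont : Continuous fun θ => massProfile b (p θ) (q θ) * Real.sin θ := by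
    simp only [massProfile]
    refine Continuous.mul (Continuous.div₀ (Continuous.mul (Continuous.sub (Continuous.div₀
      continuous_const ((hcp.pow 2).mul (hcq.pow 2)) fun θ => ?_) continuous_const) hcq)
      (hcp.pow 3) fun θ => ?_) Real.continuous_sin
    · have := hp0 θ; have := hq0 θ; positivity
    · have := hp0 θ; positivity
  have h := intervalIntegral.sub_le_integral_of_hasDeriv_right_of_le Real.pi_pos.le
    (fun θ _ => (hd θ).continuousAt.continuousWithinAt)
    (fun θ _ => (hd θ).hasDerivWithinAt)
    (hcont.continuousOn.integrableOn_compact isCompact_Icc)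
    (fun θ hθ => by
      rw [mul_neg, neg_neg]
      exact mul_le_mul_of_nonneg_right
        (le_massProfile hb (hp0 θ) (hq0 θ) (Real.cos_sq_le_one θ) (hp2 θ) (hq2 θ))
        (Real.sin_pos_of_mem_Ioo hθ).le)
  refine le_trans ?_ h
  have e1 : profilePrimitive b 1 = 1 / b ^ 3 + 1 / b + 1 / 3 - 1 / b ^ 2 := by
    simp [profilePrimitive, Real.sqrt_sq hb0.le]
    field_simp
  have e2 : profilePrimitive b (-1) = -profilePrimitive b 1 := by
    simp only [profilePrimitive]; ring_nf
  simp only [Pi.neg_apply, Function.comp_apply, Real.cos_pi, Real.cos_zero, e2, e1]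
  have h1 : 1 / b ^ 2 ≤ 1 / b := one_div_le_one_div_of_le hb0 (by nlinarith)
  have h3 : 0 < 1 / b ^ 3 := by positivity
  linarith

/-- For the Schwarzschild metric of mass `m > 0` the limit mass of the ellipsoids is at least
`m / 6`, whatever their eccentricity. -/
theorem div_six_le_limit_mass {m : ℝ} (hm : 0 < m) (hb : 1 ≤ b) :
    m / 6 ≤ 1 / (8 * Real.pi) *
      √(paramIntegral (fun u => √(inducedMetric (fun _ => 1) 1 b u).det) / (16 * Real.pi)) *
      paramIntegral (fun u => linMassDensity (schwarzschildLin m) b (ellipsoidParam 1 b u) *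
        √(inducedMetric (fun _ => 1) 1 b u).det) := by
  rw [paramIntegral_linMassDensity m (by linarith)]
  have hpi := Real.pi_pos
  have h1 : 1 / 2 ≤
      √(paramIntegral (fun u => √(inducedMetric (fun _ => 1) 1 b u).det) / (16 * Real.pi)) := by
    refine Real.le_sqrt_of_sq_le ?_
    rw [le_div_iff₀ (by positivity)]
    linarith [four_pi_le_area hb]
  have h2 := two_thirds_le_integral_massProfile hb
  calc m / 6 = 1 / (8 * Real.pi) * (1 / 2) * (4 * Real.pi * m * (2 / 3)) := by
        field_simp; norm_num
    _ ≤ _ := by gcongr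

end Positivity

end HaywardMass

end

theorem mainTheorem3 (m : ℝ) :
    ∃ mInf : ℝ → ℝ,
      (∀ b : ℝ, 1 ≤ b →
        Filter.Tendsto (fun a : ℝ => HaywardMass.haywardMass (HaywardMass.schwarzschild m) a b)
          Filter.atTop (𝓝 (mInf b))) ∧
      (∀ (M : Type*) [TopologicalSpace M] [ChartedSpace (EuclideanSpace ℝ (Fin 3)) M]
        [IsManifold (𝓡 3) ∞ M]
        (g : Bundle.ContMDiffRiemannianMetric (𝓡 3) 3 (EuclideanSpace ℝ (Fin 3))
          (fun p : M => TangentSpace (𝓡 3) p))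
        (Φ : OpenPartialHomeomorph M (EuclideanSpace ℝ (Fin 3))),
        HaywardMass.IsAsymptoticallySchwarzschild m g Φ →
        ∀ b : ℝ, 1 ≤ b →
          Filter.Tendsto (fun a : ℝ => HaywardMass.haywardMass (HaywardMass.chartMetric g Φ) a b)
            Filter.atTop (𝓝 (mInf b))) ∧
      (0 < m → ∃ C : ℝ, 0 < C ∧ ∀ b : ℝ, 1 ≤ b → C ≤ mInf b) := by
  refine ⟨_, fun b hb => (HaywardMass.hasExpansion_schwarzschild m).tendsto_haywardMass hb,
    fun M _ _ _ g Φ h b hb => h.hasExpansion.tendsto_haywardMass hb, fun hm => ?_⟩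
  exact ⟨m / 6, by positivity, fun b hb => HaywardMass.div_six_le_limit_mass hm hb⟩
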